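/- **Setting.** Let $K,d\ge 0$ be integers and let $A=\{0,1,\dots,K\}$ be the set of actions. A parameter is $c=(\beta,\alpha)$ with $\beta_k\in\mathbb R^d$ and $\alpha_{k\ell}\in\mathbb R$ for $1\le k,\ell\le K$; put $\beta_0=0$ and $\alpha_{0\ell}=\alpha_{k0}=0$. For every $n$ there is one random directed network on the players $\{1,\dots,n\}$, with friend sets $F_i\not\ni i$ and $Q_i=\#F_i$, random covariates $X_i\in\mathbb R^d$, and random private shocks $\epsilon_i=(\epsilon_{i0},\dots,\epsilon_{iK})$. Write $\mathbb S=(X_i,F_i)_{i\le n}$ for the public information. The payoff of player $i$ from action $k$ is $$U_{ik}=X_i'\beta_k+\sum_{\ell=1}^K\alpha_{k\ell}\,\frac1{Q_i}\sum_{j\in F_i}\mathbb 1(Y_j=\ell)+\epsilon_{ik}$$ (the average over an empty set of friends is $0$). The observed actions are $Y_i=r_i^*(\epsilon_i\mid\mathbb S;\theta)$, where $\theta$ is the true parameter and $r^*$ is a Bayesian Nash equilibrium of the game in which $\mathbb S$ is public and $\epsilon_i$ is known to player $i$ only. For $h\ge 0$ let $N_{(i,0)}=\{i\}$ and $N_{(i,h)}=N_{(i,h-1)}\cup\bigcup_{j\in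 N_{(i,h-1)}}F_j$. Let $\mathbb G_{(i,h)}$ be the directed subgraph of all connections among the players of $N_{(i,h)}$, rooted at $i$ and taken up to isomorphism. Let $\sigma^h_{i}(\mathbb S;c)$ be the $i$-th component of the solution $(\sigma_{jk})_{j\in N_{(i,h)},\,k\in A}$ of $$\sigma_{jk}=\frac{\exp\Big[X_j'\beta_k+\sum_{\ell=1}^K\alpha_{k\ell}\frac1{Q_j}\sum_{j'\in F_j\cap N_{(i,h)}}\sigma_{j'\ell}\Big]}{1+\sum_{q=1}^K\exp\Big[X_j'\beta_q+\sum_{\ell=1}^K\alpha_{q\ell}\frac1{Q_j}\sum_{j'\in F_j\cap N_{(i,h)}}\sigma_{j'\ell}\Big]} .$$ The approximated maximum likelihood estimator $\hat\theta=\hat\theta_n$ is a maximizer over $c\in\Theta$ of $$\hat Q(c)=\frac1n\sum_{i=1}^n\sum_{k\in A}\mathbb 1(Y_i=k)\,\ln\sigma^{h}_{ik}(\mathbb S;c),\qquad h=h_n .$$ **Theorem.** Suppose that: 1. (extreme-value shocks) for every $n$ the $\epsilon_{ik}$ are i.i.d. across actions and players with density $e^{-t}\exp(-e^{-t})$, and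 they are independent of $\mathbb S$; 2. (rank condition) with $W_i=\big(X_i',\ \tfrac1{Q_i}\sum_{j\in F_i}\mathbb P(Y_j=\ell\mid\mathbb S),\ 1\le\ell\le K\big)'$, the matrix $\mathbb E(W_iW_i')$ is invertible for large $n$, in the sense that there is $\kappa>0$ with $\det\mathbb E(W_iW_i')\ge\kappa$ for all sufficiently large $n$ and all $i\le n$; 3. (compactness and boundedness) the parameter space $\Theta$ is compact, $\theta\in\Theta$, and the $(X_i,Q_i)$ are almost surely bounded by a constant that does not depend on $i$ and $n$; 4. (bounded interaction strength) $\displaystyle\frac K{K+1}\ \sup_{(\beta,\alpha)\in\Theta}\ \max_{k,m,\ell\in A}|\alpha_{k\ell}-\alpha_{m\ell}|<1$; 5. (network) for every $h$ there is a probability distribution $\mathbb P_{\mathbb G,h}$ such that for every $i$ the law of $\mathbb G_{(i,h)}$ converges to $\mathbb P_{\mathbb G,h}$ as $n\to\infty$; for all $n,h,i,j$, conditionally on $N_{(i,h)}\cap N_{(j,h)}=\emptyset$, the subgraphs $\mathbb G_{(i,h)}$ and $\mathbb G_{(j,h)}$ are independent; and for every $n$ the covariates $X_1,\dots,X_n$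 are i.i.d. and independent of the network; 6. (bounded in-degree) there is a constant $c_0$, not depending on $n$, such that almost surely $\max_{i\le n}\sum_{j\ne i}\mathbb 1(i\in F_j)\le c_0$; 7. $h=h_n\to\infty$ as $n\to\infty$. Then $\hat\theta_n\to\theta$ in probability as $n\to\infty$. -/

import Mathlib

open MeasureTheory ProbabilityTheory Filter Topology

noncomputable section

namespace NetworkGame

/-! ## Networks and rooted neighbourhoods -/

/-- A directed network on the players `Fin n`: `friends i` is the set `F_i` of best friends of
player `i`.  It never contains `i`; friendship need not be symmetric. -/
structure Network (n : ℕ) where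
  friends : Fin n → Finset (Fin n)
  irrefl : ∀ i, i ∉ friends i

/-- There are finitely many networks on `Fin n`; all sets of networks are events. -/
instance (n : ℕ) : MeasurableSpace (Network n) := ⊤

/-- The number `Q_i` of best friends of player `i`. -/
def Network.outDegree {n : ℕ} (G : Network n) (i : Fin n) : ℕ := (G.friends i).card

/-- The number of players who nominate `i` as a best friend. -/
def Network.inDegree {n : ℕ} (G : Network n) (i : Fin n) : ℕ :=
  (Finset.univ.filter fun j => i ∈ G.friends j).card

/-- The set `N_(i,h)` of players within (directed) distance `h` of player `i`. -/
def Network.ball {n : ℕ} (G : Network n) (i : Fin n) : ℕ → Finset (Fin n)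
  | 0 => {i}
  | h + 1 => G.ball i h ∪ (G.ball i h).biUnion G.friends

theorem Network.mem_ball_self {n : ℕ} (G : Network n) (i : Fin n) (h : ℕ) : i ∈ G.ball i h := by
  induction h with
  | zero => simp [Network.ball]
  | succ h ih => exact Finset.mem_union_left _ ih

/-- A finite directed graph with a distinguished vertex. -/
structure RootedDigraph where
  size : ℕ
  adj : Fin size → Fin size → Prop
  root : Fin size

/-- Isomorphism of rooted directed graphs. -/
def RootedDigraph.Iso (A B : RootedDigraph) : Prop :=
  ∃ e : Fin A.size ≃ Fin B.size, e A.root = B.root ∧ ∀ a b, A.adj a b ↔ B.adj (e a) (e b)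

instance RootedDigraph.setoid : Setoid RootedDigraph where
  r := RootedDigraph.Iso
  iseqv :=
    { refl := fun _ => ⟨Equiv.refl _, rfl, fun _ _ => Iff.rfl⟩
      symm := by
        rintro A B ⟨e, hr, he⟩
        refine ⟨e.symm, by rw [← hr, Equiv.symm_apply_apply], fun a b => ?_⟩
        rw [he, Equiv.apply_symm_apply, Equiv.apply_symm_apply]
      trans := by
        rintro A B C ⟨e, hr, he⟩ ⟨f, hs, hf⟩
        refine ⟨e.trans f, by simp [hr, hs], fun a b => ?_⟩
        rw [he, hf]
        rfl }

/-- Isomorphism classes of finite rooted directed graphs. -/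
def RootedClass : Type := Quotient RootedDigraph.setoid

/-- There are countably many isomorphism classes; all sets of classes are events. -/
instance : MeasurableSpace RootedClass := ⊤

/-- The subgraph of all connections among the players of `N_(i,h)`, rooted at `i`; the players are
renamed in an arbitrary way. -/
def Network.ego {n : ℕ} (G : Network n) (i : Fin n) (h : ℕ) : RootedDigraph where
  size := (G.ball i h).card
  adj a b := (((G.ball i h).equivFin.symm b : G.ball i h) : Fin n) ∈
    G.friends (((G.ball i h).equivFin.symm a : G.ball i h) : Fin n)
  root := (G.ball i h).equivFin ⟨i, G.mem_ball_self i h⟩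

/-- The subgraph `𝔾_(i,h)`, in which the identities of the players do not matter. -/
def Network.egoClass {n : ℕ} (G : Network n) (i : Fin n) (h : ℕ) : RootedClass :=
  Quotient.mk RootedDigraph.setoid (G.ego i h)

/-! ## Payoffs and equilibrium

Actions are `Fin (K + 1)`, action `0` being the reference action. -/

/-- The parameter `θ = (β, α)` with `β_k ∈ ℝ^d` and `α_{kℓ} ∈ ℝ` for `1 ≤ k, ℓ ≤ K`. -/
abbrev Param (K d : ℕ) : Type := (Fin K → Fin d → ℝ) × (Fin K → Fin K → ℝ)

/-- `β_k` for every action `k`, with `β_0 = 0`. -/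
def beta {K d : ℕ} (θ : Param K d) : Fin (K + 1) → Fin d → ℝ := Fin.cons 0 θ.1

/-- `α_{kℓ}` for all actions `k`, `ℓ`, with `α_{0ℓ} = α_{k0} = 0`. -/
def alpha {K d : ℕ} (θ : Param K d) : Fin (K + 1) → Fin (K + 1) → ℝ :=
  Fin.cons 0 fun k => Fin.cons 0 (θ.2 k)

/-- The payoff of a player with covariates `x`, friends `Fi` and shocks `e` from action `k` when
the actions are `y`:
`x'β_k + ∑_ℓ α_{kℓ} (1/Q) ∑_{j ∈ Fi} 1(y_j = ℓ) + e_k`. -/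
def payoff {K d n : ℕ} (θ : Param K d) (x : Fin d → ℝ) (Fi : Finset (Fin n))
    (y : Fin n → Fin (K + 1)) (e : Fin (K + 1) → ℝ) (k : Fin (K + 1)) : ℝ :=
  (∑ a, x a * beta θ k a)
    + (∑ ℓ, alpha θ k ℓ * ((1 / (Fi.card : ℝ)) * ∑ j ∈ Fi, if y j = ℓ then 1 else 0))
    + e k

/-- The extreme value distribution, with density `exp(-t) exp(-exp(-t))`. -/
def extremeValueLaw : Measure ℝ :=
  volume.withDensity fun t => ENNReal.ofReal (Real.exp (-t) * Real.exp (-Real.exp (-t)))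

/-- The law of the vector of action specific shocks of one player. -/
def shockLaw (K : ℕ) : Measure (Fin (K + 1) → ℝ) := Measure.pi fun _ => extremeValueLaw

/-- A profile of strategies, each of which maps the private shocks of a player to an action. -/
abbrev Profile (K n : ℕ) : Type := Fin n → (Fin (K + 1) → ℝ) → Fin (K + 1)

/-- The expected payoff of player `i` with shocks `e` from action `k` in the public state `(G, x)`,
when the other players' shocks are drawn independently from their law and they follow `r`.
(As `i` is not a friend of herself, only the actions of the other players matter.) -/
def expectedPayoff {K d n : ℕ} (θ : Param K d) (G : Network n) (x : Fin n → Fin d → ℝ)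
    (r : Profile K n) (i : Fin n) (e : Fin (K + 1) → ℝ) (k : Fin (K + 1)) : ℝ :=
  ∫ η : Fin n → Fin (K + 1) → ℝ,
    payoff θ (x i) (G.friends i) (fun j => r j (η j)) e k ∂(Measure.pi fun _ => shockLaw K)

/-- `r` is a Bayesian Nash equilibrium of the network game in the public state `(G, x)`. -/
def IsBNE {K d n : ℕ} (θ : Param K d) (G : Network n) (x : Fin n → Fin d → ℝ)
    (r : Profile K n) : Prop :=
  (∀ i, Measurable (r i)) ∧
    ∀ i e k, expectedPayoff θ G x r i e k ≤ expectedPayoff θ G x r i e (r i e)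

/-- The probability that player `j` chooses `ℓ` under the profile `r`. -/
def choiceProb {K n : ℕ} (r : Profile K n) (j : Fin n) (ℓ : Fin (K + 1)) : ℝ :=
  (shockLaw K).real {e | r j e = ℓ}

/-! ## The approximated maximum likelihood estimator -/

/-- `x_j'β_k + ∑_ℓ α_{kℓ} (1/Q_j) ∑_{j' ∈ F_j ∩ N} σ_{j'ℓ}`. -/
def logitIndex {K d n : ℕ} (c : Param K d) (G : Network n) (x : Fin n → Fin d → ℝ)
    (N : Finset (Fin n)) (σ : Fin n → Fin (K + 1) → ℝ) (j : Fin n) (k : Fin (K + 1)) : ℝ :=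
  (∑ a, x j a * beta c k a)
    + ∑ ℓ, alpha c k ℓ * ((1 / (G.outDegree j : ℝ)) * ∑ j' ∈ G.friends j ∩ N, σ j' ℓ)

/-- `σ` solves the system of choice probabilities of the game among the players of `N` only. -/
def SolvesSubgame {K d n : ℕ} (c : Param K d) (G : Network n) (x : Fin n → Fin d → ℝ)
    (N : Finset (Fin n)) (σ : Fin n → Fin (K + 1) → ℝ) : Prop :=
  ∀ j ∈ N, ∀ k, σ j k = Real.exp (logitIndex c G x N σ j k) /
    (1 + ∑ q : Fin K, Real.exp (logitIndex c G x N σ j q.succ))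

/-- `σ^h_i(𝕊; c)`: the choice probabilities of the central player `i` in the solution of the game
among the players of `N_(i,h)`. -/
def approxChoiceProb {K d n : ℕ} (c : Param K d) (G : Network n) (x : Fin n → Fin d → ℝ)
    (h : ℕ) (i : Fin n) : Fin (K + 1) → ℝ :=
  (Classical.epsilon fun σ : Fin n → Fin (K + 1) → ℝ => SolvesSubgame c G x (G.ball i h) σ) i

/-- The approximated log-likelihood
`(1/n) ∑_i ∑_k 1(y_i = k) ln σ^h_{ik}(𝕊; c)`. -/
def approxLogLik {K d n : ℕ} (h : ℕ) (G : Network n) (x : Fin n → Fin d → ℝ)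
    (y : Fin n → Fin (K + 1)) (c : Param K d) : ℝ :=
  (1 / (n : ℝ)) * ∑ i, ∑ k,
    (if y i = k then 1 else 0) * Real.log (approxChoiceProb c G x h i k)

/-! ## Assumptions on the data generating process -/

/-- All shocks are i.i.d. across actions and players with the extreme value law, and they are
independent of the public information `(F, X)`. -/
def ExtremeValueShocks {Ω : Type*} [MeasurableSpace Ω] (μ : Measure Ω) {K d n : ℕ}
    (F : Ω → Network n) (X : Ω → Fin n → Fin d → ℝ) (ξ : Ω → Fin n → Fin (K + 1) → ℝ) : Prop :=
  iIndepFun (fun (p : Fin n × Fin (K + 1)) ω => ξ ω p.1 p.2) μ ∧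
  (∀ i k, μ.map (fun ω => ξ ω i k) = extremeValueLaw) ∧
  IndepFun (fun ω => (F ω, X ω)) ξ μ

/-- The covariates are i.i.d. across players and independent of the network. -/
def IIDCovariates {Ω : Type*} [MeasurableSpace Ω] (μ : Measure Ω) {d n : ℕ}
    (F : Ω → Network n) (X : Ω → Fin n → Fin d → ℝ) : Prop :=
  iIndepFun (fun i ω => X ω i) μ ∧
  (∀ i j, IdentDistrib (fun ω => X ω i) (fun ω => X ω j) μ μ) ∧
  IndepFun F X μ

/-- For every radius `h`, the laws of the subgraphs `𝔾_(i,h)` converge, as the size of the network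
grows, to one and the same probability distribution for all players `i`. -/
def LocallyConvergent {Ω : ℕ → Type*} [∀ n, MeasurableSpace (Ω n)] (μ : ∀ n, Measure (Ω n))
    (F : ∀ n, Ω n → Network n) : Prop :=
  ∀ h : ℕ, ∃ P : PMF RootedClass, ∀ (i : ℕ) (g : RootedClass),
    Tendsto (fun n => if hi : i < n then (μ n).real {ω | (F n ω).egoClass ⟨i, hi⟩ h = g} else 0)
      atTop (𝓝 (P g).toReal)

/-- For every `h`, `i` and `j`, the subgraphs `𝔾_(i,h)` and `𝔾_(j,h)` are independent conditionally
on the event that they have no common player. -/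
def IndependentSubgraphs {Ω : Type*} [MeasurableSpace Ω] (μ : Measure Ω) {n : ℕ}
    (F : Ω → Network n) : Prop :=
  ∀ (h : ℕ) (i j : Fin n),
    IndepFun (fun ω => (F ω).egoClass i h) (fun ω => (F ω).egoClass j h)
      (cond μ {ω | Disjoint ((F ω).ball i h) ((F ω).ball j h)})

/-- The regressors `W_i = (X_i, (1/Q_i) ∑_{j ∈ F_i} P(Y_j = ℓ | 𝕊), 1 ≤ ℓ ≤ K)` when the players
use the profile `r` in the public state `(G, x)`. -/
def regressor {K d n : ℕ} (r : Profile K n) (G : Network n) (x : Fin n → Fin d → ℝ) (i : Fin n) :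
    Fin d ⊕ Fin K → ℝ :=
  Sum.elim (x i) fun ℓ =>
    (1 / (G.outDegree i : ℝ)) * ∑ j ∈ G.friends i, choiceProb r j ℓ.succ

/-- The matrix `E(W_i W_i')`. -/
def secondMoment {Ω : Type*} [MeasurableSpace Ω] (μ : Measure Ω) {K d n : ℕ}
    (r : Network n → (Fin n → Fin d → ℝ) → Profile K n)
    (F : Ω → Network n) (X : Ω → Fin n → Fin d → ℝ) (i : Fin n) :
    Matrix (Fin d ⊕ Fin K) (Fin d ⊕ Fin K) ℝ :=
  Matrix.of fun a b =>
    ∫ ω, regressor (r (F ω) (X ω)) (F ω) (X ω) i a * regressor (r (F ω) (X ω)) (F ω) (X ω) i b ∂μ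

end NetworkGame

end

/-!
Conditionally on the public information the actions are independent, and with extreme value shocks
a player takes action `k` with the logit probability `σ_ik(θ)` of the equilibrium
(`shockLaw_strictBest`, `choiceProb_eq_fullProb`). The bound on the strength of interaction makes the
best response map at every parameter a contraction in the norm `sup_j ∑_k |σ_jk|`, because the
derivative of the logit probabilities is controlled by the Gini index of a distribution on `K + 1`
actions, which is at most `K / (K + 1)` (`sum_abs_softmax_sub_le`, `sum_abs_step_sub_le`). Hence the
equilibrium `fullProb` exists and is unique, it is Lipschitz in the parameter, and it is approximated
at a geometric rate both by the games on balls and by iterated best responses.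

Consistency is the usual argument for maximum likelihood. As the estimator maximizes the approximated
likelihood, the average Kullback-Leibler divergence of the choice probabilities at the estimator from
those at `θ` is bounded by averages of conditionally centred residuals and by the error of
approximation (`divergence_le`). The residuals are small on a finite net of `Θ` by Chebyshev's
inequality (`measure_residual_ge_le`) and on all of `Θ` by the Lipschitz property. A small divergence
makes the log-odds at the estimator close to those at `θ` on average over players; the difference of
the log-odds is a linear combination of the regressors `W_i` up to an effect of the probabilities of
the friends, which the bounded in-degree controls (`sum_sq_coefDiff_le`).

It remains to see that the averages of `W_i W_i'` are uniformly positive definite. The rank condition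
gives this for the means, by compactness (`exists_forall_mul_le_quadratic`). For the deviation from
the means, `W_i` is replaced by its version after `t` rounds of best responses, which depends only on
the network and the covariates around `i`. The mean of such a local statistic given the network
depends on the isomorphism class of the neighbourhood alone, so that the conditional independence of
disjoint neighbourhoods bounds the covariance of two players by the probability that their
neighbourhoods meet (`abs_covariance_local_le`). By the bounds on the degrees each neighbourhood meets
boundedly many others, and the variance of the average is of order `1 / n`
(`measure_local_average_ge_le`).
-/

noncomputable section

namespace NetworkGame

/-! ### The logit choice probabilities -/

/-- The multinomial logit probabilities of the index vector `v`. -/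
def softmax {K : ℕ} (v : Fin (K + 1) → ℝ) (k : Fin (K + 1)) : ℝ :=
  Real.exp (v k) / ∑ q, Real.exp (v q)

theorem sum_exp_pos {K : ℕ} (v : Fin (K + 1) → ℝ) : 0 < ∑ q, Real.exp (v q) :=
  Finset.sum_pos (fun _ _ => Real.exp_pos _) Finset.univ_nonempty

theorem softmax_pos {K : ℕ} (v : Fin (K + 1) → ℝ) (k : Fin (K + 1)) : 0 < softmax v k :=
  div_pos (Real.exp_pos _) (sum_exp_pos v)

theorem sum_softmax {K : ℕ} (v : Fin (K + 1) → ℝ) : ∑ k, softmax v k = 1 := by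
  unfold softmax
  rw [← Finset.sum_div, div_self (sum_exp_pos v).ne']

theorem log_softmax_sub {K : ℕ} (v : Fin (K + 1) → ℝ) (k m : Fin (K + 1)) :
    Real.log (softmax v k) - Real.log (softmax v m) = v k - v m := by
  unfold softmax
  rw [Real.log_div (Real.exp_pos _).ne' (sum_exp_pos v).ne',
    Real.log_div (Real.exp_pos _).ne' (sum_exp_pos v).ne', Real.log_exp, Real.log_exp]
  ring

theorem le_softmax {K : ℕ} {v : Fin (K + 1) → ℝ} {b : ℝ} (hv : ∀ k, |v k| ≤ b)
    (k : Fin (K + 1)) : Real.exp (-b) / ((K + 1) * Real.exp b) ≤ softmax v k := by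
  unfold softmax
  have h1 : ∑ q, Real.exp (v q) ≤ (K + 1) * Real.exp b := by
    calc ∑ q, Real.exp (v q) ≤ ∑ _q : Fin (K + 1), Real.exp b :=
          Finset.sum_le_sum fun q _ => Real.exp_le_exp.2 (abs_le.1 (hv q)).2
      _ = (K + 1) * Real.exp b := by simp
  exact div_le_div₀ (Real.exp_pos _).le (Real.exp_le_exp.2 (abs_le.1 (hv k)).1) (sum_exp_pos v) h1

theorem continuous_softmax {K : ℕ} (k : Fin (K + 1)) :
    Continuous fun v : Fin (K + 1) → ℝ => softmax v k := by
  unfold softmax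
  exact Continuous.div (by fun_prop) (by fun_prop) fun v => (sum_exp_pos v).ne'

/-- A probability vector with `K + 1` entries has Gini index at most `K / (K + 1)`. -/
theorem sum_mul_one_sub_le {K : ℕ} {p : Fin (K + 1) → ℝ} (hp : ∑ k, p k = 1) :
    ∑ k, p k * (1 - p k) ≤ (K : ℝ) / (K + 1) := by
  have h1 := sq_sum_le_card_mul_sum_sq (s := (Finset.univ : Finset (Fin (K + 1)))) (f := p)
  rw [hp] at h1
  simp only [one_pow, Finset.card_univ, Fintype.card_fin, Nat.cast_add, Nat.cast_one] at h1
  have h2 : ∑ k, p k * (1 - p k) = 1 - ∑ k, p k ^ 2 := by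
    rw [← hp, ← Finset.sum_sub_distrib, hp]
    exact Finset.sum_congr rfl fun k _ => by ring
  have h3 : (0 : ℝ) < K + 1 := by positivity
  rw [h2, le_div_iff₀ h3]
  nlinarith

theorem hasDerivAt_softmax_line {K : ℕ} (v u : Fin (K + 1) → ℝ) (k : Fin (K + 1)) (t : ℝ) :
    HasDerivAt (fun s : ℝ => softmax (fun q => v q + s * u q) k)
      (softmax (fun q => v q + t * u q) k *
        (u k - ∑ m, softmax (fun q => v q + t * u q) m * u m)) t := by
  have hE : ∀ q, HasDerivAt (fun s : ℝ => Real.exp (v q + s * u q))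
      (Real.exp (v q + t * u q) * u q) t := fun q => by
    have : HasDerivAt (fun s : ℝ => v q + s * u q) (u q) t := by
      simpa using ((hasDerivAt_id t).mul_const (u q)).const_add (v q)
    exact this.exp
  have hS := HasDerivAt.fun_sum (u := Finset.univ) fun q _ => hE q
  have h := (hE k).div hS (sum_exp_pos fun q => v q + t * u q).ne'
  refine h.congr_deriv ?_
  have hpos := (sum_exp_pos fun q => v q + t * u q).ne'
  unfold softmax
  have : ∑ m, Real.exp (v m + t * u m) / (∑ q, Real.exp (v q + t * u q)) * u m
      = (∑ m, Real.exp (v m + t * u m) * u m) / ∑ q, Real.exp (v q + t * u q) := by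
    rw [Finset.sum_div]
    exact Finset.sum_congr rfl fun m _ => by ring
  rw [this]
  field_simp

/-- The Lipschitz bound behind the contraction: only the oscillation of `v - w` across actions
matters, and the constant is the largest Gini index of a distribution on `K + 1` actions. -/
theorem sum_abs_softmax_sub_le {K : ℕ} {v w : Fin (K + 1) → ℝ} {D : ℝ}
    (hD : ∀ k m, |(v k - w k) - (v m - w m)| ≤ D) :
    ∑ k, |softmax v k - softmax w k| ≤ (K : ℝ) / (K + 1) * D := by
  have hD0 : 0 ≤ D := (abs_nonneg _).trans (hD 0 0)
  set u : Fin (K + 1) → ℝ := fun q => v q - w q with hu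
  -- The signs turn the sum of absolute values into a scalar function of the position on the
  -- segment from `w` to `v`, to which the mean value inequality applies.
  set s : Fin (K + 1) → ℝ := fun k => SignType.sign (softmax v k - softmax w k) with hs
  have hs1 : ∀ k, |s k| ≤ 1 := fun k => by
    simp only [hs]
    rcases SignType.trichotomy (SignType.sign (softmax v k - softmax w k)) with h | h | h <;>
      simp [h]
  set P : ℝ → Fin (K + 1) → ℝ := fun t => softmax (fun q => w q + t * u q) with hP
  have hder : ∀ t ∈ Set.Icc (0 : ℝ) 1, HasDerivWithinAt (fun t => ∑ k, s k * P t k)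
      (∑ k, s k * (P t k * (u k - ∑ m, P t m * u m))) (Set.Icc 0 1) t := fun t _ =>
    (HasDerivAt.fun_sum fun k _ =>
      (hasDerivAt_softmax_line w u k t).const_mul (s k)).hasDerivWithinAt
  have hbound : ∀ t ∈ Set.Ico (0 : ℝ) 1,
      ‖∑ k, s k * (P t k * (u k - ∑ m, P t m * u m))‖ ≤ (K : ℝ) / (K + 1) * D := by
    intro t _
    have hsum : ∑ m, P t m = 1 := sum_softmax _
    have hpos : ∀ m, 0 ≤ P t m := fun m => (softmax_pos _ m).le
    have hin : ∀ k, |u k - ∑ m, P t m * u m| ≤ (1 - P t k) * D := fun k => by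
      have e1 : u k - ∑ m, P t m * u m = ∑ m ∈ Finset.univ.erase k, P t m * (u k - u m) := by
        have : u k - ∑ m, P t m * u m = ∑ m, P t m * (u k - u m) := by
          simp only [mul_sub, Finset.sum_sub_distrib, ← Finset.sum_mul, hsum, one_mul]
        rw [this, ← Finset.add_sum_erase _ _ (Finset.mem_univ k)]
        simp
      have e2 : 1 - P t k = ∑ m ∈ Finset.univ.erase k, P t m := by
        rw [← hsum, ← Finset.add_sum_erase _ _ (Finset.mem_univ k)]
        ring
      rw [e1, e2, Finset.sum_mul]
      refine (Finset.abs_sum_le_sum_abs _ _).trans (Finset.sum_le_sum fun m _ => ?_)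
      rw [abs_mul, abs_of_nonneg (hpos m)]
      exact mul_le_mul_of_nonneg_left (hD k m) (hpos m)
    calc ‖∑ k, s k * (P t k * (u k - ∑ m, P t m * u m))‖
        ≤ ∑ k, P t k * ((1 - P t k) * D) := by
          refine (norm_sum_le _ _).trans (Finset.sum_le_sum fun k _ => ?_)
          rw [Real.norm_eq_abs, abs_mul, abs_mul, abs_of_nonneg (hpos k)]
          calc |s k| * (P t k * |u k - ∑ m, P t m * u m|)
              ≤ 1 * (P t k * |u k - ∑ m, P t m * u m|) :=
                mul_le_mul_of_nonneg_right (hs1 k) (mul_nonneg (hpos k) (abs_nonneg _))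
            _ ≤ P t k * ((1 - P t k) * D) := by
                rw [one_mul]
                exact mul_le_mul_of_nonneg_left (hin k) (hpos k)
      _ = (∑ k, P t k * (1 - P t k)) * D := by
          rw [Finset.sum_mul]
          exact Finset.sum_congr rfl fun k _ => by ring
      _ ≤ (K : ℝ) / (K + 1) * D := mul_le_mul_of_nonneg_right (sum_mul_one_sub_le hsum) hD0
  have h := norm_image_sub_le_of_norm_deriv_le_segment_01' hder hbound
  have h1 : P 1 = softmax v := by
    simp only [hP, hu]
    congr 1
    ext q
    ring
  have h0 : P 0 = softmax w := by simp [hP]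
  rw [h1, h0, ← Finset.sum_sub_distrib] at h
  refine le_trans (le_of_eq ?_) ((le_abs_self _).trans h)
  refine Finset.sum_congr rfl fun k _ => ?_
  rw [← mul_sub]
  exact (sign_mul_self _).symm

/-! ### The extreme value distribution -/

theorem hasDerivAt_exp_neg_mul_exp_neg (C t : ℝ) :
    HasDerivAt (fun t : ℝ => Real.exp (-(C * Real.exp (-t))))
      (C * (Real.exp (-t) * Real.exp (-(C * Real.exp (-t))))) t := by
  have h1 : HasDerivAt (fun t : ℝ => Real.exp (-t)) (-Real.exp (-t)) t := by
    simpa using (hasDerivAt_neg t).exp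
  have h2 := ((h1.const_mul C).neg).exp
  refine h2.congr_deriv ?_
  simp only [Pi.neg_apply]
  ring

theorem tendsto_exp_neg_mul_exp_neg_atBot {C : ℝ} (hC : 0 < C) :
    Tendsto (fun t : ℝ => Real.exp (-(C * Real.exp (-t)))) atBot (𝓝 0) :=
  Real.tendsto_exp_neg_atTop_nhds_zero.comp
    ((Real.tendsto_exp_atTop.comp tendsto_neg_atBot_atTop).const_mul_atTop hC)

theorem tendsto_exp_neg_mul_exp_neg_atTop (C : ℝ) :
    Tendsto (fun t : ℝ => Real.exp (-(C * Real.exp (-t)))) atTop (𝓝 1) := by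
  have h : Tendsto (fun t : ℝ => -(C * Real.exp (-t))) atTop (𝓝 (-(C * 0))) :=
    (Real.tendsto_exp_neg_atTop_nhds_zero.const_mul C).neg
  have := (Real.continuous_exp.tendsto _).comp h
  rwa [mul_zero, neg_zero, Real.exp_zero] at this

theorem integrable_exp_neg_mul_exp_neg {C : ℝ} (hC : 0 < C) :
    Integrable fun t : ℝ => Real.exp (-t) * Real.exp (-(C * Real.exp (-t))) := by
  have hcont : Continuous fun t : ℝ => Real.exp (-t) * Real.exp (-(C * Real.exp (-t))) := by
    fun_prop
  refine integrable_of_intervalIntegral_norm_bounded (l := atTop) (a := fun n : ℕ => -(n : ℝ))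
    (b := fun n : ℕ => (n : ℝ)) (1 / C) (fun n => hcont.integrableOn_Ioc)
    (tendsto_neg_atTop_atBot.comp tendsto_natCast_atTop_atTop) tendsto_natCast_atTop_atTop
    (Eventually.of_forall fun n => ?_)
  have hd : ∀ t : ℝ, HasDerivAt (fun t : ℝ => Real.exp (-(C * Real.exp (-t))) / C)
      (Real.exp (-t) * Real.exp (-(C * Real.exp (-t)))) t := fun t => by
    refine ((hasDerivAt_exp_neg_mul_exp_neg C t).div_const C).congr_deriv ?_
    field_simp
  have hnorm : ∀ t : ℝ, ‖Real.exp (-t) * Real.exp (-(C * Real.exp (-t)))‖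
      = Real.exp (-t) * Real.exp (-(C * Real.exp (-t))) := fun t =>
    Real.norm_of_nonneg (by positivity)
  simp only [hnorm]
  rw [intervalIntegral.integral_eq_sub_of_hasDerivAt (fun t _ => hd t)
    (hcont.intervalIntegrable _ _)]
  have h1 : Real.exp (-(C * Real.exp (-(n : ℝ)))) ≤ 1 :=
    Real.exp_le_one_iff.2 (neg_nonpos.2 (by positivity))
  have h2 : 0 ≤ Real.exp (-(C * Real.exp (-(-(n : ℝ))))) / C := by positivity
  have h3 : Real.exp (-(C * Real.exp (-(n : ℝ)))) / C ≤ 1 / C := by gcongr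
  linarith

theorem lintegral_exp_neg_mul_exp_neg {C : ℝ} (hC : 0 < C) :
    ∫⁻ t : ℝ, ENNReal.ofReal (Real.exp (-t) * Real.exp (-(C * Real.exp (-t))))
      = ENNReal.ofReal (1 / C) := by
  have hd : ∀ t : ℝ, HasDerivAt (fun t : ℝ => Real.exp (-(C * Real.exp (-t))) / C)
      (Real.exp (-t) * Real.exp (-(C * Real.exp (-t)))) t := fun t => by
    refine ((hasDerivAt_exp_neg_mul_exp_neg C t).div_const C).congr_deriv ?_
    field_simp
  have hb : Tendsto (fun t : ℝ => Real.exp (-(C * Real.exp (-t))) / C) atBot (𝓝 (0 / C)) :=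
    (tendsto_exp_neg_mul_exp_neg_atBot hC).div_const C
  have ht : Tendsto (fun t : ℝ => Real.exp (-(C * Real.exp (-t))) / C) atTop (𝓝 (1 / C)) :=
    (tendsto_exp_neg_mul_exp_neg_atTop C).div_const C
  have hint := integrable_exp_neg_mul_exp_neg hC
  rw [← ofReal_integral_eq_lintegral_ofReal hint (ae_of_all _ fun t => by positivity),
    integral_of_hasDerivAt_of_tendsto hd hint hb ht]
  simp

/-- The distribution function of the extreme value law. -/
theorem extremeValueLaw_Iio (s : ℝ) :
    extremeValueLaw (Set.Iio s) = ENNReal.ofReal (Real.exp (-Real.exp (-s))) := by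
  have hd : ∀ t : ℝ, HasDerivAt (fun t : ℝ => Real.exp (-Real.exp (-t)))
      (Real.exp (-t) * Real.exp (-Real.exp (-t))) t := fun t => by
    simpa using hasDerivAt_exp_neg_mul_exp_neg 1 t
  have hb : Tendsto (fun t : ℝ => Real.exp (-Real.exp (-t))) atBot (𝓝 0) := by
    simpa using tendsto_exp_neg_mul_exp_neg_atBot one_pos
  have hint : Integrable fun t : ℝ => Real.exp (-t) * Real.exp (-Real.exp (-t)) := by
    simpa using integrable_exp_neg_mul_exp_neg one_pos
  unfold extremeValueLaw
  rw [withDensity_apply _ measurableSet_Iio, setLIntegral_congr Iio_ae_eq_Iic,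
    ← ofReal_integral_eq_lintegral_ofReal hint.integrableOn (ae_of_all _ fun t => by positivity),
    integral_Iic_of_hasDerivAt_of_tendsto' (fun t _ => hd t) hint.integrableOn hb]
  simp

instance : IsProbabilityMeasure extremeValueLaw := ⟨by
  have h := lintegral_exp_neg_mul_exp_neg one_pos
  unfold extremeValueLaw
  rw [withDensity_apply _ MeasurableSet.univ, setLIntegral_univ]
  simpa using h⟩

instance (K : ℕ) : IsProbabilityMeasure (shockLaw K) := by unfold shockLaw; infer_instance

/-- The shocks at which action `k` is the unique best action when its index vector is `v`. -/
def strictBest {K : ℕ} (v : Fin (K + 1) → ℝ) (k : Fin (K + 1)) : Set (Fin (K + 1) → ℝ) :=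
  {e | ∀ q, q ≠ k → v q + e q < v k + e k}

theorem measurableSet_strictBest {K : ℕ} (v : Fin (K + 1) → ℝ) (k : Fin (K + 1)) :
    MeasurableSet (strictBest v k) := by
  unfold strictBest
  simp only [Set.ofPred_forall]
  refine MeasurableSet.iInter fun q => MeasurableSet.iInter fun _ => ?_
  exact measurableSet_lt (by fun_prop) (by fun_prop)

/-- With extreme value shocks the choice probabilities are of logit form. Given `e_k = t`, action `k`
is best with probability `∏_{q ≠ k} exp (-exp (-(t + v_k - v_q)))`, and integrating over `t` leaves a
single exponential integral. -/
theorem shockLaw_strictBest {K : ℕ} (v : Fin (K + 1) → ℝ) (k : Fin (K + 1)) :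
    shockLaw K (strictBest v k) = ENNReal.ofReal (softmax v k) := by
  have hmp := (measurePreserving_piFinSuccAbove (fun _ : Fin (K + 1) => extremeValueLaw) k).symm
  unfold shockLaw
  rw [← hmp.measure_preimage (measurableSet_strictBest v k).nullMeasurableSet]
  have hmeas := hmp.measurable (measurableSet_strictBest v k)
  rw [Measure.prod_apply hmeas]
  have hslice : ∀ t : ℝ, (Measure.pi fun j : Fin K => extremeValueLaw)
      (Prod.mk t ⁻¹' ((MeasurableEquiv.piFinSuccAbove (fun _ : Fin (K + 1) => ℝ) k).symm ⁻¹'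
        strictBest v k))
      = ENNReal.ofReal (∏ j : Fin K, Real.exp (-Real.exp (-(t + v k - v (k.succAbove j))))) := by
    intro t
    have hset : Prod.mk t ⁻¹' ((MeasurableEquiv.piFinSuccAbove (fun _ : Fin (K + 1) => ℝ) k).symm
        ⁻¹' strictBest v k)
        = Set.pi Set.univ fun j : Fin K => Set.Iio (t + v k - v (k.succAbove j)) := by
      ext e
      simp only [Set.mem_preimage, strictBest, Set.mem_ofPred_eq, Set.mem_pi, Set.mem_univ,
        forall_true_left, Set.mem_Iio]
      rw [Fin.forall_iff_succAbove k]
      simp [MeasurableEquiv.piFinSuccAbove, Fin.insertNthEquiv]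
      refine forall_congr' fun j => ?_
      constructor <;> intro h <;> linarith
    rw [hset, Measure.pi_pi, ENNReal.ofReal_prod_of_nonneg fun _ _ => (Real.exp_pos _).le]
    exact Finset.prod_congr rfl fun j _ => extremeValueLaw_Iio _
  simp only [hslice]
  have hC : 0 < ∑ q, Real.exp (v q - v k) := sum_exp_pos fun q => v q - v k
  have hprod : ∀ t : ℝ, Real.exp (-t) * Real.exp (-Real.exp (-t)) *
      ∏ j : Fin K, Real.exp (-Real.exp (-(t + v k - v (k.succAbove j))))
      = Real.exp (-t) * Real.exp (-((∑ q, Real.exp (v q - v k)) * Real.exp (-t))) := by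
    intro t
    rw [← Real.exp_sum, mul_assoc, ← Real.exp_add, Fin.sum_univ_succAbove _ k]
    congr 2
    rw [sub_self, Real.exp_zero, add_mul, one_mul, neg_add, Finset.sum_mul,
      ← Finset.sum_neg_distrib]
    congr 1
    refine Finset.sum_congr rfl fun j _ => ?_
    rw [← Real.exp_add]
    congr 2
    ring
  have hm1 : Measurable fun t : ℝ => ENNReal.ofReal (Real.exp (-t) * Real.exp (-Real.exp (-t))) := by
    fun_prop
  have hm2 : Measurable fun t : ℝ =>
      ENNReal.ofReal (∏ j : Fin K, Real.exp (-Real.exp (-(t + v k - v (k.succAbove j))))) := by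
    fun_prop
  unfold extremeValueLaw
  rw [lintegral_withDensity_eq_lintegral_mul _ hm1 hm2]
  simp only [Pi.mul_apply]
  have : ∀ t : ℝ, ENNReal.ofReal (Real.exp (-t) * Real.exp (-Real.exp (-t))) *
      ENNReal.ofReal (∏ j : Fin K, Real.exp (-Real.exp (-(t + v k - v (k.succAbove j)))))
      = ENNReal.ofReal (Real.exp (-t) *
        Real.exp (-((∑ q, Real.exp (v q - v k)) * Real.exp (-t)))) := fun t => by
    rw [← ENNReal.ofReal_mul (by positivity), hprod]
  simp only [this]
  rw [lintegral_exp_neg_mul_exp_neg hC]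
  congr 1
  unfold softmax
  simp only [Real.exp_sub]
  rw [← Finset.sum_div]
  field_simp

/-! ### The system of choice probabilities -/

variable {K d n : ℕ}

theorem dist_beta_le (c c' : Param K d) (k : Fin (K + 1)) (a : Fin d) :
    |beta c k a - beta c' k a| ≤ dist c c' := by
  refine Fin.cases ?_ (fun k => ?_) k
  · simp [beta]
  · simp only [beta, Fin.cons_succ, ← Real.dist_eq]
    exact ((dist_le_pi_dist (c.1 k) (c'.1 k) a).trans (dist_le_pi_dist c.1 c'.1 k)).trans
      (le_max_left _ _)

theorem dist_alpha_le (c c' : Param K d) (k ℓ : Fin (K + 1)) :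
    |alpha c k ℓ - alpha c' k ℓ| ≤ dist c c' := by
  refine Fin.cases ?_ (fun k => ?_) k
  · simp [alpha]
  · refine Fin.cases ?_ (fun ℓ => ?_) ℓ
    · simp [alpha]
    · simp only [alpha, Fin.cons_succ, ← Real.dist_eq]
      exact ((dist_le_pi_dist (c.2 k) (c'.2 k) ℓ).trans (dist_le_pi_dist c.2 c'.2 k)).trans
        (le_max_right _ _)

theorem beta_zero_param (k : Fin (K + 1)) (a : Fin d) : beta (0 : Param K d) k a = 0 := by
  refine Fin.cases ?_ (fun k => ?_) k <;> simp [beta]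

theorem alpha_zero_param (k ℓ : Fin (K + 1)) : alpha (0 : Param K d) k ℓ = 0 := by
  refine Fin.cases ?_ (fun k => ?_) k
  · simp [alpha]
  · refine Fin.cases ?_ (fun ℓ => ?_) ℓ <;> simp [alpha]

/-- `c` satisfies the bound on the strength of interaction with constant `lam`. The case `k = m` gives
`0 ≤ lam`. -/
def StableAt (lam : ℝ) (c : Param K d) : Prop :=
  ∀ k m ℓ : Fin (K + 1), (K : ℝ) / (K + 1) * |alpha c k ℓ - alpha c m ℓ| ≤ lam

theorem logitIndex_zero (c : Param K d) (G : Network n) (x : Fin n → Fin d → ℝ)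
    (N : Finset (Fin n)) (σ : Fin n → Fin (K + 1) → ℝ) (j : Fin n) :
    logitIndex c G x N σ j 0 = 0 := by
  simp [logitIndex, beta, alpha]

theorem solvesSubgame_iff (c : Param K d) (G : Network n) (x : Fin n → Fin d → ℝ)
    (N : Finset (Fin n)) (σ : Fin n → Fin (K + 1) → ℝ) :
    SolvesSubgame c G x N σ ↔ ∀ j ∈ N, σ j = softmax (logitIndex c G x N σ j) := by
  unfold SolvesSubgame softmax
  refine forall₂_congr fun j _ => ?_
  rw [funext_iff, Fin.sum_univ_succ, logitIndex_zero, Real.exp_zero]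

/-- Averaging over `s` does not increase the `ℓ¹`-norm, also when the divisor `q` exceeds the number
of elements of `s`, as it does for the friends inside a ball. -/
theorem sum_abs_average_le {ι κ : Type*} [Fintype κ] (s : Finset ι) {q : ℝ}
    (hq : (s.card : ℝ) ≤ q) (u : ι → κ → ℝ) {D : ℝ} (hD0 : 0 ≤ D)
    (hD : ∀ j ∈ s, ∑ ℓ, |u j ℓ| ≤ D) :
    ∑ ℓ, |1 / q * ∑ j ∈ s, u j ℓ| ≤ D := by
  have hq0 : 0 ≤ q := (Nat.cast_nonneg _).trans hq
  calc ∑ ℓ, |1 / q * ∑ j ∈ s, u j ℓ| ≤ ∑ ℓ, 1 / q * ∑ j ∈ s, |u j ℓ| := by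
        refine Finset.sum_le_sum fun ℓ _ => ?_
        rw [abs_mul, abs_of_nonneg (by positivity : 0 ≤ 1 / q)]
        exact mul_le_mul_of_nonneg_left (Finset.abs_sum_le_sum_abs _ _) (by positivity)
    _ = 1 / q * ∑ j ∈ s, ∑ ℓ, |u j ℓ| := by rw [← Finset.mul_sum, Finset.sum_comm]
    _ ≤ 1 / q * ∑ _j ∈ s, D :=
        mul_le_mul_of_nonneg_left (Finset.sum_le_sum hD) (by positivity)
    _ = (s.card / q) * D := by rw [Finset.sum_const, nsmul_eq_mul]; ring
    _ ≤ 1 * D := mul_le_mul_of_nonneg_right (div_le_one_of_le₀ hq hq0) hD0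
    _ = D := one_mul D

theorem card_inter_le_outDegree (G : Network n) (N : Finset (Fin n)) (j : Fin n) :
    ((G.friends j ∩ N).card : ℝ) ≤ (G.outDegree j : ℝ) :=
  Nat.cast_le.2 (Finset.card_le_card Finset.inter_subset_left)

theorem abs_average_le {ι : Type*} (s : Finset ι) {q : ℝ} (hq : (s.card : ℝ) ≤ q) (u : ι → ℝ)
    {D : ℝ} (hD0 : 0 ≤ D) (hD : ∀ j ∈ s, |u j| ≤ D) : |1 / q * ∑ j ∈ s, u j| ≤ D := by
  simpa using sum_abs_average_le (κ := Unit) s hq (fun j _ => u j) hD0 (by simpa using hD)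

/-- One round of best responses contracts the distance of two profiles of choice probabilities. -/
theorem sum_abs_step_sub_le {lam : ℝ} {c : Param K d} (hc : StableAt lam c) (G : Network n)
    (x : Fin n → Fin d → ℝ) {N N' : Finset (Fin n)} {σ τ : Fin n → Fin (K + 1) → ℝ} {j : Fin n}
    (hN : G.friends j ∩ N = G.friends j ∩ N') {D : ℝ} (hD0 : 0 ≤ D)
    (hD : ∀ j' ∈ G.friends j ∩ N, ∑ ℓ, |σ j' ℓ - τ j' ℓ| ≤ D) :
    ∑ k, |softmax (logitIndex c G x N σ j) k - softmax (logitIndex c G x N' τ j) k| ≤ lam * D := by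
  have hlam : 0 ≤ lam := le_trans (by positivity) (hc 0 0 0)
  set w : Fin (K + 1) → ℝ := fun ℓ =>
    1 / (G.outDegree j : ℝ) * ∑ j' ∈ G.friends j ∩ N, (σ j' ℓ - τ j' ℓ) with hw
  have hw1 : ∑ ℓ, |w ℓ| ≤ D :=
    sum_abs_average_le _ (card_inter_le_outDegree G N j) (fun j' ℓ => σ j' ℓ - τ j' ℓ) hD0 hD
  have hdiff : ∀ k, logitIndex c G x N σ j k - logitIndex c G x N' τ j k
      = ∑ ℓ, alpha c k ℓ * w ℓ := fun k => by
    simp only [logitIndex, ← hN, hw, Finset.sum_sub_distrib]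
    rw [add_sub_add_left_eq_sub, ← Finset.sum_sub_distrib]
    exact Finset.sum_congr rfl fun ℓ _ => by ring
  -- For `K = 0` the factor `K / (K + 1)` vanishes and stability says nothing about `α`, but then
  -- there is a single action.
  rcases Nat.eq_zero_or_pos K with hK | hK
  · subst hK
    refine (sum_abs_softmax_sub_le (D := 0) fun k m => ?_).trans (by simpa using mul_nonneg hlam hD0)
    have hkm : k = m := Subsingleton.elim (α := Fin 1) k m
    simp [hkm]
  · have hK' : (0 : ℝ) < K := Nat.cast_pos.2 hK
    refine (sum_abs_softmax_sub_le (D := lam * (K + 1) / K * D) fun k m => ?_).trans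
      (le_of_eq (by field_simp))
    rw [hdiff, hdiff, ← Finset.sum_sub_distrib]
    calc |∑ ℓ, (alpha c k ℓ * w ℓ - alpha c m ℓ * w ℓ)|
        ≤ ∑ ℓ, lam * (K + 1) / K * |w ℓ| := by
          refine (Finset.abs_sum_le_sum_abs _ _).trans (Finset.sum_le_sum fun ℓ _ => ?_)
          rw [← sub_mul, abs_mul]
          refine mul_le_mul_of_nonneg_right ?_ (abs_nonneg _)
          have := hc k m ℓ
          rw [le_div_iff₀ hK']
          rw [div_mul_eq_mul_div, div_le_iff₀ (by positivity)] at this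
          linarith
      _ = lam * (K + 1) / K * ∑ ℓ, |w ℓ| := by rw [Finset.mul_sum]
      _ ≤ _ := mul_le_mul_of_nonneg_left hw1 (by positivity)

theorem abs_logitIndex_sub_le (c c' : Param K d) (G : Network n) {x : Fin n → Fin d → ℝ}
    {M : ℝ} (N : Finset (Fin n)) {τ : Fin n → Fin (K + 1) → ℝ} {j : Fin n}
    (hx : ∀ a, |x j a| ≤ M) (hτ : ∀ j k, |τ j k| ≤ 1) (k : Fin (K + 1)) :
    |logitIndex c G x N τ j k - logitIndex c' G x N τ j k| ≤ (d * M + (K + 1)) * dist c c' := by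
  have h1 : logitIndex c G x N τ j k - logitIndex c' G x N τ j k
      = ∑ a, x j a * (beta c k a - beta c' k a) + ∑ ℓ, (alpha c k ℓ - alpha c' k ℓ) *
        ((1 / (G.outDegree j : ℝ)) * ∑ j' ∈ G.friends j ∩ N, τ j' ℓ) := by
    simp only [logitIndex, mul_sub, sub_mul, Finset.sum_sub_distrib]
    ring
  have h2 : |∑ a, x j a * (beta c k a - beta c' k a)| ≤ d * M * dist c c' := by
    calc _ ≤ ∑ _a : Fin d, M * dist c c' := by
          refine (Finset.abs_sum_le_sum_abs _ _).trans (Finset.sum_le_sum fun a _ => ?_)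
          rw [abs_mul]
          exact mul_le_mul (hx a) (dist_beta_le c c' k a) (abs_nonneg _)
            ((abs_nonneg _).trans (hx a))
      _ = d * M * dist c c' := by simp; ring
  have h3 : |∑ ℓ, (alpha c k ℓ - alpha c' k ℓ) *
        ((1 / (G.outDegree j : ℝ)) * ∑ j' ∈ G.friends j ∩ N, τ j' ℓ)| ≤ (K + 1) * dist c c' := by
    calc _ ≤ ∑ _ℓ : Fin (K + 1), dist c c' * 1 := by
          refine (Finset.abs_sum_le_sum_abs _ _).trans (Finset.sum_le_sum fun ℓ _ => ?_)
          rw [abs_mul]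
          exact mul_le_mul (dist_alpha_le c c' k ℓ)
            (abs_average_le _ (card_inter_le_outDegree G N j) _ zero_le_one fun j' _ => hτ j' ℓ)
            (abs_nonneg _) dist_nonneg
      _ = (K + 1) * dist c c' := by simp
  rw [h1, add_mul]
  exact (abs_add_le _ _).trans (add_le_add h2 h3)

theorem abs_logitIndex_le {c : Param K d} {R : ℝ} (hR : ‖c‖ ≤ R) (G : Network n)
    {x : Fin n → Fin d → ℝ} {M : ℝ} (hM : 0 ≤ M) (N : Finset (Fin n))
    {τ : Fin n → Fin (K + 1) → ℝ} {j : Fin n}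
    (hx : ∀ a, |x j a| ≤ M) (hτ : ∀ j k, |τ j k| ≤ 1) (k : Fin (K + 1)) :
    |logitIndex c G x N τ j k| ≤ (d * M + (K + 1)) * R := by
  have h := abs_logitIndex_sub_le c 0 G N hx hτ k
  have h0 : logitIndex 0 G x N τ j k = 0 := by
    simp [logitIndex, beta_zero_param, alpha_zero_param]
  rw [h0, sub_zero, dist_zero_right] at h
  exact h.trans (mul_le_mul_of_nonneg_left hR (by positivity))

theorem sum_abs_step_param_sub_le (c c' : Param K d) (G : Network n) {x : Fin n → Fin d → ℝ}
    {M : ℝ} (hM : 0 ≤ M) (N : Finset (Fin n)) {τ : Fin n → Fin (K + 1) → ℝ} {j : Fin n}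
    (hx : ∀ a, |x j a| ≤ M) (hτ : ∀ j k, |τ j k| ≤ 1) :
    ∑ k, |softmax (logitIndex c G x N τ j) k - softmax (logitIndex c' G x N τ j) k|
      ≤ 2 * (d * M + (K + 1)) * dist c c' := by
  have hb := abs_logitIndex_sub_le c c' G N hx hτ
  have hB : 0 ≤ 2 * (d * M + (K + 1)) * dist c c' := by positivity
  refine (sum_abs_softmax_sub_le (D := 2 * (d * M + (K + 1)) * dist c c') fun k m => ?_).trans ?_
  · refine (abs_sub _ _).trans ?_
    linarith [hb k, hb m]
  · refine mul_le_of_le_one_left hB ?_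
    rw [div_le_one (by positivity)]
    linarith

/-! ### Solutions of the system and their approximation -/

/-- `σ` is a profile of probability vectors. -/
def IsProbProfile (σ : Fin n → Fin (K + 1) → ℝ) : Prop :=
  ∀ j, (∀ k, 0 ≤ σ j k) ∧ ∑ k, σ j k = 1

theorem sum_abs_sub_le_two {p q : Fin (K + 1) → ℝ} (hp : (∀ k, 0 ≤ p k) ∧ ∑ k, p k = 1)
    (hq : (∀ k, 0 ≤ q k) ∧ ∑ k, q k = 1) : ∑ k, |p k - q k| ≤ 2 := by
  calc ∑ k, |p k - q k| ≤ ∑ k, (p k + q k) := Finset.sum_le_sum fun k _ => by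
        rw [abs_le]
        constructor <;> linarith [hp.1 k, hq.1 k]
    _ = 2 := by rw [Finset.sum_add_distrib, hp.2, hq.2]; norm_num

theorem isProb_softmax (v : Fin (K + 1) → ℝ) :
    (∀ k, 0 ≤ softmax v k) ∧ ∑ k, softmax v k = 1 :=
  ⟨fun k => (softmax_pos v k).le, sum_softmax v⟩

theorem IsProbProfile.abs_le_one {σ : Fin n → Fin (K + 1) → ℝ} (hσ : IsProbProfile σ)
    (j : Fin n) (k : Fin (K + 1)) : |σ j k| ≤ 1 := by
  rw [abs_of_nonneg ((hσ j).1 k), ← (hσ j).2]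
  exact Finset.single_le_sum (fun q _ => (hσ j).1 q) (Finset.mem_univ k)

/-- The profiles obtained by iterating the best response map of the game among the players of `N`,
starting from uniform choices. -/
def iterProb (c : Param K d) (G : Network n) (x : Fin n → Fin d → ℝ) (N : Finset (Fin n)) :
    ℕ → Fin n → Fin (K + 1) → ℝ
  | 0 => fun _ => softmax 0
  | t + 1 => fun j => softmax (logitIndex c G x N (iterProb c G x N t) j)

theorem isProbProfile_iterProb (c : Param K d) (G : Network n) (x : Fin n → Fin d → ℝ)
    (N : Finset (Fin n)) (t : ℕ) : IsProbProfile (iterProb c G x N t) := fun j => by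
  cases t <;> exact isProb_softmax _

theorem sum_abs_iterProb_succ_sub_le {lam : ℝ} {c : Param K d} (hc : StableAt lam c)
    (G : Network n) (x : Fin n → Fin d → ℝ) (N : Finset (Fin n)) (t : ℕ) :
    ∀ j, ∑ k, |iterProb c G x N t j k - iterProb c G x N (t + 1) j k| ≤ 2 * lam ^ t := by
  have hlam : 0 ≤ lam := le_trans (by positivity) (hc 0 0 0)
  induction t with
  | zero =>
    intro j
    simpa using sum_abs_sub_le_two (isProbProfile_iterProb c G x N 0 j)
      (isProbProfile_iterProb c G x N 1 j)
  | succ t ih =>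
    intro j
    refine (sum_abs_step_sub_le hc G x rfl (by positivity) fun j' _ => ih j').trans
      (le_of_eq (by ring))

theorem continuous_logitIndex_profile (c : Param K d) (G : Network n) (x : Fin n → Fin d → ℝ)
    (N : Finset (Fin n)) (j : Fin n) :
    Continuous fun σ : Fin n → Fin (K + 1) → ℝ => logitIndex c G x N σ j := by
  unfold logitIndex
  fun_prop

theorem exists_tendsto_iterProb {lam : ℝ} (hlam1 : lam < 1) {c : Param K d} (hc : StableAt lam c)
    (G : Network n) (x : Fin n → Fin d → ℝ) (N : Finset (Fin n)) :
    ∃ σ, Tendsto (iterProb c G x N) atTop (𝓝 σ) ∧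
      ∀ j, σ j = softmax (logitIndex c G x N σ j) := by
  have hlam : 0 ≤ lam := le_trans (by positivity) (hc 0 0 0)
  have hcau : CauchySeq (iterProb c G x N) := by
    refine cauchySeq_of_le_geometric lam 2 hlam1 fun t => ?_
    refine (dist_pi_le_iff (by positivity)).2 fun j => (dist_pi_le_iff (by positivity)).2 fun k => ?_
    rw [Real.dist_eq]
    exact (Finset.single_le_sum (f := fun k =>
      |iterProb c G x N t j k - iterProb c G x N (t + 1) j k|) (fun q _ => abs_nonneg _)
      (Finset.mem_univ k)).trans (sum_abs_iterProb_succ_sub_le hc G x N t j)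
  obtain ⟨σ, hσ⟩ := cauchySeq_tendsto_of_complete hcau
  refine ⟨σ, hσ, fun j => funext fun k => ?_⟩
  have h1 : Tendsto (fun t => iterProb c G x N (t + 1) j k) atTop (𝓝 (σ j k)) :=
    ((continuous_apply k).tendsto _).comp (((continuous_apply j).tendsto _).comp
      (hσ.comp (tendsto_add_atTop_nat 1)))
  have h2 : Tendsto (fun t => iterProb c G x N (t + 1) j k) atTop
      (𝓝 (softmax (logitIndex c G x N σ j) k)) :=
    (((continuous_softmax k).comp (continuous_logitIndex_profile c G x N j)).tendsto σ).comp hσ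
  exact tendsto_nhds_unique h1 h2

theorem exists_solvesSubgame {lam : ℝ} (hlam1 : lam < 1) {c : Param K d} (hc : StableAt lam c)
    (G : Network n) (x : Fin n → Fin d → ℝ) (N : Finset (Fin n)) :
    ∃ σ, SolvesSubgame c G x N σ := by
  obtain ⟨σ, -, hσ⟩ := exists_tendsto_iterProb hlam1 hc G x N
  exact ⟨σ, (solvesSubgame_iff c G x N σ).2 fun j _ => hσ j⟩

/-- The iterated best responses approach any solution of the whole game geometrically fast. -/
theorem sum_abs_iterProb_sub_le {lam : ℝ} {c : Param K d} (hc : StableAt lam c)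
    {G : Network n} {x : Fin n → Fin d → ℝ} {σ : Fin n → Fin (K + 1) → ℝ}
    (hσ : SolvesSubgame c G x Finset.univ σ) (t : ℕ) :
    ∀ j, ∑ k, |iterProb c G x Finset.univ t j k - σ j k| ≤ 2 * lam ^ t := by
  have hlam : 0 ≤ lam := le_trans (by positivity) (hc 0 0 0)
  rw [solvesSubgame_iff] at hσ
  induction t with
  | zero =>
    intro j
    rw [hσ j (Finset.mem_univ j), pow_zero, mul_one]
    exact sum_abs_sub_le_two (isProb_softmax (K := K) 0) (isProb_softmax _)
  | succ t ih =>
    intro j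
    rw [hσ j (Finset.mem_univ j)]
    refine (sum_abs_step_sub_le hc G x rfl (by positivity) fun j' _ => ih j').trans
      (le_of_eq (by ring))

theorem eq_of_solvesSubgame_univ {lam : ℝ} (hlam1 : lam < 1) {c : Param K d} (hc : StableAt lam c)
    {G : Network n} {x : Fin n → Fin d → ℝ} {σ τ : Fin n → Fin (K + 1) → ℝ}
    (hσ : SolvesSubgame c G x Finset.univ σ) (hτ : SolvesSubgame c G x Finset.univ τ) : σ = τ := by
  have hlam : 0 ≤ lam := le_trans (by positivity) (hc 0 0 0)
  have key : ∀ ρ : Fin n → Fin (K + 1) → ℝ, SolvesSubgame c G x Finset.univ ρ →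
      Tendsto (iterProb c G x Finset.univ) atTop (𝓝 ρ) := fun ρ hρ => by
    refine tendsto_pi_nhds.2 fun j => tendsto_pi_nhds.2 fun k => ?_
    refine tendsto_iff_dist_tendsto_zero.2 (squeeze_zero (fun _ => dist_nonneg) (fun t => ?_)
      (by simpa using (tendsto_pow_atTop_nhds_zero_of_lt_one hlam hlam1).const_mul 2))
    rw [Real.dist_eq]
    exact (Finset.single_le_sum (f := fun k => |iterProb c G x Finset.univ t j k - ρ j k|)
      (fun q _ => abs_nonneg _) (Finset.mem_univ k)).trans (sum_abs_iterProb_sub_le hc hρ t j)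
  exact tendsto_nhds_unique (key σ hσ) (key τ hτ)

theorem ball_mono (G : Network n) (i : Fin n) : Monotone (G.ball i) :=
  monotone_nat_of_le_succ fun _ => Finset.subset_union_left

theorem friends_subset_ball_succ (G : Network n) {i j : Fin n} {s : ℕ} (hj : j ∈ G.ball i s) :
    G.friends j ⊆ G.ball i (s + 1) := fun _ hl =>
  Finset.mem_union_right _ (Finset.mem_biUnion.2 ⟨j, hj, hl⟩)

/-- The solution of the game among the players of a ball is close to that of the whole game, with
an error decaying geometrically in the distance to the boundary of the ball. -/
theorem sum_abs_ball_solution_sub_le {lam : ℝ} {c : Param K d} (hc : StableAt lam c)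
    {G : Network n} {x : Fin n → Fin d → ℝ} {i : Fin n} {h : ℕ} {σ τ : Fin n → Fin (K + 1) → ℝ}
    (hσ : SolvesSubgame c G x (G.ball i h) σ) (hτ : SolvesSubgame c G x Finset.univ τ) (s : ℕ)
    (hs : s ≤ h) : ∀ j ∈ G.ball i (h - s), ∑ k, |σ j k - τ j k| ≤ 2 * lam ^ s := by
  have hlam : 0 ≤ lam := le_trans (by positivity) (hc 0 0 0)
  rw [solvesSubgame_iff] at hσ hτ
  induction s with
  | zero =>
    intro j hj
    rw [hσ j hj, hτ j (Finset.mem_univ j)]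
    simpa using sum_abs_sub_le_two (isProb_softmax (K := K) _) (isProb_softmax _)
  | succ s ih =>
    intro j hj
    have hF : G.friends j ⊆ G.ball i (h - s) := by
      have := friends_subset_ball_succ G hj
      rwa [show h - (s + 1) + 1 = h - s by omega] at this
    rw [hσ j (ball_mono G i (by omega) hj), hτ j (Finset.mem_univ j)]
    have hFN : G.friends j ∩ G.ball i h = G.friends j ∩ Finset.univ := by
      rw [Finset.inter_univ]
      exact Finset.inter_eq_left.2 (hF.trans (ball_mono G i (by omega)))
    refine (sum_abs_step_sub_le hc G x hFN (by positivity) fun j' hj' => ?_).trans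
      (le_of_eq (by ring : lam * (2 * lam ^ s) = 2 * lam ^ (s + 1)))
    exact ih (by omega) j' (hF (Finset.mem_inter.1 hj').1)

/-- The choice probabilities in the equilibrium of the whole game at the parameter `c`. -/
def fullProb (c : Param K d) (G : Network n) (x : Fin n → Fin d → ℝ) : Fin n → Fin (K + 1) → ℝ :=
  Classical.epsilon fun σ => SolvesSubgame c G x Finset.univ σ

theorem solves_fullProb {lam : ℝ} (hlam1 : lam < 1) {c : Param K d} (hc : StableAt lam c)
    (G : Network n) (x : Fin n → Fin d → ℝ) :
    SolvesSubgame c G x Finset.univ (fullProb c G x) :=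
  Classical.epsilon_spec (exists_solvesSubgame hlam1 hc G x Finset.univ)

theorem fullProb_eq {lam : ℝ} (hlam1 : lam < 1) {c : Param K d} (hc : StableAt lam c)
    (G : Network n) (x : Fin n → Fin d → ℝ) (j : Fin n) :
    fullProb c G x j = softmax (logitIndex c G x Finset.univ (fullProb c G x) j) :=
  (solvesSubgame_iff _ _ _ _ _).1 (solves_fullProb hlam1 hc G x) j (Finset.mem_univ j)

theorem isProbProfile_fullProb {lam : ℝ} (hlam1 : lam < 1) {c : Param K d} (hc : StableAt lam c)
    (G : Network n) (x : Fin n → Fin d → ℝ) : IsProbProfile (fullProb c G x) := fun j => by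
  rw [fullProb_eq hlam1 hc]
  exact isProb_softmax _

theorem sum_abs_approxChoiceProb_sub_le {lam : ℝ} (hlam1 : lam < 1) {c : Param K d}
    (hc : StableAt lam c) (G : Network n) (x : Fin n → Fin d → ℝ) (h : ℕ) (i : Fin n) :
    ∑ k, |approxChoiceProb c G x h i k - fullProb c G x i k| ≤ 2 * lam ^ h :=
  sum_abs_ball_solution_sub_le hc
    (Classical.epsilon_spec (exists_solvesSubgame hlam1 hc G x (G.ball i h)))
    (solves_fullProb hlam1 hc G x) h le_rfl i (by simp [Network.ball])

theorem measurable_iterProb (c : Param K d) (G : Network n) (N : Finset (Fin n)) (t : ℕ) :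
    Measurable fun x : Fin n → Fin d → ℝ => iterProb c G x N t := by
  induction t with
  | zero => exact measurable_const
  | succ t ih =>
    refine measurable_pi_lambda _ fun j => measurable_pi_lambda _ fun k => ?_
    refine (continuous_softmax k).measurable.comp (measurable_pi_lambda _ fun q => ?_)
    have h : ∀ j' ℓ, Measurable fun x : Fin n → Fin d → ℝ => iterProb c G x N t j' ℓ := fun j' ℓ =>
      (measurable_pi_apply ℓ).comp ((measurable_pi_apply j').comp ih)
    unfold logitIndex
    fun_prop

theorem tendsto_iterProb {lam : ℝ} (hlam1 : lam < 1) {c : Param K d} (hc : StableAt lam c)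
    (G : Network n) (x : Fin n → Fin d → ℝ) :
    Tendsto (iterProb c G x Finset.univ) atTop (𝓝 (fullProb c G x)) := by
  obtain ⟨σ, h1, h2⟩ := exists_tendsto_iterProb hlam1 hc G x Finset.univ
  rwa [eq_of_solvesSubgame_univ hlam1 hc ((solvesSubgame_iff c G x _ σ).2 fun j _ => h2 j)
    (solves_fullProb hlam1 hc G x)] at h1

theorem measurable_fullProb {lam : ℝ} (hlam1 : lam < 1) {c : Param K d} (hc : StableAt lam c)
    (G : Network n) : Measurable fun x : Fin n → Fin d → ℝ => fullProb c G x :=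
  measurable_of_tendsto_metrizable (fun t => measurable_iterProb c G Finset.univ t)
    (tendsto_pi_nhds.2 fun x => tendsto_iterProb hlam1 hc G x)

theorem sum_abs_fullProb_sub_le {lam : ℝ} (hlam1 : lam < 1) {c c' : Param K d}
    (hc : StableAt lam c) (hc' : StableAt lam c') (G : Network n) {x : Fin n → Fin d → ℝ}
    {M : ℝ} (hM : 0 ≤ M) (hx : ∀ j a, |x j a| ≤ M) (j : Fin n) :
    ∑ k, |fullProb c G x j k - fullProb c' G x j k|
      ≤ 2 * (d * M + (K + 1)) / (1 - lam) * dist c c' := by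
  obtain ⟨m, -, hm⟩ := Finset.exists_max_image Finset.univ
    (fun j => ∑ k, |fullProb c G x j k - fullProb c' G x j k|) ⟨j, Finset.mem_univ j⟩
  refine (hm j (Finset.mem_univ j)).trans ?_
  set D := ∑ k, |fullProb c G x m k - fullProb c' G x m k| with hDdef
  have hD0 : 0 ≤ D := Finset.sum_nonneg fun _ _ => abs_nonneg _
  have h1 := sum_abs_step_sub_le hc G x (j := m) (N := Finset.univ) rfl hD0
    fun j' _ => hm j' (Finset.mem_univ j')
  have h2 := sum_abs_step_param_sub_le c c' G hM Finset.univ (hx m)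
    (isProbProfile_fullProb hlam1 hc' G x).abs_le_one
  have h3 : D ≤ lam * D + 2 * (d * M + (K + 1)) * dist c c' := by
    rw [hDdef]
    nth_rewrite 1 [fullProb_eq hlam1 hc G x m, fullProb_eq hlam1 hc' G x m]
    refine le_trans (Finset.sum_le_sum fun k _ => abs_sub_le _
      (softmax (logitIndex c G x Finset.univ (fullProb c' G x) m) k) _) ?_
    rw [Finset.sum_add_distrib]
    exact add_le_add h1 h2
  rw [div_mul_eq_mul_div, le_div_iff₀ (by linarith)]
  linarith

/-- A lower bound for all logit probabilities when covariates are bounded by `M` and parameters by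
`R`. -/
def probFloor (K d : ℕ) (M R : ℝ) : ℝ :=
  Real.exp (-((d * M + (K + 1)) * R)) / ((K + 1) * Real.exp ((d * M + (K + 1)) * R))

theorem probFloor_pos (K d : ℕ) (M R : ℝ) : 0 < probFloor K d M R := by
  unfold probFloor
  positivity

theorem probFloor_le_fullProb {lam : ℝ} (hlam1 : lam < 1) {c : Param K d}
    (hc : StableAt lam c) {R : ℝ} (hR : ‖c‖ ≤ R) (G : Network n) {x : Fin n → Fin d → ℝ}
    {M : ℝ} (hM : 0 ≤ M) (hx : ∀ j a, |x j a| ≤ M) (j : Fin n) (k : Fin (K + 1)) :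
    probFloor K d M R ≤ fullProb c G x j k := by
  rw [fullProb_eq hlam1 hc]
  exact le_softmax (fun k => abs_logitIndex_le hR G hM Finset.univ (hx j)
    (isProbProfile_fullProb hlam1 hc G x).abs_le_one k) k

theorem probFloor_le_approxChoiceProb {lam : ℝ} (hlam1 : lam < 1) {c : Param K d}
    (hc : StableAt lam c) {R : ℝ} (hR : ‖c‖ ≤ R) (G : Network n) {x : Fin n → Fin d → ℝ}
    {M : ℝ} (hM : 0 ≤ M) (hx : ∀ j a, |x j a| ≤ M) (h : ℕ) (i : Fin n) (k : Fin (K + 1)) :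
    probFloor K d M R ≤ approxChoiceProb c G x h i k := by
  set N := G.ball i h with hN
  set σ : Fin n → Fin (K + 1) → ℝ :=
    Classical.epsilon fun σ => SolvesSubgame c G x N σ with hσdef
  have hσ := (solvesSubgame_iff c G x N σ).1
    (Classical.epsilon_spec (exists_solvesSubgame hlam1 hc G x N))
  have hi : i ∈ N := G.mem_ball_self i h
  -- Outside the ball the chosen solution is arbitrary; only its values in the ball enter the index.
  set τ : Fin n → Fin (K + 1) → ℝ := fun j => if j ∈ N then σ j else softmax 0 with hτ
  have hτ1 : IsProbProfile τ := fun j => by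
    by_cases hj : j ∈ N
    · simp only [hτ, hj, if_true]
      rw [hσ j hj]
      exact isProb_softmax _
    · simp only [hτ, hj, if_false]
      exact isProb_softmax _
  have hidx : logitIndex c G x N σ i = logitIndex c G x N τ i := by
    ext q
    unfold logitIndex
    refine congrArg _ (Finset.sum_congr rfl fun ℓ _ => ?_)
    refine congrArg _ (congrArg _ (Finset.sum_congr rfl fun j' hj' => ?_))
    simp [hτ, (Finset.mem_inter.1 hj').2]
  have : approxChoiceProb c G x h i = softmax (logitIndex c G x N τ i) := by
    rw [← hidx]
    exact hσ i hi
  rw [this]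
  exact le_softmax (fun k => abs_logitIndex_le hR G hM N (hx i) hτ1.abs_le_one k) k

theorem abs_log_sub_log_le {p a b : ℝ} (hp : 0 < p) (ha : p ≤ a) (hb : p ≤ b) :
    |Real.log a - Real.log b| ≤ |a - b| / p := by
  have key : ∀ {a b : ℝ}, p ≤ a → p ≤ b → Real.log a - Real.log b ≤ |a - b| / p := by
    intro a b ha hb
    have ha0 := hp.trans_le ha
    have hb0 := hp.trans_le hb
    have h1 := Real.log_le_sub_one_of_pos (div_pos ha0 hb0)
    rw [Real.log_div ha0.ne' hb0.ne'] at h1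
    refine h1.trans ?_
    have h2 : a / b - 1 = (a - b) / b := by field_simp
    rw [h2]
    calc (a - b) / b ≤ |a - b| / b := by gcongr; exact le_abs_self _
      _ ≤ |a - b| / p := by gcongr
  rw [abs_le]
  constructor
  · have := key hb ha
    rw [abs_sub_comm] at this
    linarith
  · exact key ha hb

/-! ### The equilibrium -/

theorem expectedPayoff_eq {θ : Param K d} {G : Network n} {x : Fin n → Fin d → ℝ}
    {r : Profile K n} (hr : ∀ i, Measurable (r i)) (i : Fin n) (e : Fin (K + 1) → ℝ)
    (k : Fin (K + 1)) :
    expectedPayoff θ G x r i e k = logitIndex θ G x Finset.univ (choiceProb r) i k + e k := by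
  classical
  have hset : ∀ j ℓ, MeasurableSet {η : Fin n → Fin (K + 1) → ℝ | r j (η j) = ℓ} := fun j ℓ =>
    ((hr j).comp (measurable_pi_apply j)) (measurableSet_singleton ℓ)
  have hind : ∀ j ℓ, (fun η : Fin n → Fin (K + 1) → ℝ => if r j (η j) = ℓ then (1 : ℝ) else 0)
      = {η : Fin n → Fin (K + 1) → ℝ | r j (η j) = ℓ}.indicator fun _ => 1 := fun j ℓ => by
    ext η
    simp [Set.indicator_apply]
  have hint : ∀ j ℓ, Integrable
      (fun η : Fin n → Fin (K + 1) → ℝ => if r j (η j) = ℓ then (1 : ℝ) else 0)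
      (Measure.pi fun _ => shockLaw K) := fun j ℓ => by
    rw [hind]
    exact (integrable_const 1).indicator (hset j ℓ)
  have hval : ∀ j ℓ, ∫ η : Fin n → Fin (K + 1) → ℝ, (if r j (η j) = ℓ then (1 : ℝ) else 0)
      ∂(Measure.pi fun _ => shockLaw K) = choiceProb r j ℓ := fun j ℓ => by
    rw [hind, integral_indicator (hset j ℓ), setIntegral_const, smul_eq_mul, mul_one]
    unfold choiceProb Measure.real
    congr 1
    have hm : MeasurableSet {e | r j e = ℓ} := hr j (measurableSet_singleton ℓ)
    rw [← (measurePreserving_eval (fun _ : Fin n => shockLaw K) j).measure_preimage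
      hm.nullMeasurableSet]
    rfl
  have hterm : ∀ ℓ, Integrable (fun η : Fin n → Fin (K + 1) → ℝ => alpha θ k ℓ *
      ((1 / ((G.friends i).card : ℝ)) * ∑ j ∈ G.friends i, if r j (η j) = ℓ then 1 else 0))
      (Measure.pi fun _ => shockLaw K) := fun ℓ =>
    ((integrable_finsetSum _ fun j _ => hint j ℓ).const_mul _).const_mul _
  have hsum : ∀ ℓ, ∫ η : Fin n → Fin (K + 1) → ℝ, alpha θ k ℓ *
      ((1 / ((G.friends i).card : ℝ)) * ∑ j ∈ G.friends i, if r j (η j) = ℓ then 1 else 0)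
      ∂(Measure.pi fun _ => shockLaw K)
      = alpha θ k ℓ * ((1 / ((G.friends i).card : ℝ)) * ∑ j ∈ G.friends i, choiceProb r j ℓ) :=
    fun ℓ => by
      rw [integral_const_mul, integral_const_mul, integral_finsetSum _ fun j _ => hint j ℓ]
      simp only [hval]
  have hS := integrable_finsetSum Finset.univ fun ℓ _ => hterm ℓ
  have hadd : ∀ (a b : ℝ) (f : (Fin n → Fin (K + 1) → ℝ) → ℝ),
      Integrable f (Measure.pi fun _ => shockLaw K) →
      ∫ η, (a + f η + b) ∂(Measure.pi fun _ => shockLaw K)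
        = a + ∫ η, f η ∂(Measure.pi fun _ => shockLaw K) + b := fun a b f hf => by
    have hf' : Integrable (fun η => a + f η) (Measure.pi fun _ : Fin n => shockLaw K) :=
      (integrable_const a).add hf
    rw [integral_add hf' (integrable_const b), integral_add (integrable_const a) hf]
    simp
  unfold expectedPayoff payoff logitIndex
  refine (hadd _ _ _ hS).trans ?_
  rw [integral_finsetSum _ fun ℓ _ => hterm ℓ]
  simp only [hsum, Finset.inter_univ, Network.outDegree]

theorem eq_of_mem_strictBest {θ : Param K d} {G : Network n} {x : Fin n → Fin d → ℝ}
    {r : Profile K n} (hr : IsBNE θ G x r) {i : Fin n} {e : Fin (K + 1) → ℝ} {k : Fin (K + 1)}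
    (he : e ∈ strictBest (logitIndex θ G x Finset.univ (choiceProb r) i) k) : r i e = k := by
  by_contra hne
  have h1 := hr.2 i e k
  rw [expectedPayoff_eq hr.1, expectedPayoff_eq hr.1] at h1
  exact absurd (he _ hne) (not_lt.2 h1)

theorem disjoint_strictBest (v : Fin (K + 1) → ℝ) {k m : Fin (K + 1)} (hkm : k ≠ m)
    {e : Fin (K + 1) → ℝ} (hk : e ∈ strictBest v k) : e ∉ strictBest v m := fun hm =>
  lt_asymm (hk m hkm.symm) (hm k hkm)

/-- In equilibrium the choice probabilities solve the logit system: each one is at least the logit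
probability of being the unique best action, and both families sum to one. -/
theorem choiceProb_eq_softmax {θ : Param K d} {G : Network n} {x : Fin n → Fin d → ℝ}
    {r : Profile K n} (hr : IsBNE θ G x r) (i : Fin n) :
    choiceProb r i = softmax (logitIndex θ G x Finset.univ (choiceProb r) i) := by
  set v := logitIndex θ G x Finset.univ (choiceProb r) i with hv
  have hle : ∀ k, softmax v k ≤ choiceProb r i k := fun k => by
    have h1 : (shockLaw K).real (strictBest v k) = softmax v k := by
      rw [Measure.real, shockLaw_strictBest, ENNReal.toReal_ofReal (softmax_pos v k).le]
    rw [← h1]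
    exact measureReal_mono fun e he => eq_of_mem_strictBest hr he
  have hsum : ∑ k, choiceProb r i k = 1 := by
    have h := sum_measureReal_preimage_singleton (μ := shockLaw K) (f := r i) Finset.univ
      fun k _ => hr.1 i (measurableSet_singleton k)
    rw [Finset.coe_univ, Set.preimage_univ, probReal_univ] at h
    exact h
  have hall := (Finset.sum_eq_sum_iff_of_le fun k _ => hle k).1 ((sum_softmax v).trans hsum.symm)
  exact funext fun k => (hall k (Finset.mem_univ k)).symm

theorem choiceProb_eq_fullProb {lam : ℝ} (hlam1 : lam < 1) {θ : Param K d} (hθ : StableAt lam θ)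
    {G : Network n} {x : Fin n → Fin d → ℝ} {r : Profile K n} (hr : IsBNE θ G x r) :
    choiceProb r = fullProb θ G x :=
  eq_of_solvesSubgame_univ hlam1 hθ
    ((solvesSubgame_iff _ _ _ _ _).2 fun j _ => choiceProb_eq_softmax hr j)
    (solves_fullProb hlam1 hθ G x)

/-- The non-random part of the payoffs in equilibrium. -/
def eqIndex (c : Param K d) (G : Network n) (x : Fin n → Fin d → ℝ) (i : Fin n) :
    Fin (K + 1) → ℝ :=
  logitIndex c G x Finset.univ (fullProb c G x) i

theorem shockLaw_strictBest_eqIndex {lam : ℝ} (hlam1 : lam < 1) {c : Param K d}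
    (hc : StableAt lam c) (G : Network n) (x : Fin n → Fin d → ℝ) (i : Fin n) (k : Fin (K + 1)) :
    (shockLaw K).real (strictBest (eqIndex c G x i) k) = fullProb c G x i k := by
  rw [Measure.real, shockLaw_strictBest, ENNReal.toReal_ofReal (softmax_pos _ k).le,
    fullProb_eq hlam1 hc G x i]
  rfl

instance : Countable (Network n) :=
  Function.Injective.countable (f := Network.friends) fun G H h => by
    cases G
    cases H
    simpa using h

instance : MeasurableSingletonClass (Network n) := ⟨fun _ => trivial⟩

/-- The equilibrium probabilities are measurable in the public state, although nothing is assumed on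
how the equilibrium profile depends on it: they are the limit of iterated best responses. -/
theorem measurable_fullProb_prod {lam : ℝ} (hlam1 : lam < 1) {c : Param K d} (hc : StableAt lam c)
    (i : Fin n) (k : Fin (K + 1)) :
    Measurable fun S : Network n × (Fin n → Fin d → ℝ) => fullProb c S.1 S.2 i k :=
  measurable_from_prod_countable_right fun G =>
    (measurable_pi_apply k).comp ((measurable_pi_apply i).comp (measurable_fullProb hlam1 hc G))

theorem measurable_eqIndex_prod {lam : ℝ} (hlam1 : lam < 1) {c : Param K d} (hc : StableAt lam c)
    (i : Fin n) (k : Fin (K + 1)) :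
    Measurable fun S : Network n × (Fin n → Fin d → ℝ) => eqIndex c S.1 S.2 i k :=
  measurable_from_prod_countable_right fun G => by
    have h : ∀ j' ℓ, Measurable fun x : Fin n → Fin d → ℝ => fullProb c G x j' ℓ := fun j' ℓ =>
      (measurable_pi_apply ℓ).comp ((measurable_pi_apply j').comp (measurable_fullProb hlam1 hc G))
    simp only [eqIndex, logitIndex]
    fun_prop

/-! ### Averages of the choice residuals -/

section Noise

variable {Ω : Type*} [MeasurableSpace Ω] {μ : Measure Ω} [IsProbabilityMeasure μ]
  {F : Ω → Network n} {X : Ω → Fin n → Fin d → ℝ} {ξ : Ω → Fin n → Fin (K + 1) → ℝ}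

theorem map_shocks (hξ : Measurable ξ) (h : ExtremeValueShocks μ F X ξ) :
    μ.map ξ = Measure.pi fun _ => shockLaw K := by
  have hm : ∀ p : Fin n × Fin (K + 1), Measurable fun ω => ξ ω p.1 p.2 := fun p =>
    (measurable_pi_apply p.2).comp ((measurable_pi_apply p.1).comp hξ)
  have h1 := (iIndepFun_iff_map_fun_eq_pi_map fun p => (hm p).aemeasurable).1 h.1
  simp only [h.2.1] at h1
  have h2 := Measure.infinitePi_map_curry (X := ℝ)
    fun (_ : Fin n) (_ : Fin (K + 1)) => extremeValueLaw
  simp only [Measure.infinitePi_eq_pi] at h2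
  rw [← h1, Measure.map_map (MeasurableEquiv.measurable _) (measurable_pi_lambda _ hm)] at h2
  exact h2

theorem map_public_shocks (hF : Measurable F) (hX : Measurable X) (hξ : Measurable ξ)
    (h : ExtremeValueShocks μ F X ξ) :
    μ.map (fun ω => ((F ω, X ω), ξ ω))
      = (μ.map fun ω => (F ω, X ω)).prod (Measure.pi fun _ => shockLaw K) := by
  rw [← map_shocks hξ h]
  exact (indepFun_iff_map_prod_eq_prod_map_map (hF.prodMk hX).aemeasurable hξ.aemeasurable).1 h.2.2

theorem measurableSet_strictBest_prod {lam : ℝ} (hlam1 : lam < 1) {θ : Param K d}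
    (hθ : StableAt lam θ) (i : Fin n) (k : Fin (K + 1)) :
    MeasurableSet {z : (Network n × (Fin n → Fin d → ℝ)) × (Fin n → Fin (K + 1) → ℝ) |
      z.2 i ∈ strictBest (eqIndex θ z.1.1 z.1.2 i) k} := by
  have h : ∀ k, Measurable fun z : (Network n × (Fin n → Fin d → ℝ)) × (Fin n → Fin (K + 1) → ℝ) =>
      eqIndex θ z.1.1 z.1.2 i k + z.2 i k := fun k =>
    ((measurable_eqIndex_prod hlam1 hθ i k).comp measurable_fst).add (by fun_prop)
  change MeasurableSet {z : (Network n × (Fin n → Fin d → ℝ)) × (Fin n → Fin (K + 1) → ℝ) |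
    ∀ q, q ≠ k → eqIndex θ z.1.1 z.1.2 i q + z.2 i q < eqIndex θ z.1.1 z.1.2 i k + z.2 i k}
  simp only [Set.ofPred_forall]
  exact MeasurableSet.iInter fun q => MeasurableSet.iInter fun _ => measurableSet_lt (h q) (h k)

/-- Ties have probability zero: the logit probabilities of the unique best actions sum to one. -/
theorem ae_exists_strictBest {lam : ℝ} (hlam1 : lam < 1) {θ : Param K d} (hθ : StableAt lam θ)
    (hF : Measurable F) (hX : Measurable X) (hξ : Measurable ξ)
    (h : ExtremeValueShocks μ F X ξ) :
    ∀ᵐ ω ∂μ, ∀ i, ∃ k, ξ ω i ∈ strictBest (eqIndex θ (F ω) (X ω) i) k := by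
  rw [ae_all_iff]
  intro i
  set T : Set ((Network n × (Fin n → Fin d → ℝ)) × (Fin n → Fin (K + 1) → ℝ)) :=
    {z | ∃ k, z.2 i ∈ strictBest (eqIndex θ z.1.1 z.1.2 i) k} with hT
  have hTm : MeasurableSet T := by
    simp only [hT, Set.ofPred_exists]
    exact MeasurableSet.iUnion fun k => measurableSet_strictBest_prod hlam1 hθ i k
  have hmap : Measurable fun ω => ((F ω, X ω), ξ ω) := (hF.prodMk hX).prodMk hξ
  have hae : ∀ᵐ z ∂(μ.map fun ω => ((F ω, X ω), ξ ω)), z ∈ T := by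
    rw [map_public_shocks hF hX hξ h]
    refine (Measure.measure_prod_null hTm.compl).2 (ae_of_all _ fun S => ?_)
    have h1 : shockLaw K (⋃ k, strictBest (eqIndex θ S.1 S.2 i) k) = 1 := by
      rw [measure_iUnion (fun k m hkm => Set.disjoint_left.2 fun e he =>
        disjoint_strictBest _ hkm he) fun k => measurableSet_strictBest _ k, tsum_fintype]
      simp only [shockLaw_strictBest]
      rw [← ENNReal.ofReal_sum_of_nonneg fun k _ => (softmax_pos _ k).le, sum_softmax,
        ENNReal.ofReal_one]
    have hm : MeasurableSet (⋃ k, strictBest (eqIndex θ S.1 S.2 i) k) :=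
      MeasurableSet.iUnion fun k => measurableSet_strictBest _ k
    have h2 := (prob_compl_eq_zero_iff hm).2 h1
    rw [← (measurePreserving_eval (fun _ : Fin n => shockLaw K) i).measure_preimage
      hm.compl.nullMeasurableSet] at h2
    refine (congrArg (Measure.pi fun _ : Fin n => shockLaw K) (Set.ext fun e => ?_)).trans h2
    simp [hT]
  exact (ae_map_iff hmap.aemeasurable hTm).1 hae

/-- Almost surely the observed action is the unique best one. This replaces the equilibrium profile,
which need not be jointly measurable, by a measurable description of the choices. -/
theorem ae_choice_iff_strictBest {lam : ℝ} (hlam1 : lam < 1) {θ : Param K d}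
    (hθ : StableAt lam θ) (hF : Measurable F) (hX : Measurable X) (hξ : Measurable ξ)
    (h : ExtremeValueShocks μ F X ξ) {r : Network n → (Fin n → Fin d → ℝ) → Profile K n}
    (hr : ∀ G x, IsBNE θ G x (r G x)) {Y : Ω → Fin n → Fin (K + 1)}
    (hY : ∀ᵐ ω ∂μ, ∀ i, Y ω i = r (F ω) (X ω) i (ξ ω i)) :
    ∀ᵐ ω ∂μ, ∀ i k, Y ω i = k ↔ ξ ω i ∈ strictBest (eqIndex θ (F ω) (X ω) i) k := by
  filter_upwards [ae_exists_strictBest hlam1 hθ hF hX hξ h, hY] with ω h1 h2 i k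
  obtain ⟨m, hm⟩ := h1 i
  have hYm : Y ω i = m := by
    rw [h2 i]
    refine eq_of_mem_strictBest (hr _ _) ?_
    rw [choiceProb_eq_fullProb hlam1 hθ (hr _ _)]
    exact hm
  constructor
  · intro hk
    rwa [← hk, hYm]
  · intro hk
    by_contra hne
    rw [hYm] at hne
    exact disjoint_strictBest _ hne hm hk

theorem lintegral_sum_sq_le {E : Type*} [MeasurableSpace E] (ρ : Measure E)
    [IsProbabilityMeasure ρ] {g : Fin n → E → ℝ} (hg : ∀ i, Measurable (g i)) {B : ℝ}
    (hB : ∀ i e, |g i e| ≤ B) (h0 : ∀ i, ∫ e, g i e ∂ρ = 0) :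
    ∫⁻ e : Fin n → E, ENNReal.ofReal ((∑ i, g i (e i)) ^ 2) ∂(Measure.pi fun _ => ρ)
      ≤ ENNReal.ofReal (n * B ^ 2) := by
  have hL : ∀ i, MemLp (g i) 2 ρ := fun i =>
    MemLp.of_bound (hg i).aestronglyMeasurable B (ae_of_all _ (hB i))
  have hLpi : ∀ i, MemLp (fun e : Fin n → E => g i (e i)) 2 (Measure.pi fun _ => ρ) := fun i =>
    (hL i).comp_measurePreserving (measurePreserving_eval _ i)
  have hLs : MemLp (∑ i, fun e : Fin n → E => g i (e i)) 2 (Measure.pi fun _ => ρ) :=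
    memLp_finsetSum' _ fun i _ => hLpi i
  have hmean : ∫ e : Fin n → E, (∑ i, fun e : Fin n → E => g i (e i)) e
      ∂(Measure.pi fun _ => ρ) = 0 := by
    simp only [Finset.sum_apply]
    rw [integral_finsetSum _ fun i _ => (hLpi i).integrable (by norm_num)]
    refine Finset.sum_eq_zero fun i _ => ?_
    have h1 : ∫ y, g i y ∂((Measure.pi fun _ : Fin n => ρ).map (Function.eval i))
        = ∫ e, g i (Function.eval i e) ∂(Measure.pi fun _ : Fin n => ρ) :=
      integral_map (measurable_pi_apply i).aemeasurable (hg i).aestronglyMeasurable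
    rw [(measurePreserving_eval (fun _ : Fin n => ρ) i).map_eq, h0 i] at h1
    exact h1.symm
  have hvar := variance_sum_pi (μ := fun _ : Fin n => ρ) (X := g) hL
  rw [variance_of_integral_eq_zero hLs.aemeasurable hmean] at hvar
  have hle : ∑ i, Var[g i; ρ] ≤ n * B ^ 2 := by
    calc ∑ i, Var[g i; ρ] ≤ ∑ _i : Fin n, B ^ 2 := by
          refine Finset.sum_le_sum fun i _ => ?_
          rw [variance_of_integral_eq_zero (hg i).aemeasurable (h0 i)]
          calc ∫ e, g i e ^ 2 ∂ρ ≤ ∫ _e, B ^ 2 ∂ρ := by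
                refine integral_mono (hL i).integrable_sq (integrable_const _) fun e => ?_
                exact sq_le_sq' (abs_le.1 (hB i e)).1 (abs_le.1 (hB i e)).2
            _ = B ^ 2 := by simp
      _ = n * B ^ 2 := by simp
  have hfun : ∀ e : Fin n → E, (∑ i, fun e : Fin n → E => g i (e i)) e = ∑ i, g i (e i) :=
    fun e => by simp
  simp only [hfun] at hvar
  have hLs' := hLs.integrable_sq
  simp only [hfun] at hLs'
  rw [← ofReal_integral_eq_lintegral_ofReal hLs' (ae_of_all _ fun e => sq_nonneg _), hvar]
  exact ENNReal.ofReal_le_ofReal hle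

/-- The residual of player `i` in the comparison of her choice with its conditional probabilities,
weighted by the log-probabilities at the parameter `c`. -/
def residual (θ c : Param K d) (G : Network n) (x : Fin n → Fin d → ℝ)
    (y : Fin n → Fin (K + 1)) (i : Fin n) : ℝ :=
  ∑ k, ((if y i = k then 1 else 0) - fullProb θ G x i k) * Real.log (fullProb c G x i k)

/-- A bound on the residuals when covariates are bounded by `M` and parameters by `R`. -/
def residualBound (K d : ℕ) (M R : ℝ) : ℝ := (K + 1) * -Real.log (probFloor K d M R)

theorem abs_log_le_neg_log {p q : ℝ} (hp : 0 < p) (hpq : p ≤ q) (hq : q ≤ 1) :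
    |Real.log q| ≤ -Real.log p := by
  rw [abs_of_nonpos (Real.log_nonpos (hp.le.trans hpq) hq)]
  exact neg_le_neg (Real.log_le_log hp hpq)

/-- Given the public information the residuals are independent and centred, so their average is of
order `n ^ (-1/2)`. -/
theorem measure_residual_ge_le {lam : ℝ} (hlam1 : lam < 1) {θ c : Param K d}
    (hθ : StableAt lam θ) (hc : StableAt lam c) {R : ℝ} (hR : ‖c‖ ≤ R)
    (hF : Measurable F) (hX : Measurable X) (hξ : Measurable ξ)
    (h : ExtremeValueShocks μ F X ξ) {r : Network n → (Fin n → Fin d → ℝ) → Profile K n}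
    (hr : ∀ G x, IsBNE θ G x (r G x)) {Y : Ω → Fin n → Fin (K + 1)}
    (hY : ∀ᵐ ω ∂μ, ∀ i, Y ω i = r (F ω) (X ω) i (ξ ω i)) {M : ℝ} (hM : 0 ≤ M)
    (hXM : ∀ᵐ ω ∂μ, ∀ i a, |X ω i a| ≤ M) (hn : 0 < n) {δ : ℝ} (hδ : 0 < δ) :
    μ {ω | δ ≤ |1 / (n : ℝ) * ∑ i, residual θ c (F ω) (X ω) (Y ω) i|}
      ≤ ENNReal.ofReal (residualBound K d M R ^ 2 / δ ^ 2 * (n : ℝ)⁻¹) := by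
  classical
  set g : Network n × (Fin n → Fin d → ℝ) → Fin n → (Fin (K + 1) → ℝ) → ℝ := fun S i e =>
    ∑ k, ((strictBest (eqIndex θ S.1 S.2 i) k).indicator (fun _ => (1 : ℝ)) e
      - fullProb θ S.1 S.2 i k) * Real.log (fullProb c S.1 S.2 i k) with hg
  have hgm : ∀ i, Measurable fun z : (Network n × (Fin n → Fin d → ℝ)) ×
      (Fin n → Fin (K + 1) → ℝ) => g z.1 i (z.2 i) := fun i => by
    refine Finset.measurable_sum _ fun k _ => Measurable.mul (Measurable.sub ?_ ?_) ?_
    · have : (fun z : (Network n × (Fin n → Fin d → ℝ)) × (Fin n → Fin (K + 1) → ℝ) =>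
          (strictBest (eqIndex θ z.1.1 z.1.2 i) k).indicator (fun _ => (1 : ℝ)) (z.2 i))
          = {z : (Network n × (Fin n → Fin d → ℝ)) × (Fin n → Fin (K + 1) → ℝ) |
            z.2 i ∈ strictBest (eqIndex θ z.1.1 z.1.2 i) k}.indicator fun _ => 1 := by
        ext z
        simp only [Set.indicator_apply, Set.mem_ofPred_eq]
      rw [this]
      exact measurable_const.indicator (measurableSet_strictBest_prod hlam1 hθ i k)
    · exact (measurable_fullProb_prod hlam1 hθ i k).comp measurable_fst
    · exact Real.measurable_log.comp ((measurable_fullProb_prod hlam1 hc i k).comp measurable_fst)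
  set G2 : (Network n × (Fin n → Fin d → ℝ)) × (Fin n → Fin (K + 1) → ℝ) → ENNReal := fun z =>
    ENNReal.ofReal ((∑ i, g z.1 i (z.2 i)) ^ 2) with hG2
  have hG2m : Measurable G2 :=
    ((Finset.measurable_sum _ fun i _ => hgm i).pow_const 2).ennreal_ofReal
  have hinner : ∀ S : Network n × (Fin n → Fin d → ℝ), (∀ i a, |S.2 i a| ≤ M) →
      ∫⁻ e, G2 (S, e) ∂(Measure.pi fun _ => shockLaw K)
        ≤ ENNReal.ofReal (n * residualBound K d M R ^ 2) := by
    intro S hS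
    have hms : ∀ i k, Measurable fun e : Fin (K + 1) → ℝ =>
        (strictBest (eqIndex θ S.1 S.2 i) k).indicator (fun _ => (1 : ℝ)) e := fun i k =>
      measurable_const.indicator (measurableSet_strictBest _ k)
    refine lintegral_sum_sq_le (shockLaw K) (g := g S) (fun i => ?_) (fun i e => ?_) fun i => ?_
    · exact Finset.measurable_sum _ fun k _ => ((hms i k).sub_const _).mul_const _
    · calc |g S i e| ≤ ∑ _k : Fin (K + 1), 1 * -Real.log (probFloor K d M R) := by
            refine (Finset.abs_sum_le_sum_abs _ _).trans (Finset.sum_le_sum fun k _ => ?_)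
            rw [abs_mul]
            refine mul_le_mul ?_ (abs_log_le_neg_log (probFloor_pos K d M R)
              (probFloor_le_fullProb hlam1 hc hR S.1 hM hS i k)
              ((le_abs_self _).trans ((isProbProfile_fullProb hlam1 hc S.1 S.2).abs_le_one i k)))
              (abs_nonneg _) zero_le_one
            have h1 := (isProbProfile_fullProb hlam1 hθ S.1 S.2 i).1 k
            have h2 := (le_abs_self _).trans
              ((isProbProfile_fullProb hlam1 hθ S.1 S.2).abs_le_one i k)
            rw [Set.indicator_apply, abs_le]
            split_ifs <;> constructor <;> linarith
        _ = residualBound K d M R := by simp [residualBound]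
    · have hint : ∀ k, Integrable ((strictBest (eqIndex θ S.1 S.2 i) k).indicator
          fun _ => (1 : ℝ)) (shockLaw K) := fun k =>
        (integrable_const 1).indicator (measurableSet_strictBest _ k)
      have hres : ∀ k, Integrable (fun e =>
          ((strictBest (eqIndex θ S.1 S.2 i) k).indicator (fun _ => (1 : ℝ)) e
            - fullProb θ S.1 S.2 i k) * Real.log (fullProb c S.1 S.2 i k)) (shockLaw K) := fun k =>
        ((hint k).sub (integrable_const _)).mul_const _
      simp only [hg]
      rw [integral_finsetSum _ fun k _ => hres k]
      refine Finset.sum_eq_zero fun k _ => ?_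
      rw [integral_mul_const, integral_sub (hint k) (integrable_const _),
        integral_indicator (measurableSet_strictBest _ k), setIntegral_const,
        shockLaw_strictBest_eqIndex hlam1 hθ]
      simp
  have hmap : Measurable fun ω => ((F ω, X ω), ξ ω) := (hF.prodMk hX).prodMk hξ
  have htotal : ∫⁻ ω, G2 ((F ω, X ω), ξ ω) ∂μ ≤ ENNReal.ofReal (n * residualBound K d M R ^ 2) := by
    rw [← lintegral_map hG2m hmap, map_public_shocks hF hX hξ h, lintegral_prod _ hG2m.aemeasurable]
    have hb : Measurable fun S : Network n × (Fin n → Fin d → ℝ) =>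
        ∫⁻ e, G2 (S, e) ∂(Measure.pi fun _ => shockLaw K) := hG2m.lintegral_prod_right'
    rw [lintegral_map hb (hF.prodMk hX)]
    calc _ ≤ ∫⁻ _ω, ENNReal.ofReal (n * residualBound K d M R ^ 2) ∂μ := by
          refine lintegral_mono_ae ?_
          filter_upwards [hXM] with ω hω
          exact hinner (F ω, X ω) hω
      _ = _ := by simp
  have hn' : (0 : ℝ) < n := Nat.cast_pos.2 hn
  have hsub : {ω | δ ≤ |1 / (n : ℝ) * ∑ i, residual θ c (F ω) (X ω) (Y ω) i|}
      ≤ᵐ[μ] {ω | ENNReal.ofReal ((n * δ) ^ 2) ≤ G2 ((F ω, X ω), ξ ω)} := by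
    filter_upwards [ae_choice_iff_strictBest hlam1 hθ hF hX hξ h hr hY] with ω hω hmem
    have heq : ∑ i, residual θ c (F ω) (X ω) (Y ω) i = ∑ i, g (F ω, X ω) i (ξ ω i) := by
      refine Finset.sum_congr rfl fun i _ => Finset.sum_congr rfl fun k _ => ?_
      simp only [Set.indicator_apply, hω i k]
    change δ ≤ |1 / (n : ℝ) * ∑ i, residual θ c (F ω) (X ω) (Y ω) i| at hmem
    change ENNReal.ofReal ((n * δ) ^ 2) ≤ ENNReal.ofReal ((∑ i, g (F ω, X ω) i (ξ ω i)) ^ 2)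
    rw [heq, abs_mul, abs_of_pos (by positivity), one_div, le_inv_mul_iff₀ hn'] at hmem
    refine ENNReal.ofReal_le_ofReal ?_
    rw [← sq_abs (∑ i, g (F ω, X ω) i (ξ ω i))]
    exact pow_le_pow_left₀ (by positivity) hmem 2
  refine (measure_mono_ae hsub).trans ?_
  have hpos : (0 : ℝ) < (n * δ) ^ 2 := by positivity
  refine (meas_ge_le_lintegral_div (hG2m.comp hmap).aemeasurable
    (ENNReal.ofReal_pos.2 hpos).ne' ENNReal.ofReal_ne_top).trans ?_
  refine (ENNReal.div_le_div_right htotal _).trans ?_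
  rw [← ENNReal.ofReal_div_of_pos hpos]
  refine ENNReal.ofReal_le_ofReal (le_of_eq ?_)
  field_simp

end Noise

/-! ### Local statistics of a network -/

/-- The permutation `π` carries the friends of every player of the ball `N_(i,t)` of `G` to the
friends of the image of the player in `G'`. -/
def PreservesFriends (π : Equiv.Perm (Fin n)) (G G' : Network n) (i : Fin n) (t : ℕ) : Prop :=
  ∀ a ∈ G.ball i t, (G.friends a).map π.toEmbedding = G'.friends (π a)

/-- A statistic of a player that depends only on the friends of the players of `N_(i,t)` and on the
covariates of the players of `N_(i,t+1)`, and not on the names of the players. -/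
def IsLocal (t : ℕ) (f : Network n → (Fin n → Fin d → ℝ) → Fin n → ℝ) : Prop :=
  ∀ (G G' : Network n) (i : Fin n) (π : Equiv.Perm (Fin n)) (x x' : Fin n → Fin d → ℝ),
    PreservesFriends π G G' i t → (∀ b ∈ G.ball i (t + 1), x b = x' (π b)) →
      f G x i = f G' x' (π i)

/-- An isomorphism of two neighbourhoods extends to a permutation of all players. The friends of the
players at distance at most `t` lie within distance `t + 1`, so none of them is lost. -/
theorem exists_perm_of_egoClass_eq {G G' : Network n} {i i' : Fin n} {t : ℕ}
    (h : G.egoClass i (t + 1) = G'.egoClass i' (t + 1)) :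
    ∃ π : Equiv.Perm (Fin n), π i = i' ∧ PreservesFriends π G G' i t := by
  obtain ⟨e, hroot, hadj⟩ : RootedDigraph.Iso (G.ego i (t + 1)) (G'.ego i' (t + 1)) :=
    Quotient.exact h
  let E : G.ball i (t + 1) ≃ G'.ball i' (t + 1) :=
    ((G.ball i (t + 1)).equivFin.trans e).trans (G'.ball i' (t + 1)).equivFin.symm
  have hEroot : E ⟨i, G.mem_ball_self i _⟩ = ⟨i', G'.mem_ball_self i' _⟩ := by
    change (G'.ball i' (t + 1)).equivFin.symm (e (G.ego i (t + 1)).root) = _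
    rw [hroot]
    exact Equiv.symm_apply_apply _ _
  have hEadj : ∀ a b : G.ball i (t + 1),
      (b : Fin n) ∈ G.friends a ↔ (E b : Fin n) ∈ G'.friends (E a) := fun a b => by
    have := hadj ((G.ball i (t + 1)).equivFin a) ((G.ball i (t + 1)).equivFin b)
    change (((G.ball i (t + 1)).equivFin.symm ((G.ball i (t + 1)).equivFin b) :
      G.ball i (t + 1)) : Fin n) ∈ G.friends (((G.ball i (t + 1)).equivFin.symm
        ((G.ball i (t + 1)).equivFin a) : G.ball i (t + 1)) : Fin n) ↔ _ at this
    rw [Equiv.symm_apply_apply, Equiv.symm_apply_apply] at this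
    exact this
  let π : Equiv.Perm (Fin n) := E.extendSubtype
  have hπ : ∀ a (ha : a ∈ G.ball i (t + 1)), π a = E ⟨a, ha⟩ := fun a ha =>
    E.extendSubtype_apply_of_mem a ha
  have hπroot : π i = i' := by rw [hπ i (G.mem_ball_self i _), hEroot]
  have hπadj : ∀ a ∈ G.ball i (t + 1), ∀ b ∈ G.ball i (t + 1),
      (b ∈ G.friends a ↔ π b ∈ G'.friends (π a)) := fun a ha b hb => by
    rw [hπ a ha, hπ b hb]
    exact hEadj ⟨a, ha⟩ ⟨b, hb⟩
  have hball : ∀ s ≤ t + 1, ∀ a ∈ G.ball i s, π a ∈ G'.ball i' s := by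
    intro s
    induction s with
    | zero =>
      intro _ a ha
      simp only [Network.ball, Finset.mem_singleton] at ha ⊢
      rw [ha, hπroot]
    | succ s ih =>
      intro hs a ha
      rcases Finset.mem_union.1 ha with ha' | ha'
      · exact Finset.mem_union_left _ (ih (by omega) a ha')
      · obtain ⟨b, hb, hab⟩ := Finset.mem_biUnion.1 ha'
        exact friends_subset_ball_succ G' (ih (by omega) b hb)
          ((hπadj b (ball_mono G i (by omega) hb) a (ball_mono G i hs ha)).1 hab)
  refine ⟨π, hπroot, fun a ha => ?_⟩
  have ha1 := ball_mono G i (Nat.le_succ t) ha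
  ext b
  simp only [Finset.mem_map, Equiv.coe_toEmbedding]
  constructor
  · rintro ⟨c, hc, rfl⟩
    exact (hπadj a ha1 c (friends_subset_ball_succ G ha hc)).1 hc
  · intro hb
    have hb1 : b ∈ G'.ball i' (t + 1) :=
      friends_subset_ball_succ G' (hball t (by omega) a ha) hb
    have hbe : π (E.symm ⟨b, hb1⟩) = b := by
      rw [hπ _ (E.symm ⟨b, hb1⟩).2]
      simp
    refine ⟨E.symm ⟨b, hb1⟩, ?_, hbe⟩
    rw [hπadj a ha1 _ (E.symm ⟨b, hb1⟩).2, hbe]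
    exact hb

theorem IsLocal.congr_covariates {t : ℕ} {f : Network n → (Fin n → Fin d → ℝ) → Fin n → ℝ}
    (hf : IsLocal t f) (G : Network n) (i : Fin n) {x x' : Fin n → Fin d → ℝ}
    (h : ∀ b ∈ G.ball i (t + 1), x b = x' b) : f G x i = f G x' i :=
  hf G G i (Equiv.refl _) x x' (fun a _ => by simp) h

/-- The mean of a statistic given the network when the covariates are i.i.d. with law `ν`. -/
def networkMean (ν : Measure (Fin d → ℝ)) (f : Network n → (Fin n → Fin d → ℝ) → Fin n → ℝ)
    (G : Network n) (i : Fin n) : ℝ :=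
  ∫ x, f G x i ∂(Measure.pi fun _ => ν)

/-- The mean of a local statistic given the network depends on the isomorphism class of the
neighbourhood only, because i.i.d. covariates are exchangeable. -/
theorem IsLocal.networkMean_eq {t : ℕ} {f : Network n → (Fin n → Fin d → ℝ) → Fin n → ℝ}
    (hf : IsLocal t f) (ν : Measure (Fin d → ℝ)) [IsProbabilityMeasure ν] {G G' : Network n}
    {i i' : Fin n} (h : G.egoClass i (t + 1) = G'.egoClass i' (t + 1)) :
    networkMean ν f G i = networkMean ν f G' i' := by
  obtain ⟨π, rfl, hπ⟩ := exists_perm_of_egoClass_eq h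
  unfold networkMean
  have hmp := measurePreserving_piCongrLeft (α := fun _ : Fin n => Fin d → ℝ) (fun _ => ν) π.symm
  rw [← hmp.integral_comp']
  refine integral_congr_ae (ae_of_all _ fun x => hf G G' i π _ x hπ fun b _ => ?_)
  have := Equiv.piCongrLeft_apply_apply (P := fun _ : Fin n => Fin d → ℝ) (e := π.symm) x (π b)
  rw [Equiv.symm_apply_apply] at this
  exact this

theorem networkMean_abs_le {f : Network n → (Fin n → Fin d → ℝ) → Fin n → ℝ} {B : ℝ}
    (hB : ∀ G x i, |f G x i| ≤ B) (ν : Measure (Fin d → ℝ)) [IsProbabilityMeasure ν]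
    (G : Network n) (i : Fin n) : |networkMean ν f G i| ≤ B := by
  have h := norm_integral_le_of_norm_le_const (μ := Measure.pi fun _ : Fin n => ν)
    (f := fun x => f G x i) (ae_of_all _ fun x => hB G x i)
  simpa [networkMean] using h

/-- Given the network, local statistics of players with disjoint neighbourhoods are independent. -/
theorem IsLocal.integral_mul_eq {t : ℕ} {f : Network n → (Fin n → Fin d → ℝ) → Fin n → ℝ}
    (hf : IsLocal t f) (hfm : ∀ G i, Measurable fun x => f G x i)
    (ν : Measure (Fin d → ℝ)) [IsProbabilityMeasure ν] {G : Network n} {i j : Fin n}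
    (hij : Disjoint (G.ball i (t + 1)) (G.ball j (t + 1))) :
    ∫ x, f G x i * f G x j ∂(Measure.pi fun _ => ν)
      = networkMean ν f G i * networkMean ν f G j := by
  have hind : iIndepFun (fun (a : Fin n) (x : Fin n → Fin d → ℝ) => x a)
      (Measure.pi fun _ => ν) :=
    iIndepFun_pi (X := fun _ : Fin n => (id : (Fin d → ℝ) → Fin d → ℝ)) fun _ => aemeasurable_id
  have h2 := hind.indepFun_finset _ _ hij fun a => measurable_pi_apply a
  -- A local statistic factors through the covariates of the ball, here extended by zero.
  let ext (S : Finset (Fin n)) (y : S → Fin d → ℝ) : Fin n → Fin d → ℝ := fun a =>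
    if h : a ∈ S then y ⟨a, h⟩ else 0
  have hext : ∀ S, Measurable (ext S) := fun S => measurable_pi_lambda _ fun a => by
    by_cases h : a ∈ S
    · simpa only [ext, h, dif_pos] using measurable_pi_apply _
    · simpa only [ext, h, dif_neg, not_false_eq_true] using measurable_const
  have hfac : ∀ (l : Fin n) (x : Fin n → Fin d → ℝ),
      f G (ext (G.ball l (t + 1)) fun a => x a) l = f G x l := fun l x =>
    hf.congr_covariates G l fun b hb => by simp [ext, hb]
  have h3 := h2.comp ((hfm G i).comp (hext _)) ((hfm G j).comp (hext _))
  have h4 : IndepFun (fun x => f G x i) (fun x => f G x j) (Measure.pi fun _ => ν) := by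
    refine h3.congr (ae_of_all _ fun x => hfac i x) (ae_of_all _ fun x => hfac j x)
  exact h4.integral_fun_mul_eq_mul_integral (hfm G i).aestronglyMeasurable
    (hfm G j).aestronglyMeasurable

/-! ### Overlap of neighbourhoods -/

theorem card_ball_le {G : Network n} {q : ℕ} (hq : ∀ i, (G.friends i).card ≤ q) (i : Fin n)
    (h : ℕ) : (G.ball i h).card ≤ (1 + q) ^ h := by
  induction h with
  | zero => simp [Network.ball]
  | succ h ih =>
    calc (G.ball i (h + 1)).card ≤ (G.ball i h).card + (G.ball i h).card * q :=
          (Finset.card_union_le _ _).trans (Nat.add_le_add_left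
            (Finset.card_biUnion_le_card_mul _ _ _ fun j _ => hq j) _)
      _ = (G.ball i h).card * (1 + q) := by ring
      _ ≤ (1 + q) ^ h * (1 + q) := Nat.mul_le_mul_right _ ih
      _ = (1 + q) ^ (h + 1) := (pow_succ _ _).symm

theorem card_mem_ball_le {G : Network n} {c₀ : ℕ} (hc : ∀ i, G.inDegree i ≤ c₀) (h : ℕ)
    (a : Fin n) : (Finset.univ.filter fun j => a ∈ G.ball j h).card ≤ (1 + c₀) ^ h := by
  induction h generalizing a with
  | zero =>
    simp only [Network.ball, Finset.mem_singleton, pow_zero]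
    exact Finset.card_le_one.2 fun b hb c hc => by simp_all
  | succ h ih =>
    have hsub : (Finset.univ.filter fun j => a ∈ G.ball j (h + 1)) ⊆
        (Finset.univ.filter fun j => a ∈ G.ball j h) ∪
          (Finset.univ.filter fun b => a ∈ G.friends b).biUnion fun b =>
            Finset.univ.filter fun j => b ∈ G.ball j h := by
      intro j hj
      rw [Finset.mem_filter] at hj
      rcases Finset.mem_union.1 hj.2 with h1 | h1
      · exact Finset.mem_union_left _ (by simpa using h1)
      · obtain ⟨b, hb, hab⟩ := Finset.mem_biUnion.1 h1
        refine Finset.mem_union_right _ (Finset.mem_biUnion.2 ⟨b, ?_, ?_⟩)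
        · simpa using hab
        · simpa using hb
    calc _ ≤ (1 + c₀) ^ h + c₀ * (1 + c₀) ^ h := by
          refine (Finset.card_le_card hsub).trans ((Finset.card_union_le _ _).trans
            (Nat.add_le_add (ih a) ?_))
          exact (Finset.card_biUnion_le_card_mul _ _ _ fun b _ => ih b).trans
            (Nat.mul_le_mul_right _ (hc a))
      _ = (1 + c₀) ^ (h + 1) := by ring

theorem card_not_disjoint_le {G : Network n} {q c₀ : ℕ} (hq : ∀ i, (G.friends i).card ≤ q)
    (hc : ∀ i, G.inDegree i ≤ c₀) (h : ℕ) (i : Fin n) :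
    (Finset.univ.filter fun j => ¬Disjoint (G.ball i h) (G.ball j h)).card
      ≤ (1 + q) ^ h * (1 + c₀) ^ h := by
  have hsub : (Finset.univ.filter fun j => ¬Disjoint (G.ball i h) (G.ball j h)) ⊆
      (G.ball i h).biUnion fun a => Finset.univ.filter fun j => a ∈ G.ball j h := by
    intro j hj
    obtain ⟨a, ha, ha'⟩ := Finset.not_disjoint_iff.1 (Finset.mem_filter.1 hj).2
    exact Finset.mem_biUnion.2 ⟨a, ha, by simpa using ha'⟩
  exact (Finset.card_le_card hsub).trans
    ((Finset.card_biUnion_le_card_mul _ _ _ fun a _ => card_mem_ball_le hc h a).trans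
      (Nat.mul_le_mul_right _ (card_ball_le hq i h)))

/-! ### A law of large numbers for local statistics -/

section LLN

variable {Ω : Type*} [MeasurableSpace Ω] {μ : Measure Ω} [IsProbabilityMeasure μ]

/-- If, on an event `D`, the product of `a` and `b` has the same integral as the product of two
variables that are independent given `D` and have the means of `a` and `b`, then the covariance of
`a` and `b` is at most of the order of the probability of the complement of `D`. -/
theorem abs_integral_mul_sub_le {D : Set Ω} (hD : MeasurableSet D) {B : ℝ} {a b u v : Ω → ℝ}
    (ha : Measurable a) (hb : Measurable b) (hu : Measurable u) (hv : Measurable v)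
    (haB : ∀ ω, |a ω| ≤ B) (hbB : ∀ ω, |b ω| ≤ B) (huB : ∀ ω, |u ω| ≤ B) (hvB : ∀ ω, |v ω| ≤ B)
    (hau : ∫ ω, a ω ∂μ = ∫ ω, u ω ∂μ) (hbv : ∫ ω, b ω ∂μ = ∫ ω, v ω ∂μ)
    (hab : ∫ ω in D, a ω * b ω ∂μ = ∫ ω in D, u ω * v ω ∂μ)
    (hind : IndepFun u v (cond μ D)) :
    |∫ ω, a ω * b ω ∂μ - (∫ ω, a ω ∂μ) * ∫ ω, b ω ∂μ| ≤ 4 * B ^ 2 * μ.real Dᶜ := by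
  obtain ⟨ω₀⟩ : Nonempty Ω := nonempty_of_isProbabilityMeasure μ
  have hB : 0 ≤ B := (abs_nonneg _).trans (haB ω₀)
  have hbd : ∀ {g : Ω → ℝ}, Measurable g → ∀ {C : ℝ}, (∀ ω, |g ω| ≤ C) → Integrable g μ :=
    fun hg _ hC => Integrable.of_bound hg.aestronglyMeasurable _ (ae_of_all _ hC)
  have hmulB : ∀ {f g : Ω → ℝ}, (∀ ω, |f ω| ≤ B) → (∀ ω, |g ω| ≤ B) →
      ∀ ω, |f ω * g ω| ≤ B ^ 2 := fun hf hg ω => by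
    rw [abs_mul, sq]
    exact mul_le_mul (hf ω) (hg ω) (abs_nonneg _) hB
  have hset : ∀ {g : Ω → ℝ} {C : ℝ}, (∀ ω, |g ω| ≤ C) → ∀ s, |∫ ω in s, g ω ∂μ| ≤ C * μ.real s :=
    fun {g _} hC s =>
      norm_setIntegral_le_of_norm_le_const (f := g) (measure_lt_top μ s) fun ω _ => hC ω
  have hcondint : ∀ g : Ω → ℝ, ∫ ω, g ω ∂(cond μ D) = (μ.real D)⁻¹ * ∫ ω in D, g ω ∂μ := fun g => by
    unfold ProbabilityTheory.cond
    rw [integral_smul_measure, smul_eq_mul, ENNReal.toReal_inv]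
    rfl
  -- Multiplied by `μ D`, the independence given `D` also holds when `D` is null.
  have hp : μ.real D * ∫ ω in D, u ω * v ω ∂μ = (∫ ω in D, u ω ∂μ) * ∫ ω in D, v ω ∂μ := by
    rcases eq_or_ne (μ.real D) 0 with h0 | h0
    · have hz : ∀ g : Ω → ℝ, ∫ ω in D, g ω ∂μ = 0 := fun g => by
        rw [Measure.restrict_eq_zero.2 ((measureReal_eq_zero_iff).1 h0), integral_zero_measure]
      rw [hz, hz, h0]
      simp
    · have h := hind.integral_fun_mul_eq_mul_integral hu.aestronglyMeasurable
        hv.aestronglyMeasurable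
      rw [hcondint, hcondint, hcondint] at h
      field_simp at h
      linarith
  have hpq : μ.real D + μ.real Dᶜ = 1 := by
    rw [measureReal_add_measureReal_compl hD, probReal_univ]
  have hq0 : 0 ≤ μ.real Dᶜ := measureReal_nonneg
  have hp0 : 0 ≤ μ.real D := measureReal_nonneg
  have e1 := integral_add_compl hD (hbd (ha.mul hb) (hmulB haB hbB))
  have e2 := integral_add_compl hD (hbd hu huB)
  have e3 := integral_add_compl hD (hbd hv hvB)
  have b1 := hset (hmulB haB hbB) Dᶜ
  have b2 := hset (hmulB huB hvB) D
  have b3 := hset huB Dᶜ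
  have b4 := hset hvB Dᶜ
  have b5 := hset hvB D
  have b6 : |∫ ω, u ω ∂μ| ≤ B := by
    simpa using hset huB Set.univ
  rw [hau, hbv]
  simp only [Pi.mul_apply] at e1
  rw [hab] at e1
  have key : ∫ ω, a ω * b ω ∂μ - (∫ ω, u ω ∂μ) * ∫ ω, v ω ∂μ
      = μ.real Dᶜ * (∫ ω in D, u ω * v ω ∂μ) + (∫ ω in Dᶜ, a ω * b ω ∂μ)
        - (∫ ω in Dᶜ, u ω ∂μ) * (∫ ω in D, v ω ∂μ)
        - (∫ ω, u ω ∂μ) * ∫ ω in Dᶜ, v ω ∂μ := by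
    rw [← e1, ← e2, ← e3]
    have : μ.real Dᶜ = 1 - μ.real D := by linarith
    rw [this, sub_mul, hp]
    ring
  have c1 : |μ.real Dᶜ * ∫ ω in D, u ω * v ω ∂μ| ≤ B ^ 2 * μ.real Dᶜ := by
    rw [abs_mul, abs_of_nonneg hq0, mul_comm]
    refine mul_le_mul_of_nonneg_right (b2.trans ?_) hq0
    exact mul_le_of_le_one_right (sq_nonneg B) (by linarith)
  have c2 : |(∫ ω in Dᶜ, u ω ∂μ) * ∫ ω in D, v ω ∂μ| ≤ B ^ 2 * μ.real Dᶜ := by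
    rw [abs_mul]
    calc _ ≤ B * μ.real Dᶜ * B := mul_le_mul b3
          (b5.trans (mul_le_of_le_one_right hB (by linarith))) (abs_nonneg _) (by positivity)
      _ = _ := by ring
  have c3 : |(∫ ω, u ω ∂μ) * ∫ ω in Dᶜ, v ω ∂μ| ≤ B ^ 2 * μ.real Dᶜ := by
    rw [abs_mul]
    calc _ ≤ B * (B * μ.real Dᶜ) := mul_le_mul b6 b4 (abs_nonneg _) hB
      _ = _ := by ring
  rw [key]
  rw [abs_le] at b1 c1 c2 c3 ⊢
  constructor <;> linarith [b1.1, b1.2, c1.1, c1.2, c2.1, c2.2, c3.1, c3.2]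

variable {F : Ω → Network n} {X : Ω → Fin n → Fin d → ℝ}

/-- As the covariates are i.i.d. and independent of the network, expectations can be computed by
first integrating the covariates with the network fixed. -/
theorem integral_network_covariates (hF : Measurable F) (hX : Measurable X)
    (hiid : IIDCovariates μ F X) {ν : Measure (Fin d → ℝ)} [IsProbabilityMeasure ν]
    (hν : ∀ i, μ.map (fun ω => X ω i) = ν) {φ : Network n → (Fin n → Fin d → ℝ) → ℝ}
    (hφ : ∀ G, Measurable (φ G)) {B : ℝ} (hB : ∀ G x, |φ G x| ≤ B) :
    ∫ ω, φ (F ω) (X ω) ∂μ = ∫ ω, (∫ x, φ (F ω) x ∂(Measure.pi fun _ => ν)) ∂μ := by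
  have hXi : ∀ i, Measurable fun ω => X ω i := fun i => (measurable_pi_apply i).comp hX
  have hlaw : μ.map X = Measure.pi fun _ => ν := by
    have h := (iIndepFun_iff_map_fun_eq_pi_map fun i => (hXi i).aemeasurable).1 hiid.1
    simp only [hν] at h
    exact h
  have hpair : μ.map (fun ω => (F ω, X ω)) = (μ.map F).prod (Measure.pi fun _ => ν) := by
    rw [← hlaw]
    exact (indepFun_iff_map_prod_eq_prod_map_map hF.aemeasurable hX.aemeasurable).1 hiid.2.2
  have hm : Measurable fun S : Network n × (Fin n → Fin d → ℝ) => φ S.1 S.2 :=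
    measurable_from_prod_countable_right fun G => hφ G
  have : IsProbabilityMeasure (μ.map F) := Measure.isProbabilityMeasure_map hF.aemeasurable
  calc ∫ ω, φ (F ω) (X ω) ∂μ
      = ∫ S, φ S.1 S.2 ∂(μ.map fun ω => (F ω, X ω)) :=
        (integral_map (hF.prodMk hX).aemeasurable hm.aestronglyMeasurable).symm
    _ = ∫ G, (∫ x, φ G x ∂(Measure.pi fun _ => ν)) ∂(μ.map F) := by
        rw [hpair, integral_prod]
        exact Integrable.of_bound hm.aestronglyMeasurable B (ae_of_all _ fun S => hB S.1 S.2)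
    _ = _ := integral_map hF.aemeasurable (measurable_of_countable _).aestronglyMeasurable

theorem measurable_network {β : Type*} [MeasurableSpace β] (hF : Measurable F)
    (g : Network n → β) : Measurable fun ω => g (F ω) :=
  (measurable_of_countable g).comp hF

theorem abs_covariance_local_le {t : ℕ} {f : Network n → (Fin n → Fin d → ℝ) → Fin n → ℝ}
    (hf : IsLocal t f) (hfm : ∀ G i, Measurable fun x => f G x i) {B : ℝ}
    (hB : ∀ G x i, |f G x i| ≤ B) (hF : Measurable F) (hX : Measurable X)
    (hiid : IIDCovariates μ F X) (hindep : IndependentSubgraphs μ F) (i j : Fin n) :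
    |∫ ω, f (F ω) (X ω) i * f (F ω) (X ω) j ∂μ
        - (∫ ω, f (F ω) (X ω) i ∂μ) * ∫ ω, f (F ω) (X ω) j ∂μ|
      ≤ 4 * B ^ 2 *
        μ.real {ω | Disjoint ((F ω).ball i (t + 1)) ((F ω).ball j (t + 1))}ᶜ := by
  classical
  have hXi : ∀ i, Measurable fun ω => X ω i := fun i => (measurable_pi_apply i).comp hX
  set ν : Measure (Fin d → ℝ) := μ.map fun ω => X ω i with hνdef
  have hνp : IsProbabilityMeasure ν := Measure.isProbabilityMeasure_map (hXi i).aemeasurable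
  have hν : ∀ l, μ.map (fun ω => X ω l) = ν := fun l => (hiid.2.1 l i).map_eq
  set D : Set Ω := {ω | Disjoint ((F ω).ball i (t + 1)) ((F ω).ball j (t + 1))} with hDdef
  have hD : MeasurableSet D :=
    hF (t := {G : Network n | Disjoint (G.ball i (t + 1)) (G.ball j (t + 1))}) trivial
  have hfj : ∀ l, Measurable fun ω => f (F ω) (X ω) l := fun l =>
    (measurable_from_prod_countable_right (f := fun S : Network n × (Fin n → Fin d → ℝ) =>
      f S.1 S.2 l) fun G => hfm G l).comp (hF.prodMk hX)
  have hmean : ∀ l, ∫ ω, f (F ω) (X ω) l ∂μ = ∫ ω, networkMean ν f (F ω) l ∂μ := fun l =>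
    integral_network_covariates hF hX hiid hν (φ := fun G x => f G x l) (fun G => hfm G l)
      fun G x => hB G x l
  have hB0 : 0 ≤ B := by
    obtain ⟨ω₀⟩ : Nonempty Ω := nonempty_of_isProbabilityMeasure μ
    exact (abs_nonneg _).trans (hB (F ω₀) (X ω₀) i)
  -- The conditional mean is a function of the isomorphism class of the neighbourhood.
  have hclass : ∀ l, ∃ g : RootedClass → ℝ, ∀ G : Network n,
      networkMean ν f G l = g (G.egoClass l (t + 1)) := fun l => by
    have : Function.FactorsThrough (fun G : Network n => networkMean ν f G l)
        (fun G : Network n => G.egoClass l (t + 1)) := fun G G' h => hf.networkMean_eq ν h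
    exact ⟨Function.extend (fun G : Network n => G.egoClass l (t + 1))
      (fun G : Network n => networkMean ν f G l) 0, fun G => (this.extend_apply 0 G).symm⟩
  have hind : IndepFun (fun ω => networkMean ν f (F ω) i) (fun ω => networkMean ν f (F ω) j)
      (cond μ D) := by
    obtain ⟨gi, hgi⟩ := hclass i
    obtain ⟨gj, hgj⟩ := hclass j
    have hgim : Measurable gi := fun _ _ => trivial
    have hgjm : Measurable gj := fun _ _ => trivial
    simp only [hgi, hgj]
    exact (hindep (t + 1) i j).comp hgim hgjm
  refine abs_integral_mul_sub_le hD (hfj i) (hfj j) (measurable_network hF fun G => networkMean ν f G i)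
    (measurable_network hF fun G => networkMean ν f G j) (fun ω => hB _ _ _) (fun ω => hB _ _ _)
    (fun ω => networkMean_abs_le hB ν _ _) (fun ω => networkMean_abs_le hB ν _ _)
    (hmean i) (hmean j) ?_ hind
  let φ : Network n → (Fin n → Fin d → ℝ) → ℝ := fun G x =>
    if Disjoint (G.ball i (t + 1)) (G.ball j (t + 1)) then f G x i * f G x j else 0
  have hφm : ∀ G, Measurable (φ G) := fun G => by
    by_cases h : Disjoint (G.ball i (t + 1)) (G.ball j (t + 1))
    · simp only [φ, h, if_true]
      exact (hfm G i).mul (hfm G j)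
    · simpa only [φ, h, if_false] using measurable_const
  have hφB : ∀ G x, |φ G x| ≤ B * B := fun G x => by
    by_cases h : Disjoint (G.ball i (t + 1)) (G.ball j (t + 1))
    · simp only [φ, h, if_true, abs_mul]
      exact mul_le_mul (hB G x i) (hB G x j) (abs_nonneg _) hB0
    · simpa only [φ, h, if_false, abs_zero] using mul_nonneg hB0 hB0
  rw [← integral_indicator hD, ← integral_indicator hD]
  have e1 : ∀ ω, D.indicator (fun ω => f (F ω) (X ω) i * f (F ω) (X ω) j) ω
      = φ (F ω) (X ω) := fun ω => by
    simp only [Set.indicator_apply, φ, hDdef, Set.mem_ofPred_eq]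
  have e2 : ∀ ω, D.indicator (fun ω => networkMean ν f (F ω) i * networkMean ν f (F ω) j) ω
      = ∫ x, φ (F ω) x ∂(Measure.pi fun _ => ν) := fun ω => by
    by_cases h : Disjoint ((F ω).ball i (t + 1)) ((F ω).ball j (t + 1))
    · have hω : ω ∈ D := h
      simp only [Set.indicator_of_mem hω, φ, h, if_true]
      exact (hf.integral_mul_eq hfm ν h).symm
    · have hω : ω ∉ D := h
      simp [Set.indicator_of_notMem hω, φ, h]
  simp only [e1, e2]
  exact integral_network_covariates hF hX hiid hν hφm hφB

/-- Averages of bounded local statistics concentrate: all but a bounded number of neighbourhoods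
are disjoint from a given one. -/
theorem measure_local_average_ge_le {t : ℕ}
    {f : Network n → (Fin n → Fin d → ℝ) → Fin n → ℝ}
    (hf : IsLocal t f) (hfm : ∀ G i, Measurable fun x => f G x i) {B : ℝ}
    (hB : ∀ G x i, |f G x i| ≤ B) (hF : Measurable F) (hX : Measurable X)
    (hiid : IIDCovariates μ F X) (hindep : IndependentSubgraphs μ F) {q c₀ : ℕ}
    (hq : ∀ᵐ ω ∂μ, ∀ i, ((F ω).friends i).card ≤ q) (hc : ∀ᵐ ω ∂μ, ∀ i, (F ω).inDegree i ≤ c₀)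
    (hn : 0 < n) {δ : ℝ} (hδ : 0 < δ) :
    μ {ω | δ ≤ |1 / (n : ℝ) * ∑ i, (f (F ω) (X ω) i - ∫ ω, f (F ω) (X ω) i ∂μ)|}
      ≤ ENNReal.ofReal (4 * B ^ 2 * ((1 + q) ^ (t + 1) * (1 + c₀) ^ (t + 1) : ℕ) / δ ^ 2
        * (n : ℝ)⁻¹) := by
  classical
  have hfj : ∀ l, Measurable fun ω => f (F ω) (X ω) l := fun l =>
    (measurable_from_prod_countable_right (f := fun S : Network n × (Fin n → Fin d → ℝ) =>
      f S.1 S.2 l) fun G => hfm G l).comp (hF.prodMk hX)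
  set Z : Fin n → Ω → ℝ := fun i ω => f (F ω) (X ω) i with hZ
  have hZm : ∀ i, MemLp (Z i) 2 μ := fun i =>
    MemLp.of_bound (hfj i).aestronglyMeasurable B (ae_of_all _ fun ω => hB _ _ _)
  set C : ℕ := (1 + q) ^ (t + 1) * (1 + c₀) ^ (t + 1) with hC
  set D : Fin n → Fin n → Set Ω := fun i j =>
    {ω | Disjoint ((F ω).ball i (t + 1)) ((F ω).ball j (t + 1))} with hD
  have hDm : ∀ i j, MeasurableSet (D i j) := fun i j =>
    hF (t := {G : Network n | Disjoint (G.ball i (t + 1)) (G.ball j (t + 1))}) trivial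
  have hcount : ∀ i, ∑ j, μ.real (D i j)ᶜ ≤ C := fun i => by
    have h1 : ∀ j, μ.real (D i j)ᶜ = ∫ ω, (D i j)ᶜ.indicator (fun _ => (1 : ℝ)) ω ∂μ := fun j => by
      rw [integral_indicator (hDm i j).compl, setIntegral_const, smul_eq_mul, mul_one]
    have hint : ∀ j, Integrable (fun ω => (D i j)ᶜ.indicator (fun _ => (1 : ℝ)) ω) μ := fun j =>
      (integrable_const 1).indicator (hDm i j).compl
    simp only [h1]
    rw [← integral_finsetSum _ fun j _ => hint j]
    calc ∫ ω, ∑ j, (D i j)ᶜ.indicator (fun _ => (1 : ℝ)) ω ∂μ ≤ ∫ _ω, (C : ℝ) ∂μ := by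
          refine integral_mono_ae (integrable_finsetSum _ fun j _ => hint j) (integrable_const _) ?_
          filter_upwards [hq, hc] with ω h2 h3
          have h4 : ∑ j, (D i j)ᶜ.indicator (fun _ => (1 : ℝ)) ω
              = ((Finset.univ.filter fun j => ¬Disjoint ((F ω).ball i (t + 1))
                ((F ω).ball j (t + 1))).card : ℝ) := by
            rw [Finset.card_filter, Nat.cast_sum]
            refine Finset.sum_congr rfl fun j _ => ?_
            simp only [Set.indicator_apply, Set.mem_compl_iff, hD, Set.mem_ofPred_eq,
              Nat.cast_ite, Nat.cast_one, Nat.cast_zero]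
          rw [h4]
          exact Nat.cast_le.2 (card_not_disjoint_le h2 h3 (t + 1) i)
      _ = C := by simp
  have hvar : Var[∑ i, Z i; μ] ≤ n * (4 * B ^ 2 * C) := by
    rw [variance_sum hZm]
    calc ∑ i, ∑ j, cov[Z i, Z j; μ] ≤ ∑ i, ∑ j, 4 * B ^ 2 * μ.real (D i j)ᶜ := by
          refine Finset.sum_le_sum fun i _ => Finset.sum_le_sum fun j _ => ?_
          rw [covariance_eq_sub (hZm i) (hZm j)]
          exact (le_abs_self _).trans
            (abs_covariance_local_le hf hfm hB hF hX hiid hindep i j)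
      _ ≤ ∑ _i : Fin n, 4 * B ^ 2 * C := by
          refine Finset.sum_le_sum fun i _ => ?_
          rw [← Finset.mul_sum]
          exact mul_le_mul_of_nonneg_left (hcount i) (by positivity)
      _ = n * (4 * B ^ 2 * C) := by simp
  have hn' : (0 : ℝ) < n := Nat.cast_pos.2 hn
  have hcheb := meas_ge_le_variance_div_sq (memLp_finsetSum' Finset.univ fun i _ => hZm i)
    (mul_pos hn' hδ)
  refine le_trans (measure_mono fun ω hω => ?_) (hcheb.trans (ENNReal.ofReal_le_ofReal ?_))
  · change δ ≤ _ at hω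
    change n * δ ≤ |(∑ i, Z i) ω - ∫ ω, (∑ i, Z i) ω ∂μ|
    rw [Finset.sum_sub_distrib, abs_mul, abs_of_pos (by positivity), one_div,
      le_inv_mul_iff₀ hn'] at hω
    simp only [Finset.sum_apply]
    rwa [integral_finsetSum _ fun i _ => (hZm i).integrable (by norm_num)]
  · rw [div_le_iff₀ (by positivity)]
    refine hvar.trans (le_of_eq ?_)
    field_simp

end LLN

/-! ### Averages of products of regressors -/

/-- The regressors of player `i` when `p` lists the choice probabilities of all players. -/
def peerRegressor (p : Fin n → Fin (K + 1) → ℝ) (G : Network n) (x : Fin n → Fin d → ℝ)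
    (i : Fin n) : Fin d ⊕ Fin K → ℝ :=
  Sum.elim (x i) fun ℓ => (1 / (G.outDegree i : ℝ)) * ∑ j ∈ G.friends i, p j ℓ.succ

/-- Covariates truncated to `[-M, M]`. The covariates are bounded only almost surely, whereas the law of
large numbers for local statistics asks for bounds at every state. -/
def clampCov (M : ℝ) (x : Fin n → Fin d → ℝ) (i : Fin n) (a : Fin d) : ℝ :=
  max (-M) (min M (x i a))

theorem abs_clampCov_le {M : ℝ} (hM : 0 ≤ M) (x : Fin n → Fin d → ℝ) (i : Fin n) (a : Fin d) :
    |clampCov M x i a| ≤ M :=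
  abs_le.2 ⟨le_max_left _ _, max_le (by linarith) (min_le_left _ _)⟩

theorem clampCov_eq {M : ℝ} {x : Fin n → Fin d → ℝ} (hx : ∀ i a, |x i a| ≤ M) :
    clampCov M x = x := by
  ext i a
  have h := abs_le.1 (hx i a)
  rw [clampCov, min_eq_right h.2, max_eq_right h.1]

theorem measurable_clampCov (M : ℝ) :
    Measurable fun x : Fin n → Fin d → ℝ => clampCov M x := by
  refine measurable_pi_lambda _ fun i => measurable_pi_lambda _ fun a => ?_
  unfold clampCov
  fun_prop

/-- A product of two regressors in which the equilibrium probabilities are replaced by `t` rounds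
of best responses. -/
def localProduct (θ : Param K d) (M : ℝ) (t : ℕ) (a b : Fin d ⊕ Fin K) (G : Network n)
    (x : Fin n → Fin d → ℝ) (i : Fin n) : ℝ :=
  peerRegressor (iterProb θ G (clampCov M x) Finset.univ t) G (clampCov M x) i a *
    peerRegressor (iterProb θ G (clampCov M x) Finset.univ t) G (clampCov M x) i b

theorem abs_peerRegressor_le {p : Fin n → Fin (K + 1) → ℝ} (hp : IsProbProfile p) (G : Network n)
    {x : Fin n → Fin d → ℝ} {M : ℝ} (hM : 1 ≤ M) {i : Fin n} (hx : ∀ a, |x i a| ≤ M)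
    (a : Fin d ⊕ Fin K) : |peerRegressor p G x i a| ≤ M := by
  rcases a with a | ℓ
  · exact hx a
  · exact (abs_average_le _ le_rfl _ zero_le_one fun j _ => hp.abs_le_one j ℓ.succ).trans hM

theorem abs_peerRegressor_sub_le {p p' : Fin n → Fin (K + 1) → ℝ} {D : ℝ} (hD : 0 ≤ D)
    (hpp : ∀ j, ∑ k, |p j k - p' j k| ≤ D) (G : Network n) (x : Fin n → Fin d → ℝ) (i : Fin n)
    (a : Fin d ⊕ Fin K) : |peerRegressor p G x i a - peerRegressor p' G x i a| ≤ D := by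
  rcases a with a | ℓ
  · simpa [peerRegressor] using hD
  · simp only [peerRegressor, Sum.elim_inr]
    rw [← mul_sub, ← Finset.sum_sub_distrib]
    exact abs_average_le _ le_rfl _ hD fun j _ =>
      (Finset.single_le_sum (f := fun k => |p j k - p' j k|) (fun q _ => abs_nonneg _)
        (Finset.mem_univ ℓ.succ)).trans (hpp j)

/-- After `s` rounds the probabilities of a player depend only on what lies within distance `s` of the
player, in a way that does not involve names. -/
theorem iterProb_equivariant {G G' : Network n} {i : Fin n} {π : Equiv.Perm (Fin n)} {t : ℕ}
    (hπ : PreservesFriends π G G' i t) {x x' : Fin n → Fin d → ℝ}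
    (hx : ∀ b ∈ G.ball i (t + 1), x b = x' (π b)) (θ : Param K d) (s : ℕ) (hs : s ≤ t + 1) :
    ∀ a ∈ G.ball i (t + 1 - s),
      iterProb θ G x Finset.univ s a = iterProb θ G' x' Finset.univ s (π a) := by
  induction s with
  | zero => exact fun a _ => rfl
  | succ s ih =>
    intro a ha
    have hat : a ∈ G.ball i t := ball_mono G i (by omega) ha
    have hfr : G.friends a ⊆ G.ball i (t + 1 - s) := by
      have := friends_subset_ball_succ G ha
      rwa [show t + 1 - (s + 1) + 1 = t + 1 - s by omega] at this
    have hdeg : G.outDegree a = G'.outDegree (π a) := by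
      unfold Network.outDegree
      rw [← hπ a hat, Finset.card_map]
    change softmax _ = softmax _
    congr 1
    ext k
    unfold logitIndex
    rw [hx a (ball_mono G i (Nat.le_succ t) hat), hdeg]
    refine congrArg _ (Finset.sum_congr rfl fun ℓ _ => ?_)
    rw [Finset.inter_univ, Finset.inter_univ, ← hπ a hat, Finset.sum_map]
    refine congrArg _ (congrArg _ (Finset.sum_congr rfl fun j hj => ?_))
    exact congrFun (ih (by omega) j (hfr hj)) ℓ

theorem isLocal_localProduct (θ : Param K d) (M : ℝ) (t : ℕ) (a b : Fin d ⊕ Fin K) :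
    IsLocal (n := n) t (localProduct θ M t a b) := by
  intro G G' i π x x' hπ hx
  have hx' : ∀ l ∈ G.ball i (t + 1), clampCov M x l = clampCov M x' (π l) := fun l hl => by
    ext a
    simp only [clampCov, hx l hl]
  have hi : i ∈ G.ball i t := G.mem_ball_self i t
  have hreg : peerRegressor (iterProb θ G (clampCov M x) Finset.univ t) G (clampCov M x) i
      = peerRegressor (iterProb θ G' (clampCov M x') Finset.univ t) G' (clampCov M x') (π i) := by
    unfold peerRegressor
    rw [hx' i (G.mem_ball_self i _)]
    congr 1
    ext ℓ
    have hdeg : G.outDegree i = G'.outDegree (π i) := by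
      unfold Network.outDegree
      rw [← hπ i hi, Finset.card_map]
    rw [hdeg, ← hπ i hi, Finset.sum_map]
    refine congrArg _ (Finset.sum_congr rfl fun j hj => ?_)
    refine congrFun (iterProb_equivariant hπ hx' θ t (Nat.le_succ t) j ?_) ℓ.succ
    rw [show t + 1 - t = 0 + 1 by omega]
    exact friends_subset_ball_succ G (by simp [Network.ball]) hj
  unfold localProduct
  rw [hreg]

theorem measurable_peerRegressor {p : (Fin n → Fin d → ℝ) → Fin n → Fin (K + 1) → ℝ}
    (hp : Measurable p) (G : Network n) (i : Fin n) (a : Fin d ⊕ Fin K) :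
    Measurable fun x => peerRegressor (p x) G x i a := by
  rcases a with a | ℓ
  · simp only [peerRegressor, Sum.elim_inl]
    fun_prop
  · simp only [peerRegressor, Sum.elim_inr]
    fun_prop

theorem measurable_localProduct (θ : Param K d) (M : ℝ) (t : ℕ) (a b : Fin d ⊕ Fin K)
    (G : Network n) (i : Fin n) : Measurable fun x => localProduct θ M t a b G x i :=
  ((measurable_peerRegressor (measurable_iterProb θ G Finset.univ t) G i a).mul
    (measurable_peerRegressor (measurable_iterProb θ G Finset.univ t) G i b)).comp
      (measurable_clampCov M)

theorem abs_localProduct_le (θ : Param K d) {M : ℝ} (hM : 1 ≤ M) (t : ℕ) (a b : Fin d ⊕ Fin K)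
    (G : Network n) (x : Fin n → Fin d → ℝ) (i : Fin n) :
    |localProduct θ M t a b G x i| ≤ M * M := by
  have h := abs_peerRegressor_le (isProbProfile_iterProb θ G (clampCov M x) Finset.univ t) G hM
    (abs_clampCov_le (by linarith) x i)
  unfold localProduct
  rw [abs_mul]
  exact mul_le_mul (h a) (h b) (abs_nonneg _) (by linarith)

/-- The regressors at the equilibrium. -/
def eqRegressor (θ : Param K d) (G : Network n) (x : Fin n → Fin d → ℝ) (i : Fin n) :
    Fin d ⊕ Fin K → ℝ :=
  peerRegressor (fullProb θ G x) G x i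

theorem regressor_eq {lam : ℝ} (hlam1 : lam < 1) {θ : Param K d} (hθ : StableAt lam θ)
    {G : Network n} {x : Fin n → Fin d → ℝ} {r : Profile K n} (hr : IsBNE θ G x r) (i : Fin n) :
    regressor r G x i = eqRegressor θ G x i := by
  unfold regressor eqRegressor peerRegressor
  rw [choiceProb_eq_fullProb hlam1 hθ hr]

theorem abs_eqRegressor_le {lam : ℝ} (hlam1 : lam < 1) {θ : Param K d} (hθ : StableAt lam θ)
    (G : Network n) {x : Fin n → Fin d → ℝ} {M : ℝ} (hM : 1 ≤ M) {i : Fin n}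
    (hx : ∀ a, |x i a| ≤ M) (a : Fin d ⊕ Fin K) : |eqRegressor θ G x i a| ≤ M :=
  abs_peerRegressor_le (isProbProfile_fullProb hlam1 hθ G x) G hM hx a

theorem abs_eqRegressor_mul_sub_le {lam : ℝ} (hlam1 : lam < 1) {θ : Param K d}
    (hθ : StableAt lam θ) (G : Network n) {x : Fin n → Fin d → ℝ} {M : ℝ} (hM : 1 ≤ M)
    (hx : ∀ i a, |x i a| ≤ M) (t : ℕ) (i : Fin n) (a b : Fin d ⊕ Fin K) :
    |eqRegressor θ G x i a * eqRegressor θ G x i b - localProduct θ M t a b G x i|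
      ≤ 4 * M * lam ^ t := by
  have hlam : 0 ≤ lam := le_trans (by positivity) (hθ 0 0 0)
  unfold localProduct
  rw [clampCov_eq hx]
  set w := peerRegressor (iterProb θ G x Finset.univ t) G x i with hw
  have h1 : ∀ a, |eqRegressor θ G x i a - w a| ≤ 2 * lam ^ t := fun a => by
    rw [abs_sub_comm]
    exact abs_peerRegressor_sub_le (by positivity)
      (sum_abs_iterProb_sub_le hθ (solves_fullProb hlam1 hθ G x) t) G x i a
  have h2 := abs_eqRegressor_le hlam1 hθ G hM (hx i)
  have h3 : ∀ a, |w a| ≤ M := abs_peerRegressor_le (isProbProfile_iterProb θ G x Finset.univ t) G hM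
    (hx i)
  have e : eqRegressor θ G x i a * eqRegressor θ G x i b - w a * w b
      = eqRegressor θ G x i a * (eqRegressor θ G x i b - w b)
        + (eqRegressor θ G x i a - w a) * w b := by ring
  rw [e]
  refine (abs_add_le _ _).trans ?_
  rw [abs_mul, abs_mul]
  have e1 := mul_le_mul (h2 a) (h1 b) (abs_nonneg _) (by linarith)
  have e2 := mul_le_mul (h1 a) (h3 b) (abs_nonneg _) (by positivity)
  linarith

section Moments

variable {Ω : Type*} [MeasurableSpace Ω] {μ : Measure Ω}
  {F : Ω → Network n} {X : Ω → Fin n → Fin d → ℝ}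

theorem measurable_eqRegressor {lam : ℝ} (hlam1 : lam < 1) {θ : Param K d} (hθ : StableAt lam θ)
    (hF : Measurable F) (hX : Measurable X) (i : Fin n) (a : Fin d ⊕ Fin K) :
    Measurable fun ω => eqRegressor θ (F ω) (X ω) i a := by
  have h : Measurable fun S : Network n × (Fin n → Fin d → ℝ) => eqRegressor θ S.1 S.2 i a := by
    refine measurable_from_prod_countable_right fun G => ?_
    exact measurable_peerRegressor (p := fun x => fullProb θ G x)
      (measurable_fullProb hlam1 hθ G) G i a
  simpa only [Function.comp_def] using h.comp (hF.prodMk hX)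

/-- The matrix `E(W_i W_i')` at the equilibrium. -/
def eqMoment (μ : Measure Ω) (θ : Param K d) (F : Ω → Network n) (X : Ω → Fin n → Fin d → ℝ)
    (i : Fin n) (a b : Fin d ⊕ Fin K) : ℝ :=
  ∫ ω, eqRegressor θ (F ω) (X ω) i a * eqRegressor θ (F ω) (X ω) i b ∂μ

theorem secondMoment_eq {lam : ℝ} (hlam1 : lam < 1) {θ : Param K d} (hθ : StableAt lam θ)
    {r : Network n → (Fin n → Fin d → ℝ) → Profile K n} (hr : ∀ G x, IsBNE θ G x (r G x))
    (i : Fin n) : secondMoment μ r F X i = Matrix.of (eqMoment μ θ F X i) := by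
  ext a b
  simp only [secondMoment, eqMoment, Matrix.of_apply, regressor_eq hlam1 hθ (hr _ _)]

variable [IsProbabilityMeasure μ]

theorem integrable_eqRegressor_mul {lam : ℝ} (hlam1 : lam < 1) {θ : Param K d}
    (hθ : StableAt lam θ) (hF : Measurable F) (hX : Measurable X) {M : ℝ} (hM : 1 ≤ M)
    (hXM : ∀ᵐ ω ∂μ, ∀ i a, |X ω i a| ≤ M) (i : Fin n) (a b : Fin d ⊕ Fin K) :
    Integrable (fun ω => eqRegressor θ (F ω) (X ω) i a * eqRegressor θ (F ω) (X ω) i b) μ := by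
  refine Integrable.of_bound ((measurable_eqRegressor hlam1 hθ hF hX i a).mul
    (measurable_eqRegressor hlam1 hθ hF hX i b)).aestronglyMeasurable (M * M) ?_
  filter_upwards [hXM] with ω hω
  rw [Real.norm_eq_abs, abs_mul]
  exact mul_le_mul (abs_eqRegressor_le hlam1 hθ _ hM (hω i) a)
    (abs_eqRegressor_le hlam1 hθ _ hM (hω i) b) (abs_nonneg _) (by linarith)

/-- The averages of the products of regressors concentrate around their means. -/
theorem measure_regressor_average_ge_le {lam : ℝ} (hlam1 : lam < 1) {θ : Param K d}
    (hθ : StableAt lam θ) (hF : Measurable F) (hX : Measurable X) {M : ℝ} (hM : 1 ≤ M)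
    (hXM : ∀ᵐ ω ∂μ, ∀ i a, |X ω i a| ≤ M)
    (hiid : IIDCovariates μ F X) (hindep : IndependentSubgraphs μ F) {q c₀ : ℕ}
    (hq : ∀ᵐ ω ∂μ, ∀ i, ((F ω).friends i).card ≤ q) (hc : ∀ᵐ ω ∂μ, ∀ i, (F ω).inDegree i ≤ c₀)
    (hn : 0 < n) {δ : ℝ} (hδ : 0 < δ) {t : ℕ} (ht : 4 * M * lam ^ t ≤ δ / 4)
    (a b : Fin d ⊕ Fin K) :
    μ {ω | δ ≤ |1 / (n : ℝ) * ∑ i, (eqRegressor θ (F ω) (X ω) i a * eqRegressor θ (F ω) (X ω) i b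
        - eqMoment μ θ F X i a b)|}
      ≤ ENNReal.ofReal (4 * (M * M) ^ 2 * ((1 + q) ^ (t + 1) * (1 + c₀) ^ (t + 1) : ℕ)
        / (δ / 2) ^ 2 * (n : ℝ)⁻¹) := by
  refine le_trans (measure_mono_ae ?_) (measure_local_average_ge_le
    (isLocal_localProduct θ M t a b) (measurable_localProduct θ M t a b)
    (abs_localProduct_le θ hM t a b) hF hX hiid hindep hq hc hn (half_pos hδ))
  filter_upwards [hXM] with ω hω hmem
  change δ ≤ _ at hmem
  change δ / 2 ≤ |1 / (n : ℝ) * ∑ i, (localProduct θ M t a b (F ω) (X ω) i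
    - ∫ ω, localProduct θ M t a b (F ω) (X ω) i ∂μ)|
  have hn' : (0 : ℝ) < n := Nat.cast_pos.2 hn
  have hpt : ∀ i, |eqRegressor θ (F ω) (X ω) i a * eqRegressor θ (F ω) (X ω) i b
      - localProduct θ M t a b (F ω) (X ω) i| ≤ δ / 4 := fun i =>
    (abs_eqRegressor_mul_sub_le hlam1 hθ (F ω) hM hω t i a b).trans ht
  have hloc : ∀ i, Integrable (fun ω => localProduct θ M t a b (F ω) (X ω) i) μ := fun i =>
    Integrable.of_bound ((measurable_from_prod_countable_right
      (f := fun S : Network n × (Fin n → Fin d → ℝ) => localProduct θ M t a b S.1 S.2 i)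
      fun G => measurable_localProduct θ M t a b G i).comp (hF.prodMk hX)).aestronglyMeasurable
      (M * M) (ae_of_all _ fun ω => abs_localProduct_le θ hM t a b _ _ _)
  have hmean : ∀ i, |eqMoment μ θ F X i a b
      - ∫ ω, localProduct θ M t a b (F ω) (X ω) i ∂μ| ≤ δ / 4 := fun i => by
    unfold eqMoment
    rw [← integral_sub (integrable_eqRegressor_mul hlam1 hθ hF hX hM hXM i a b) (hloc i)]
    have h := norm_integral_le_of_norm_le_const (μ := μ) (C := δ / 4)
      (f := fun ω => eqRegressor θ (F ω) (X ω) i a * eqRegressor θ (F ω) (X ω) i b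
        - localProduct θ M t a b (F ω) (X ω) i) (by
        filter_upwards [hXM] with ω hω
        exact (abs_eqRegressor_mul_sub_le hlam1 hθ (F ω) hM hω t i a b).trans ht)
    simpa using h
  have hdiff : |1 / (n : ℝ) * ∑ i, (eqRegressor θ (F ω) (X ω) i a * eqRegressor θ (F ω) (X ω) i b
        - eqMoment μ θ F X i a b)
      - 1 / (n : ℝ) * ∑ i, (localProduct θ M t a b (F ω) (X ω) i
        - ∫ ω, localProduct θ M t a b (F ω) (X ω) i ∂μ)| ≤ δ / 2 := by
    rw [← mul_sub, ← Finset.sum_sub_distrib]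
    refine abs_average_le Finset.univ (by simp) _ (by positivity) fun i _ => ?_
    have h1 := abs_le.1 (hpt i)
    have h2 := abs_le.1 (hmean i)
    rw [abs_le]
    constructor <;> linarith [h1.1, h1.2, h2.1, h2.2]
  have := abs_sub_abs_le_abs_sub
    (1 / (n : ℝ) * ∑ i, (eqRegressor θ (F ω) (X ω) i a * eqRegressor θ (F ω) (X ω) i b
        - eqMoment μ θ F X i a b))
    (1 / (n : ℝ) * ∑ i, (localProduct θ M t a b (F ω) (X ω) i
        - ∫ ω, localProduct θ M t a b (F ω) (X ω) i ∂μ))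
  linarith

/-! ### The rank condition -/

/-- Positive semidefinite matrices with bounded entries and determinant bounded away from zero are
uniformly positive definite. -/
theorem exists_forall_mul_le_quadratic {ι : Type*} [Fintype ι] [DecidableEq ι] (B : ℝ) {κ : ℝ}
    (hκ : 0 < κ) :
    ∃ κ' : ℝ, 0 < κ' ∧ ∀ A : Matrix ι ι ℝ, A.PosSemidef → (∀ a b, |A a b| ≤ B) → κ ≤ A.det →
      ∀ v : ι → ℝ, κ' * ∑ a, v a ^ 2 ≤ ∑ a, ∑ b, v a * A a b * v b := by
  -- The quadratic form is positive on the compact set of admissible matrices and unit vectors.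
  set S : Set ((ι → ι → ℝ) × (ι → ℝ)) := {z | (∀ a b, z.1 a b = z.1 b a) ∧
    (∀ w : ι → ℝ, 0 ≤ ∑ a, ∑ b, w a * z.1 a b * w b) ∧ (∀ a b, |z.1 a b| ≤ B) ∧
    κ ≤ (Matrix.of z.1).det ∧ ∑ a, z.2 a ^ 2 = 1} with hS
  have hpsd : ∀ A : ι → ι → ℝ, (∀ a b, A a b = A b a) →
      (∀ w : ι → ℝ, 0 ≤ ∑ a, ∑ b, w a * A a b * w b) → (Matrix.of A).PosSemidef := by
    intro A h1 h2
    refine Matrix.PosSemidef.of_dotProduct_mulVec_nonneg ?_ fun w => ?_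
    · ext a b
      simpa using h1 b a
    · refine (h2 w).trans (le_of_eq ?_)
      simp only [dotProduct, Matrix.mulVec, star_trivial, Matrix.of_apply, Finset.mul_sum]
      exact Finset.sum_congr rfl fun a _ => Finset.sum_congr rfl fun b _ => by ring
  have hquad : ∀ (A : Matrix ι ι ℝ) (w : ι → ℝ),
      ∑ a, ∑ b, w a * A a b * w b = star w ⬝ᵥ (A.mulVec w) := by
    intro A w
    simp only [dotProduct, Matrix.mulVec, star_trivial, Finset.mul_sum]
    exact Finset.sum_congr rfl fun a _ => Finset.sum_congr rfl fun b _ => by ring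
  have hclosed : IsClosed S := by
    simp only [hS, Set.ofPred_and, Set.ofPred_forall]
    refine IsClosed.inter ?_ (IsClosed.inter ?_ (IsClosed.inter ?_ (IsClosed.inter ?_ ?_)))
    · exact isClosed_iInter fun a => isClosed_iInter fun b =>
        isClosed_eq (by fun_prop) (by fun_prop)
    · exact isClosed_iInter fun w => isClosed_le (by fun_prop) (by fun_prop)
    · exact isClosed_iInter fun a => isClosed_iInter fun b =>
        isClosed_le (by fun_prop) (by fun_prop)
    · exact isClosed_le (by fun_prop)
        (Continuous.matrix_det (A := fun z : (ι → ι → ℝ) × (ι → ℝ) => Matrix.of z.1)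
          continuous_fst)
    · exact isClosed_eq (by fun_prop) (by fun_prop)
  have hcomp : IsCompact S := by
    refine Metric.isCompact_of_isClosed_isBounded hclosed ?_
    refine (Metric.isBounded_closedBall (x := (0 : (ι → ι → ℝ) × (ι → ℝ)))
      (r := max |B| 1)).subset fun z hz => ?_
    have h0 : (0 : ℝ) ≤ max |B| 1 := le_max_of_le_right zero_le_one
    rw [mem_closedBall_zero_iff, Prod.norm_def]
    refine max_le ?_ ?_
    · refine (pi_norm_le_iff_of_nonneg h0).2 fun a => (pi_norm_le_iff_of_nonneg h0).2 fun b => ?_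
      exact ((hz.2.2.1 a b).trans (le_abs_self B)).trans (le_max_left _ _)
    · refine (pi_norm_le_iff_of_nonneg h0).2 fun a => le_max_of_le_right ?_
      have h1 : z.2 a ^ 2 ≤ 1 := by
        rw [← hz.2.2.2.2]
        exact Finset.single_le_sum (f := fun a => z.2 a ^ 2) (fun a _ => sq_nonneg _)
          (Finset.mem_univ a)
      rwa [Real.norm_eq_abs, ← sq_le_one_iff_abs_le_one]
  have hcont : ContinuousOn
      (fun z : (ι → ι → ℝ) × (ι → ℝ) => ∑ a, ∑ b, z.2 a * z.1 a b * z.2 b) S := by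
    fun_prop
  have hpos : ∀ z ∈ S, 0 < ∑ a, ∑ b, z.2 a * z.1 a b * z.2 b := by
    intro z hz
    have hdet : (Matrix.of z.1).det ≠ 0 := (hκ.trans_le hz.2.2.2.1).ne'
    have hpd := (hpsd z.1 hz.1 hz.2.1).posDef_iff_det_ne_zero.2 hdet
    have hne : z.2 ≠ 0 := fun h => by
      have := hz.2.2.2.2
      simp [h] at this
    have := hpd.dotProduct_mulVec_pos hne
    rw [← hquad] at this
    exact this
  have hmin : ∃ κ' : ℝ, 0 < κ' ∧ ∀ z ∈ S, κ' ≤ ∑ a, ∑ b, z.2 a * z.1 a b * z.2 b := by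
    rcases S.eq_empty_or_nonempty with h | h
    · exact ⟨1, one_pos, by simp [h]⟩
    · obtain ⟨z, hz, hzmin⟩ := hcomp.exists_isMinOn h hcont
      exact ⟨_, hpos z hz, fun y hy => hzmin hy⟩
  obtain ⟨κ', hκ', hle⟩ := hmin
  refine ⟨κ', hκ', fun A hA hAB hAd v => ?_⟩
  have hA2 : ∀ w : ι → ℝ, 0 ≤ ∑ a, ∑ b, w a * A a b * w b := fun w => by
    rw [hquad]
    exact hA.dotProduct_mulVec_nonneg w
  rcases (Finset.sum_nonneg fun a _ => sq_nonneg (v a)).eq_or_lt' with h0 | h0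
  · rw [h0, mul_zero]
    exact hA2 v
  · set N := ∑ a, v a ^ 2 with hN
    have hs : Real.sqrt N ^ 2 = N := Real.sq_sqrt h0.le
    have hmem : ((A : ι → ι → ℝ), fun a => v a / Real.sqrt N) ∈ S := by
      refine ⟨fun a b => ?_, hA2, hAB, hAd, ?_⟩
      · have := congrFun (congrFun hA.isHermitian b) a
        simpa using this
      · simp only [div_pow, hs]
        rw [← Finset.sum_div]
        exact div_self h0.ne'
    have h1 := hle _ hmem
    have h2 : ∑ a, ∑ b, v a / Real.sqrt N * A a b * (v b / Real.sqrt N)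
        = (∑ a, ∑ b, v a * A a b * v b) / N := by
      rw [Finset.sum_div]
      refine Finset.sum_congr rfl fun a _ => ?_
      rw [Finset.sum_div]
      refine Finset.sum_congr rfl fun b _ => ?_
      nth_rewrite 3 [← hs]
      field_simp
    simp only [h2] at h1
    rwa [le_div_iff₀ h0] at h1

theorem posSemidef_eqMoment {lam : ℝ} (hlam1 : lam < 1) {θ : Param K d}
    (hθ : StableAt lam θ) (hF : Measurable F) (hX : Measurable X) {M : ℝ} (hM : 1 ≤ M)
    (hXM : ∀ᵐ ω ∂μ, ∀ i a, |X ω i a| ≤ M) (i : Fin n) :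
    (Matrix.of (eqMoment μ θ F X i)).PosSemidef := by
  refine Matrix.PosSemidef.of_dotProduct_mulVec_nonneg ?_ fun w => ?_
  · ext a b
    simp only [Matrix.conjTranspose_apply, Matrix.of_apply, star_trivial, eqMoment, mul_comm]
  · have hint := integrable_eqRegressor_mul hlam1 hθ hF hX hM hXM i
    have h : star w ⬝ᵥ (Matrix.of (eqMoment μ θ F X i)).mulVec w
        = ∫ ω, (∑ a, w a * eqRegressor θ (F ω) (X ω) i a) ^ 2 ∂μ := by
      have e : ∀ ω, (∑ a, w a * eqRegressor θ (F ω) (X ω) i a) ^ 2 = ∑ a, ∑ b, w a * w b *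
          (eqRegressor θ (F ω) (X ω) i a * eqRegressor θ (F ω) (X ω) i b) := fun ω => by
        rw [sq, Finset.sum_mul_sum]
        exact Finset.sum_congr rfl fun a _ => Finset.sum_congr rfl fun b _ => by ring
      simp only [e]
      rw [integral_finsetSum _ fun a _ => integrable_finsetSum _ fun b _ => (hint a b).const_mul _]
      simp only [dotProduct, Matrix.mulVec, star_trivial, Matrix.of_apply, Finset.mul_sum]
      refine Finset.sum_congr rfl fun a _ => ?_
      rw [integral_finsetSum _ fun b _ => (hint a b).const_mul _]
      refine Finset.sum_congr rfl fun b _ => ?_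
      rw [integral_const_mul]
      unfold eqMoment
      ring
    rw [h]
    exact integral_nonneg fun ω => sq_nonneg _

theorem abs_eqMoment_le {lam : ℝ} (hlam1 : lam < 1) {θ : Param K d}
    (hθ : StableAt lam θ) {M : ℝ} (hM : 1 ≤ M)
    (hXM : ∀ᵐ ω ∂μ, ∀ i a, |X ω i a| ≤ M) (i : Fin n) (a b : Fin d ⊕ Fin K) :
    |eqMoment μ θ F X i a b| ≤ M * M := by
  have h := norm_integral_le_of_norm_le_const (μ := μ) (C := M * M)
    (f := fun ω => eqRegressor θ (F ω) (X ω) i a * eqRegressor θ (F ω) (X ω) i b) (by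
      filter_upwards [hXM] with ω hω
      rw [Real.norm_eq_abs, abs_mul]
      exact mul_le_mul (abs_eqRegressor_le hlam1 hθ _ hM (hω i) a)
        (abs_eqRegressor_le hlam1 hθ _ hM (hω i) b) (abs_nonneg _) (by linarith))
  simpa [eqMoment] using h

end Moments

/-! ### Identification -/

/-- The squared Euclidean distance of two probability vectors is at most four times their
Kullback-Leibler divergence: `log u ≤ 2 (√u - 1)` reduces the divergence to the Hellinger
distance. -/
theorem sum_sq_sub_le_kl {p q : Fin (K + 1) → ℝ} (hp : ∀ k, 0 < p k) (hq : ∀ k, 0 < q k)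
    (hp1 : ∑ k, p k = 1) (hq1 : ∑ k, q k = 1) :
    ∑ k, (p k - q k) ^ 2 ≤ 4 * ∑ k, p k * (Real.log (p k) - Real.log (q k)) := by
  have hle1 : ∀ {f : Fin (K + 1) → ℝ}, (∀ k, 0 < f k) → ∑ k, f k = 1 → ∀ k, f k ≤ 1 :=
    fun {f} hf hf1 k => hf1 ▸ Finset.single_le_sum (fun k _ => (hf k).le) (Finset.mem_univ k)
  have hterm : ∀ k, (p k - q k) ^ 2
      ≤ 4 * (p k * (Real.log (p k) - Real.log (q k)) - p k + q k) := by
    intro k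
    set a := Real.sqrt (p k) with ha
    set b := Real.sqrt (q k) with hb
    have ha2 : a ^ 2 = p k := Real.sq_sqrt (hp k).le
    have hb2 : b ^ 2 = q k := Real.sq_sqrt (hq k).le
    have ha0 : 0 < a := Real.sqrt_pos.2 (hp k)
    have hb0 : 0 < b := Real.sqrt_pos.2 (hq k)
    have ha1 : a ≤ 1 := Real.sqrt_le_one.2 (hle1 hp hp1 k)
    have hb1 : b ≤ 1 := Real.sqrt_le_one.2 (hle1 hq hq1 k)
    have h1 := Real.log_le_sub_one_of_pos (div_pos hb0 ha0)
    rw [Real.log_div hb0.ne' ha0.ne', le_sub_iff_add_le, le_div_iff₀ ha0] at h1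
    have hla : Real.log (p k) = 2 * Real.log a := by rw [← ha2, Real.log_pow]; norm_num
    have hlb : Real.log (q k) = 2 * Real.log b := by rw [← hb2, Real.log_pow]; norm_num
    have h2 : (a - b) ^ 2 ≤ p k * (Real.log (p k) - Real.log (q k)) - p k + q k := by
      rw [hla, hlb, ← ha2, ← hb2]
      nlinarith [mul_le_mul_of_nonneg_left h1 ha0.le]
    have h3 : (p k - q k) ^ 2 = (a + b) ^ 2 * (a - b) ^ 2 := by
      rw [← ha2, ← hb2]
      ring
    have h4 : (a + b) ^ 2 ≤ 4 := by nlinarith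
    rw [h3]
    exact mul_le_mul h4 h2 (sq_nonneg _) (by norm_num)
  refine (Finset.sum_le_sum fun k _ => hterm k).trans (le_of_eq ?_)
  rw [← Finset.mul_sum, Finset.sum_add_distrib, Finset.sum_sub_distrib, hp1, hq1]
  ring

/-- The coefficients of `W_i` in the difference of the indices of action `k` at `θ` and at `c`. -/
def coefDiff (θ c : Param K d) (k : Fin K) : Fin d ⊕ Fin K → ℝ :=
  Sum.elim (fun a => θ.1 k a - c.1 k a) fun ℓ => θ.2 k ℓ - c.2 k ℓ

theorem logitIndex_succ (c : Param K d) (G : Network n) (x : Fin n → Fin d → ℝ)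
    (σ : Fin n → Fin (K + 1) → ℝ) (i : Fin n) (k : Fin K) :
    logitIndex c G x Finset.univ σ i k.succ = ∑ a, x i a * c.1 k a
      + ∑ ℓ, c.2 k ℓ * ((1 / (G.outDegree i : ℝ)) * ∑ j ∈ G.friends i, σ j ℓ.succ) := by
  unfold logitIndex
  rw [Fin.sum_univ_succ]
  simp [alpha, beta]

theorem sum_eqRegressor_mul_coefDiff (θ c : Param K d) (G : Network n) (x : Fin n → Fin d → ℝ)
    (i : Fin n) (k : Fin K) :
    ∑ a, coefDiff θ c k a * eqRegressor θ G x i a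
      = (eqIndex θ G x i k.succ - eqIndex c G x i k.succ)
        - ∑ ℓ, c.2 k ℓ * ((1 / (G.outDegree i : ℝ)) *
          ∑ j ∈ G.friends i, (fullProb θ G x j ℓ.succ - fullProb c G x j ℓ.succ)) := by
  unfold eqIndex
  rw [logitIndex_succ, logitIndex_succ, Fintype.sum_sum_type]
  simp only [coefDiff, eqRegressor, peerRegressor, Sum.elim_inl, Sum.elim_inr,
    Finset.sum_sub_distrib, mul_sub, sub_mul]
  have h1 : ∑ a, θ.1 k a * x i a = ∑ a, x i a * θ.1 k a :=
    Finset.sum_congr rfl fun a _ => mul_comm _ _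
  have h2 : ∑ a, c.1 k a * x i a = ∑ a, x i a * c.1 k a :=
    Finset.sum_congr rfl fun a _ => mul_comm _ _
  rw [h1, h2]
  ring

theorem sq_average_le {ι : Type*} (s : Finset ι) (u : ι → ℝ) :
    (1 / (s.card : ℝ) * ∑ j ∈ s, u j) ^ 2 ≤ ∑ j ∈ s, u j ^ 2 := by
  rcases s.eq_empty_or_nonempty with h | h
  · simp [h]
  · have hc : (1 : ℝ) ≤ s.card := Nat.one_le_cast.2 h.card_pos
    have h1 := sq_sum_le_card_mul_sum_sq (s := s) (f := u)
    have h2 : 0 ≤ ∑ j ∈ s, u j ^ 2 := Finset.sum_nonneg fun j _ => sq_nonneg _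
    rw [mul_pow, one_div, inv_pow, inv_mul_le_iff₀ (by positivity)]
    nlinarith

/-- Summing over players and their friends counts each player as often as she is nominated. -/
theorem sum_friends_le {G : Network n} {c₀ : ℕ} (hc : ∀ i, G.inDegree i ≤ c₀) {s : Fin n → ℝ}
    (hs : ∀ j, 0 ≤ s j) : ∑ i, ∑ j ∈ G.friends i, s j ≤ c₀ * ∑ j, s j := by
  have h1 : ∑ i, ∑ j ∈ G.friends i, s j = ∑ j, (G.inDegree j : ℝ) * s j := by
    have : ∀ i, ∑ j ∈ G.friends i, s j = ∑ j, if j ∈ G.friends i then s j else 0 := fun i => by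
      rw [← Finset.sum_filter]
      exact Finset.sum_congr (by ext; simp) fun _ _ => rfl
    simp only [this]
    rw [Finset.sum_comm]
    refine Finset.sum_congr rfl fun j _ => ?_
    rw [← Finset.sum_filter, Finset.sum_const, nsmul_eq_mul]
    rfl
  rw [h1, Finset.mul_sum]
  exact Finset.sum_le_sum fun j _ =>
    mul_le_mul_of_nonneg_right (Nat.cast_le.2 (hc j)) (hs j)

/-- The sum over players of the Kullback-Leibler divergences of the choice probabilities at `c` from
those at `θ`. -/
def divergence (θ c : Param K d) (G : Network n) (x : Fin n → Fin d → ℝ) : ℝ :=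
  ∑ i, ∑ k, fullProb θ G x i k * (Real.log (fullProb θ G x i k) - Real.log (fullProb c G x i k))

/-- The constant in the identification bound. -/
def identConst (K d : ℕ) (M R : ℝ) (c₀ : ℕ) : ℝ :=
  4 * (8 / probFloor K d M R ^ 2 + 2 * K * R ^ 2 * c₀)

theorem abs_snd_le (c : Param K d) (k ℓ : Fin K) : |c.2 k ℓ| ≤ ‖c‖ := by
  rw [← Real.norm_eq_abs]
  exact ((norm_le_pi_norm (c.2 k) ℓ).trans (norm_le_pi_norm c.2 k)).trans (norm_snd_le c)

/-- Close choice probabilities force close indices. Log-odds give the indices of a player, the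
bounded in-degree controls the effect of the choices of her friends. -/
theorem sum_sq_coefDiff_le {lam : ℝ} (hlam1 : lam < 1) {θ c : Param K d}
    (hθ : StableAt lam θ) (hc : StableAt lam c) {R : ℝ} (hθR : ‖θ‖ ≤ R) (hcR : ‖c‖ ≤ R)
    {G : Network n} {x : Fin n → Fin d → ℝ} {M : ℝ} (hM : 0 ≤ M) (hx : ∀ j a, |x j a| ≤ M)
    {c₀ : ℕ} (hdeg : ∀ i, G.inDegree i ≤ c₀) (k : Fin K) :
    ∑ i, (∑ a, coefDiff θ c k a * eqRegressor θ G x i a) ^ 2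
      ≤ identConst K d M R c₀ * divergence θ c G x := by
  have hR0 : 0 ≤ R := (norm_nonneg θ).trans hθR
  set p := probFloor K d M R with hp
  have hp0 : 0 < p := probFloor_pos K d M R
  set D : Fin n → Fin (K + 1) → ℝ := fun j m => fullProb θ G x j m - fullProb c G x j m with hD
  set s : Fin n → ℝ := fun j => ∑ m, D j m ^ 2 with hs
  have hs0 : ∀ j, 0 ≤ s j := fun j => Finset.sum_nonneg fun m _ => sq_nonneg _
  have hDs : ∀ j m, D j m ^ 2 ≤ s j := fun j m =>
    Finset.single_le_sum (f := fun m => D j m ^ 2) (fun m _ => sq_nonneg _) (Finset.mem_univ m)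
  have hidx : ∀ (e : Param K d), StableAt lam e → ∀ i, eqIndex e G x i k.succ
      = Real.log (fullProb e G x i k.succ) - Real.log (fullProb e G x i 0) := fun e he i => by
    rw [fullProb_eq hlam1 he G x i, log_softmax_sub, logitIndex_zero, sub_zero]
    rfl
  have hlog : ∀ i m, |Real.log (fullProb θ G x i m) - Real.log (fullProb c G x i m)|
      ≤ |D i m| / p := fun i m =>
    abs_log_sub_log_le hp0 (probFloor_le_fullProb hlam1 hθ hθR G hM hx i m)
      (probFloor_le_fullProb hlam1 hc hcR G hM hx i m)
  have hΔ : ∀ i, (eqIndex θ G x i k.succ - eqIndex c G x i k.succ) ^ 2 ≤ 4 / p ^ 2 * s i := by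
    intro i
    have h1 : |eqIndex θ G x i k.succ - eqIndex c G x i k.succ|
        ≤ (|D i k.succ| + |D i 0|) / p := by
      rw [hidx θ hθ, hidx c hc, sub_sub_sub_comm, add_div]
      exact (abs_sub _ _).trans (add_le_add (hlog i _) (hlog i _))
    rw [← sq_abs]
    refine (pow_le_pow_left₀ (abs_nonneg _) h1 2).trans ?_
    rw [div_pow, div_mul_eq_mul_div]
    refine div_le_div_of_nonneg_right ?_ (by positivity)
    have h2 := hDs i k.succ
    have h3 := hDs i 0
    rw [← sq_abs] at h2 h3
    nlinarith [sq_nonneg (|D i k.succ| - |D i 0|)]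
  have hT : ∀ i, (∑ ℓ, c.2 k ℓ * ((1 / (G.outDegree i : ℝ)) * ∑ j ∈ G.friends i, D j ℓ.succ)) ^ 2
      ≤ K * R ^ 2 * ∑ j ∈ G.friends i, s j := by
    intro i
    have h1 := sq_sum_le_card_mul_sum_sq (s := (Finset.univ : Finset (Fin K)))
      (f := fun ℓ => c.2 k ℓ * ((1 / (G.outDegree i : ℝ)) * ∑ j ∈ G.friends i, D j ℓ.succ))
    rw [Finset.card_univ, Fintype.card_fin] at h1
    refine h1.trans ?_
    rw [mul_assoc]
    refine mul_le_mul_of_nonneg_left ?_ (Nat.cast_nonneg K)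
    calc ∑ ℓ, (c.2 k ℓ * ((1 / (G.outDegree i : ℝ)) * ∑ j ∈ G.friends i, D j ℓ.succ)) ^ 2
        ≤ ∑ ℓ : Fin K, R ^ 2 * ∑ j ∈ G.friends i, D j ℓ.succ ^ 2 := by
          refine Finset.sum_le_sum fun ℓ _ => ?_
          rw [mul_pow]
          refine mul_le_mul ?_ (sq_average_le _ _) (sq_nonneg _) (sq_nonneg _)
          rw [← sq_abs]
          exact pow_le_pow_left₀ (abs_nonneg _) ((abs_snd_le c k ℓ).trans hcR) 2
      _ = R ^ 2 * ∑ j ∈ G.friends i, ∑ ℓ : Fin K, D j ℓ.succ ^ 2 := by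
          rw [← Finset.mul_sum, Finset.sum_comm]
      _ ≤ R ^ 2 * ∑ j ∈ G.friends i, s j := by
          refine mul_le_mul_of_nonneg_left (Finset.sum_le_sum fun j _ => ?_) (sq_nonneg R)
          simp only [hs]
          rw [Fin.sum_univ_succ]
          linarith [sq_nonneg (D j 0)]
  have hi : ∀ i, (∑ a, coefDiff θ c k a * eqRegressor θ G x i a) ^ 2
      ≤ 8 / p ^ 2 * s i + 2 * K * R ^ 2 * ∑ j ∈ G.friends i, s j := by
    intro i
    rw [sum_eqRegressor_mul_coefDiff]
    have h1 := hΔ i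
    have h2 := hT i
    set u := eqIndex θ G x i k.succ - eqIndex c G x i k.succ with hu
    set w := ∑ ℓ, c.2 k ℓ * ((1 / (G.outDegree i : ℝ)) * ∑ j ∈ G.friends i, D j ℓ.succ) with hw
    have h3 : (u - w) ^ 2 ≤ 2 * u ^ 2 + 2 * w ^ 2 := by nlinarith [sq_nonneg (u + w)]
    have h4 : 8 / p ^ 2 * s i = 2 * (4 / p ^ 2 * s i) := by ring
    change (u - w) ^ 2 ≤ _
    rw [h4]
    linarith
  have hkl : ∑ i, s i ≤ 4 * divergence θ c G x := by
    unfold divergence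
    rw [Finset.mul_sum]
    refine Finset.sum_le_sum fun i _ => ?_
    exact sum_sq_sub_le_kl
      (fun m => hp0.trans_le (probFloor_le_fullProb hlam1 hθ hθR G hM hx i m))
      (fun m => hp0.trans_le (probFloor_le_fullProb hlam1 hc hcR G hM hx i m))
      (isProbProfile_fullProb hlam1 hθ G x i).2 (isProbProfile_fullProb hlam1 hc G x i).2
  calc ∑ i, (∑ a, coefDiff θ c k a * eqRegressor θ G x i a) ^ 2
      ≤ ∑ i, (8 / p ^ 2 * s i + 2 * K * R ^ 2 * ∑ j ∈ G.friends i, s j) :=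
        Finset.sum_le_sum fun i _ => hi i
    _ = 8 / p ^ 2 * ∑ i, s i + 2 * K * R ^ 2 * ∑ i, ∑ j ∈ G.friends i, s j := by
        rw [Finset.sum_add_distrib, Finset.mul_sum, Finset.mul_sum]
    _ ≤ 8 / p ^ 2 * ∑ i, s i + 2 * K * R ^ 2 * (c₀ * ∑ i, s i) := by
        gcongr
        exact sum_friends_le hdeg hs0
    _ = (8 / p ^ 2 + 2 * K * R ^ 2 * c₀) * ∑ i, s i := by ring
    _ ≤ (8 / p ^ 2 + 2 * K * R ^ 2 * c₀) * (4 * divergence θ c G x) :=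
        mul_le_mul_of_nonneg_left hkl (by positivity)
    _ = identConst K d M R c₀ * divergence θ c G x := by
        unfold identConst
        ring

theorem sum_ite_mul (y : Fin (K + 1)) (g : Fin (K + 1) → ℝ) :
    ∑ k, (if y = k then (1 : ℝ) else 0) * g k = g y := by
  simp

theorem abs_log_approxChoiceProb_sub_le {lam : ℝ} (hlam1 : lam < 1) {c : Param K d}
    (hc : StableAt lam c) {R : ℝ} (hcR : ‖c‖ ≤ R) (G : Network n) {x : Fin n → Fin d → ℝ} {M : ℝ}
    (hM : 0 ≤ M) (hx : ∀ j a, |x j a| ≤ M) (h : ℕ) (i : Fin n) (k : Fin (K + 1)) :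
    |Real.log (approxChoiceProb c G x h i k) - Real.log (fullProb c G x i k)|
      ≤ 2 * lam ^ h / probFloor K d M R := by
  have hp0 := probFloor_pos K d M R
  refine (abs_log_sub_log_le hp0 (probFloor_le_approxChoiceProb hlam1 hc hcR G hM hx h i k)
    (probFloor_le_fullProb hlam1 hc hcR G hM hx i k)).trans ?_
  refine div_le_div_of_nonneg_right ?_ hp0.le
  exact (Finset.single_le_sum (f := fun k => |approxChoiceProb c G x h i k - fullProb c G x i k|)
    (fun k _ => abs_nonneg _) (Finset.mem_univ k)).trans
      (sum_abs_approxChoiceProb_sub_le hlam1 hc G x h i)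

/-- The average of the residuals. -/
def meanResidual (θ c : Param K d) (G : Network n) (x : Fin n → Fin d → ℝ)
    (y : Fin n → Fin (K + 1)) : ℝ :=
  1 / (n : ℝ) * ∑ i, residual θ c G x y i

/-- The basic inequality of maximum likelihood: where the approximated likelihood is at least as
large as at the true parameter, the divergence from the truth is bounded by the average residuals
and by the error of approximation. -/
theorem divergence_le {lam : ℝ} (hlam1 : lam < 1) {θ c : Param K d}
    (hθ : StableAt lam θ) (hc : StableAt lam c) {R : ℝ} (hθR : ‖θ‖ ≤ R) (hcR : ‖c‖ ≤ R)
    {G : Network n} {x : Fin n → Fin d → ℝ} {M : ℝ} (hM : 0 ≤ M) (hx : ∀ j a, |x j a| ≤ M)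
    {h : ℕ} {y : Fin n → Fin (K + 1)}
    (hle : approxLogLik h G x y θ ≤ approxLogLik h G x y c) :
    1 / (n : ℝ) * divergence θ c G x ≤ meanResidual θ c G x y - meanResidual θ θ G x y
      + 4 * lam ^ h / probFloor K d M R := by
  have hlam : 0 ≤ lam := le_trans (by positivity) (hθ 0 0 0)
  have hp0 := probFloor_pos K d M R
  have hb : 0 ≤ 2 * lam ^ h / probFloor K d M R := by positivity
  set Lc : Fin n → ℝ := fun i =>
    Real.log (approxChoiceProb c G x h i (y i)) - Real.log (fullProb c G x i (y i)) with hLc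
  set Lθ : Fin n → ℝ := fun i =>
    Real.log (approxChoiceProb θ G x h i (y i)) - Real.log (fullProb θ G x i (y i)) with hLθ
  have e1 : ∀ e : Param K d, approxLogLik h G x y e
      = 1 / (n : ℝ) * ∑ i, Real.log (approxChoiceProb e G x h i (y i)) := fun e => by
    unfold approxLogLik
    simp only [sum_ite_mul]
  have e2 : ∀ e : Param K d, ∀ i, residual θ e G x y i = Real.log (fullProb e G x i (y i))
      - ∑ k, fullProb θ G x i k * Real.log (fullProb e G x i k) := fun e i => by
    unfold residual
    simp only [sub_mul, Finset.sum_sub_distrib, sum_ite_mul]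
  have key : 1 / (n : ℝ) * divergence θ c G x = meanResidual θ c G x y - meanResidual θ θ G x y
      - (approxLogLik h G x y c - approxLogLik h G x y θ)
      + (1 / (n : ℝ) * ∑ i, Lc i - 1 / (n : ℝ) * ∑ i, Lθ i) := by
    rw [e1, e1]
    unfold divergence meanResidual
    simp only [e2, hLc, hLθ, mul_sub, Finset.sum_sub_distrib]
    ring
  have b1 : |1 / (n : ℝ) * ∑ i, Lc i| ≤ 2 * lam ^ h / probFloor K d M R :=
    abs_average_le Finset.univ (by simp) _ hb fun i _ =>
      abs_log_approxChoiceProb_sub_le hlam1 hc hcR G hM hx h i (y i)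
  have b2 : |1 / (n : ℝ) * ∑ i, Lθ i| ≤ 2 * lam ^ h / probFloor K d M R :=
    abs_average_le Finset.univ (by simp) _ hb fun i _ =>
      abs_log_approxChoiceProb_sub_le hlam1 hθ hθR G hM hx h i (y i)
  have e3 : 4 * lam ^ h / probFloor K d M R = 2 * (2 * lam ^ h / probFloor K d M R) := by ring
  rw [key, e3]
  linarith [(abs_le.1 b1).2, (abs_le.1 b2).1]

/-- A Lipschitz constant of the average residual in the parameter. -/
def residualLip (K d : ℕ) (M R lam : ℝ) : ℝ :=
  2 * (d * M + (K + 1)) / (1 - lam) / probFloor K d M R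

theorem abs_meanResidual_sub_le {lam : ℝ} (hlam1 : lam < 1) {θ c c' : Param K d}
    (hθ : StableAt lam θ) (hc : StableAt lam c) (hc' : StableAt lam c') {R : ℝ}
    (hcR : ‖c‖ ≤ R) (hcR' : ‖c'‖ ≤ R) (G : Network n) {x : Fin n → Fin d → ℝ} {M : ℝ} (hM : 0 ≤ M)
    (hx : ∀ j a, |x j a| ≤ M) (y : Fin n → Fin (K + 1)) :
    |meanResidual θ c G x y - meanResidual θ c' G x y|
      ≤ residualLip K d M R lam * dist c c' := by
  have hp0 := probFloor_pos K d M R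
  have h1lam : 0 < 1 - lam := by linarith
  have hL : 0 ≤ residualLip K d M R lam * dist c c' := by
    unfold residualLip
    positivity
  unfold meanResidual
  rw [← mul_sub, ← Finset.sum_sub_distrib]
  refine abs_average_le Finset.univ (by simp) _ hL fun i _ => ?_
  unfold residual
  rw [← Finset.sum_sub_distrib]
  calc |∑ k, (((if y i = k then 1 else 0) - fullProb θ G x i k) * Real.log (fullProb c G x i k)
        - ((if y i = k then 1 else 0) - fullProb θ G x i k) * Real.log (fullProb c' G x i k))|
      ≤ ∑ k, |fullProb c G x i k - fullProb c' G x i k| / probFloor K d M R := by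
        refine (Finset.abs_sum_le_sum_abs _ _).trans (Finset.sum_le_sum fun k _ => ?_)
        rw [← mul_sub, abs_mul]
        have h1 := (isProbProfile_fullProb hlam1 hθ G x i).1 k
        have h2 := (le_abs_self _).trans ((isProbProfile_fullProb hlam1 hθ G x).abs_le_one i k)
        have h3 : |(if y i = k then (1 : ℝ) else 0) - fullProb θ G x i k| ≤ 1 := by
          rw [abs_le]
          split_ifs <;> constructor <;> linarith
        refine (mul_le_mul h3 (abs_log_sub_log_le hp0
          (probFloor_le_fullProb hlam1 hc hcR G hM hx i k)
          (probFloor_le_fullProb hlam1 hc' hcR' G hM hx i k)) (abs_nonneg _) zero_le_one).trans ?_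
        rw [one_mul]
    _ = (∑ k, |fullProb c G x i k - fullProb c' G x i k|) / probFloor K d M R := by
        rw [Finset.sum_div]
    _ ≤ (2 * (d * M + (K + 1)) / (1 - lam) * dist c c') / probFloor K d M R :=
        div_le_div_of_nonneg_right (sum_abs_fullProb_sub_le hlam1 hc hc' G hM hx i) hp0.le
    _ = residualLip K d M R lam * dist c c' := by
        unfold residualLip
        ring

/-- If averages of the products of regressors are close to their means, the mean matrices are
uniformly positive definite, and the regressors are nearly orthogonal to `v`, then `v` is small. -/
theorem sum_sq_le_of_average_close {ι : Type*} [Fintype ι] {w : Fin n → ι → ℝ}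
    {A : Fin n → ι → ι → ℝ} {κ η u : ℝ} (hn : 0 < n)
    (hA : ∀ i, ∀ v : ι → ℝ, κ * ∑ a, v a ^ 2 ≤ ∑ a, ∑ b, v a * A i a b * v b)
    (hclose : ∀ a b, |1 / (n : ℝ) * ∑ i, (w i a * w i b - A i a b)| ≤ η)
    (hη : η * Fintype.card ι ≤ κ / 2) {v : ι → ℝ}
    (hv : 1 / (n : ℝ) * ∑ i, (∑ a, v a * w i a) ^ 2 ≤ u) :
    κ / 2 * ∑ a, v a ^ 2 ≤ u := by
  have hn' : (0 : ℝ) < n := Nat.cast_pos.2 hn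
  set N := ∑ a, v a ^ 2 with hN
  have hN0 : 0 ≤ N := Finset.sum_nonneg fun a _ => sq_nonneg _
  set E : ι → ι → ℝ := fun a b => 1 / (n : ℝ) * ∑ i, (w i a * w i b - A i a b) with hE
  have e1 : 1 / (n : ℝ) * ∑ i, (∑ a, v a * w i a) ^ 2
      = 1 / (n : ℝ) * ∑ i, (∑ a, ∑ b, v a * A i a b * v b) + ∑ a, ∑ b, v a * E a b * v b := by
    have e2 : ∑ a, ∑ b, v a * E a b * v b
        = 1 / (n : ℝ) * ∑ i, ∑ a, ∑ b, v a * (w i a * w i b - A i a b) * v b := by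
      rw [Finset.sum_comm (s := (Finset.univ : Finset (Fin n))), Finset.mul_sum]
      refine Finset.sum_congr rfl fun a _ => ?_
      rw [Finset.sum_comm, Finset.mul_sum]
      refine Finset.sum_congr rfl fun b _ => ?_
      simp only [hE, Finset.mul_sum, Finset.sum_mul]
      exact Finset.sum_congr rfl fun i _ => by ring
    rw [e2, ← mul_add, ← Finset.sum_add_distrib]
    congr 1
    refine Finset.sum_congr rfl fun i _ => ?_
    rw [← Finset.sum_add_distrib, sq, Finset.sum_mul_sum]
    refine Finset.sum_congr rfl fun a _ => ?_
    rw [← Finset.sum_add_distrib]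
    exact Finset.sum_congr rfl fun b _ => by ring
  have e3 : κ * N ≤ 1 / (n : ℝ) * ∑ i, (∑ a, ∑ b, v a * A i a b * v b) := by
    calc κ * N = 1 / (n : ℝ) * ∑ _i : Fin n, κ * N := by
          simp
          field_simp
      _ ≤ _ := mul_le_mul_of_nonneg_left (Finset.sum_le_sum fun i _ => hA i v) (by positivity)
  have e4 : |∑ a, ∑ b, v a * E a b * v b| ≤ κ / 2 * N := by
    calc |∑ a, ∑ b, v a * E a b * v b| ≤ ∑ a, ∑ b, η * (|v a| * |v b|) := by
          refine (Finset.abs_sum_le_sum_abs _ _).trans (Finset.sum_le_sum fun a _ => ?_)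
          refine (Finset.abs_sum_le_sum_abs _ _).trans (Finset.sum_le_sum fun b _ => ?_)
          rw [abs_mul, abs_mul]
          nlinarith [mul_le_mul_of_nonneg_left (hclose a b)
            (mul_nonneg (abs_nonneg (v a)) (abs_nonneg (v b)))]
      _ = η * (∑ a, |v a|) ^ 2 := by
          rw [sq, Finset.sum_mul_sum, Finset.mul_sum]
          exact Finset.sum_congr rfl fun a _ => by rw [Finset.mul_sum]
      _ ≤ η * (Fintype.card ι * N) := by
          rcases isEmpty_or_nonempty ι with hι | ⟨⟨a⟩⟩
          · simp
          · refine mul_le_mul_of_nonneg_left ?_ ((abs_nonneg _).trans (hclose a a))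
            have := sq_sum_le_card_mul_sum_sq (s := (Finset.univ : Finset ι)) (f := fun a => |v a|)
            simpa only [sq_abs, Finset.card_univ] using this
      _ ≤ κ / 2 * N := by
          rw [← mul_assoc]
          exact mul_le_mul_of_nonneg_right hη hN0
  linarith [(abs_le.1 e4).1]

theorem dist_lt_of_sum_sq_lt {θ c : Param K d} {ε : ℝ} (hε : 0 < ε)
    (h : ∀ k, ∑ a, coefDiff θ c k a ^ 2 < ε ^ 2) : dist c θ < ε := by
  have hk : ∀ k a, |coefDiff θ c k a| < ε := fun k a => by
    refine abs_lt_of_sq_lt_sq ?_ hε.le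
    exact (Finset.single_le_sum (f := fun a => coefDiff θ c k a ^ 2) (fun a _ => sq_nonneg _)
      (Finset.mem_univ a)).trans_lt (h k)
  rw [dist_comm, Prod.dist_eq]
  refine max_lt ?_ ?_
  · refine (dist_pi_lt_iff hε).2 fun k => (dist_pi_lt_iff hε).2 fun a => ?_
    exact hk k (Sum.inl a)
  · refine (dist_pi_lt_iff hε).2 fun k => (dist_pi_lt_iff hε).2 fun ℓ => ?_
    exact hk k (Sum.inr ℓ)

/-! ### Consistency -/

theorem identConst_pos (K d : ℕ) (M R : ℝ) (c₀ : ℕ) : 0 < identConst K d M R c₀ := by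
  have := probFloor_pos K d M R
  unfold identConst
  positivity

/-- The deterministic part of the consistency proof: when the average residuals are small on a net
of the parameter space, the averages of products of regressors are close to their means, and the
radius is large, every parameter at which the approximated likelihood is at least as large as at
`θ` is close to `θ`. -/
theorem dist_lt_of_good_event {lam : ℝ} (hlam1 : lam < 1) {Θ : Set (Param K d)}
    (hst : ∀ c ∈ Θ, StableAt lam c) {R : ℝ} (hR : ∀ c ∈ Θ, ‖c‖ ≤ R) {θ c : Param K d}
    (hθ : θ ∈ Θ) (hc : c ∈ Θ) {G : Network n} {x : Fin n → Fin d → ℝ} {M : ℝ} (hM : 0 ≤ M)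
    (hx : ∀ j a, |x j a| ≤ M) {c₀ : ℕ} (hdeg : ∀ i, G.inDegree i ≤ c₀) {h : ℕ}
    {y : Fin n → Fin (K + 1)} (hle : approxLogLik h G x y θ ≤ approxLogLik h G x y c)
    {T : Set (Param K d)} {e η η' κ ε : ℝ} (hTΘ : T ⊆ Θ) (hT : Θ ⊆ ⋃ b ∈ T, Metric.ball b e)
    (hres : ∀ b ∈ T, |meanResidual θ b G x y| ≤ η) (hn : 0 < n)
    {A : Fin n → Fin d ⊕ Fin K → Fin d ⊕ Fin K → ℝ}
    (hA : ∀ i, ∀ v : Fin d ⊕ Fin K → ℝ, κ * ∑ a, v a ^ 2 ≤ ∑ a, ∑ b, v a * A i a b * v b)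
    (hclose : ∀ a b, |1 / (n : ℝ) * ∑ i,
      (eqRegressor θ G x i a * eqRegressor θ G x i b - A i a b)| ≤ η')
    (hη' : η' * Fintype.card (Fin d ⊕ Fin K) ≤ κ / 2) (hκ : 0 < κ) (hε : 0 < ε)
    (hsmall : identConst K d M R c₀ * (2 * (η + residualLip K d M R lam * e)
      + 4 * lam ^ h / probFloor K d M R) < κ / 2 * ε ^ 2) : dist c θ < ε := by
  have hL : 0 ≤ residualLip K d M R lam := by
    have hp0 := probFloor_pos K d M R
    have h1lam : 0 < 1 - lam := by linarith
    unfold residualLip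
    positivity
  have hnet : ∀ b ∈ Θ, |meanResidual θ b G x y| ≤ η + residualLip K d M R lam * e := by
    intro b hb
    obtain ⟨b', hb', hbb'⟩ := Set.mem_iUnion₂.1 (hT hb)
    have h1 := abs_meanResidual_sub_le hlam1 (hst θ hθ) (hst b hb) (hst b' (hTΘ hb')) (hR b hb)
      (hR b' (hTΘ hb')) G hM hx y
    have h2 := mul_le_mul_of_nonneg_left (Metric.mem_ball.1 hbb').le hL
    have h3 := abs_sub_abs_le_abs_sub (meanResidual θ b G x y) (meanResidual θ b' G x y)
    linarith [hres b' hb']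
  have hdiv := divergence_le hlam1 (hst θ hθ) (hst c hc) (hR θ hθ) (hR c hc) hM hx hle
  have hdiv' : 1 / (n : ℝ) * divergence θ c G x
      ≤ 2 * (η + residualLip K d M R lam * e) + 4 * lam ^ h / probFloor K d M R := by
    linarith [(abs_le.1 (hnet c hc)).2, (abs_le.1 (hnet θ hθ)).1]
  refine dist_lt_of_sum_sq_lt hε fun k => ?_
  have hid := sum_sq_coefDiff_le hlam1 (hst θ hθ) (hst c hc) (hR θ hθ) (hR c hc) hM hx hdeg k
  have hv : 1 / (n : ℝ) * ∑ i, (∑ a, coefDiff θ c k a * eqRegressor θ G x i a) ^ 2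
      ≤ identConst K d M R c₀ * (2 * (η + residualLip K d M R lam * e)
        + 4 * lam ^ h / probFloor K d M R) := by
    refine (mul_le_mul_of_nonneg_left hid (by positivity)).trans ?_
    rw [mul_left_comm]
    exact mul_le_mul_of_nonneg_left hdiv' (identConst_pos K d M R c₀).le
  have hfin := (sum_sq_le_of_average_close hn hA hclose hη' hv).trans_lt hsmall
  exact lt_of_mul_lt_mul_left hfin (by positivity)

theorem tendsto_ofReal_mul_inv (C : ℝ) :
    Tendsto (fun n : ℕ => ENNReal.ofReal (C * (n : ℝ)⁻¹)) atTop (𝓝 0) := by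
  have h := ENNReal.tendsto_ofReal ((tendsto_inv_atTop_nhds_zero_nat (𝕜 := ℝ)).const_mul C)
  simpa using h

end NetworkGame

end

theorem mainTheorem2
    {K d : ℕ}
    -- the parameter space and the true parameter
    (Θ : Set (NetworkGame.Param K d)) (hΘ : IsCompact Θ)
    (θ : NetworkGame.Param K d) (hθ : θ ∈ Θ)
    -- bounded strength of interaction, over the whole parameter space
    (hstable : ∃ lam : ℝ, lam < 1 ∧ ∀ c ∈ Θ, ∀ k m ℓ : Fin (K + 1),
      (K : ℝ) / (K + 1) * |NetworkGame.alpha c k ℓ - NetworkGame.alpha c m ℓ| ≤ lam)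
    -- for each size `n`: the network, the covariates and the private shocks
    {Ω : ℕ → Type*} [∀ n, MeasurableSpace (Ω n)]
    (μ : ∀ n, MeasureTheory.Measure (Ω n)) [∀ n, MeasureTheory.IsProbabilityMeasure (μ n)]
    (F : ∀ n, Ω n → NetworkGame.Network n) (hF : ∀ n, Measurable (F n))
    (X : ∀ n, Ω n → Fin n → Fin d → ℝ) (hX : ∀ n, Measurable (X n))
    (ξ : ∀ n, Ω n → Fin n → Fin (K + 1) → ℝ) (hξ : ∀ n, Measurable (ξ n))
    (hshock : ∀ n, NetworkGame.ExtremeValueShocks (μ n) (F n) (X n) (ξ n))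
    -- the observed actions are those of the equilibrium at the true parameter
    (r : ∀ n, NetworkGame.Network n → (Fin n → Fin d → ℝ) → NetworkGame.Profile K n)
    (hr : ∀ n G x, NetworkGame.IsBNE θ G x (r n G x))
    (Y : ∀ n, Ω n → Fin n → Fin (K + 1))
    (hY : ∀ n, ∀ᵐ ω ∂(μ n), ∀ i, Y n ω i = r n (F n ω) (X n ω) i (ξ n ω i))
    -- rank condition for large `n`
    (hrank : ∃ κ : ℝ, 0 < κ ∧ ∀ᶠ n in Filter.atTop, ∀ i : Fin n,
      κ ≤ (NetworkGame.secondMoment (μ n) (r n) (F n) (X n) i).det)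
    -- bounded support of covariates and numbers of friends
    (hbdd : ∃ M : ℝ, ∀ n, ∀ᵐ ω ∂(μ n), ∀ i : Fin n,
      (∀ a, |X n ω i a| ≤ M) ∧ ((F n ω).outDegree i : ℝ) ≤ M)
    -- distribution of the network and of the covariates
    (hconv : NetworkGame.LocallyConvergent μ F)
    (hindep : ∀ n, NetworkGame.IndependentSubgraphs (μ n) (F n))
    (hiid : ∀ n, NetworkGame.IIDCovariates (μ n) (F n) (X n))
    -- uniformly bounded in-degree
    (hdeg : ∃ c₀ : ℕ, ∀ n, ∀ᵐ ω ∂(μ n), ∀ i : Fin n, (F n ω).inDegree i ≤ c₀)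
    -- the radius of the approximating games
    (h : ℕ → ℕ) (hh : Filter.Tendsto h Filter.atTop Filter.atTop)
    -- the approximated maximum likelihood estimator
    (θhat : ∀ n, Ω n → NetworkGame.Param K d)
    (hmax : ∀ n, ∀ᵐ ω ∂(μ n), θhat n ω ∈ Θ ∧
      IsMaxOn (NetworkGame.approxLogLik (h n) (F n ω) (X n ω) (Y n ω)) Θ (θhat n ω)) :
    ∀ ε : ℝ, 0 < ε →
      Filter.Tendsto (fun n => μ n {ω | ε ≤ dist (θhat n ω) θ}) Filter.atTop (nhds 0) := by
  intro ε hε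
  obtain ⟨lam, hlam1, hst⟩ := hstable
  have hst' : ∀ c ∈ Θ, NetworkGame.StableAt lam c := hst
  have hlam : 0 ≤ lam := le_trans (by positivity) (hst θ hθ 0 0 0)
  obtain ⟨κ, hκ, hrank⟩ := hrank
  obtain ⟨M₀, hM₀⟩ := hbdd
  obtain ⟨c₀, hc₀⟩ := hdeg
  obtain ⟨R, hR⟩ := hΘ.isBounded.exists_norm_le
  set M : ℝ := max M₀ 1 with hMdef
  have hM1 : 1 ≤ M := le_max_right _ _
  have hM0 : 0 ≤ M := by linarith
  have hXM : ∀ n, ∀ᵐ ω ∂(μ n), ∀ i a, |X n ω i a| ≤ M := fun n => by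
    filter_upwards [hM₀ n] with ω hω i a
    exact ((hω i).1 a).trans (le_max_left _ _)
  have hq : ∀ n, ∀ᵐ ω ∂(μ n), ∀ i, ((F n ω).friends i).card ≤ ⌈M⌉₊ := fun n => by
    filter_upwards [hM₀ n] with ω hω i
    have h1 : (((F n ω).friends i).card : ℝ) ≤ M := (hω i).2.trans (le_max_left _ _)
    exact_mod_cast h1.trans (Nat.le_ceil M)
  obtain ⟨κ', hκ', hquad⟩ :=
    NetworkGame.exists_forall_mul_le_quadratic (ι := Fin d ⊕ Fin K) (M * M) hκ
  set p := NetworkGame.probFloor K d M R with hp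
  have hp0 : 0 < p := NetworkGame.probFloor_pos K d M R
  set C := NetworkGame.identConst K d M R c₀ with hC
  have hC0 : 0 < C := NetworkGame.identConst_pos K d M R c₀
  set L := NetworkGame.residualLip K d M R lam with hL
  have hL0 : 0 ≤ L := by
    have h1lam : 0 < 1 - lam := by linarith
    simp only [hL, NetworkGame.residualLip]
    positivity
  -- `u` is the size of the mean divergence that is allowed; its three sources get a quarter, a
  -- quarter and a half.
  set u : ℝ := κ' / 2 * ε ^ 2 / (2 * C) with hu
  have hu0 : 0 < u := by positivity
  have hCu : C * u < κ' / 2 * ε ^ 2 := by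
    have h1 : C * u = κ' / 2 * ε ^ 2 / 2 := by
      rw [hu]
      field_simp
    have h2 : 0 < κ' / 2 * ε ^ 2 := by positivity
    rw [h1]
    linarith
  set η' : ℝ := κ' / (2 * (Fintype.card (Fin d ⊕ Fin K) + 1)) with hη'
  have hη'0 : 0 < η' := by positivity
  have hη'card : η' * Fintype.card (Fin d ⊕ Fin K) ≤ κ' / 2 := by
    rw [hη', div_mul_eq_mul_div, div_le_div_iff₀ (by positivity) (by norm_num)]
    nlinarith
  set e : ℝ := u / (8 * (L + 1)) with he
  have he0 : 0 < e := by positivity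
  have hLe : L * e ≤ u / 8 := by
    rw [he, mul_div_assoc', div_le_div_iff₀ (by positivity) (by norm_num)]
    nlinarith
  obtain ⟨T, hTΘ, hTfin, hT⟩ := hΘ.finite_cover_balls he0
  have hpow : Filter.Tendsto (fun t : ℕ => lam ^ t) Filter.atTop (nhds 0) :=
    tendsto_pow_atTop_nhds_zero_of_lt_one hlam hlam1
  obtain ⟨t, ht⟩ : ∃ t : ℕ, 4 * M * lam ^ t ≤ η' / 4 := by
    have h1 : Filter.Tendsto (fun t : ℕ => 4 * M * lam ^ t) Filter.atTop (nhds 0) := by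
      simpa using hpow.const_mul (4 * M)
    exact (h1.eventually_le_const (by positivity)).exists
  have hrad : ∀ᶠ n in Filter.atTop, 4 * lam ^ h n / p ≤ u / 2 := by
    have h1 : Filter.Tendsto (fun n => 4 * lam ^ h n / p) Filter.atTop (nhds 0) := by
      simpa using ((hpow.comp hh).const_mul 4).div_const p
    exact h1.eventually_le_const (by positivity)
  set C₁ : ℝ := NetworkGame.residualBound K d M R ^ 2 / (u / 8) ^ 2 with hC₁
  set C₂ : ℝ := 4 * (M * M) ^ 2 * ((1 + ⌈M⌉₊) ^ (t + 1) * (1 + c₀) ^ (t + 1) : ℕ)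
    / (η' / 2) ^ 2 with hC₂
  have hlim : Filter.Tendsto (fun n : ℕ => ∑ _b ∈ hTfin.toFinset, ENNReal.ofReal (C₁ * (n : ℝ)⁻¹)
      + ∑ _a : Fin d ⊕ Fin K, ∑ _b : Fin d ⊕ Fin K, ENNReal.ofReal (C₂ * (n : ℝ)⁻¹))
      Filter.atTop (nhds 0) := by
    have h1 := (tendsto_finsetSum hTfin.toFinset fun _ _ =>
      NetworkGame.tendsto_ofReal_mul_inv C₁).add
        (tendsto_finsetSum (Finset.univ : Finset (Fin d ⊕ Fin K)) fun _ _ =>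
          tendsto_finsetSum (Finset.univ : Finset (Fin d ⊕ Fin K)) fun _ _ =>
            NetworkGame.tendsto_ofReal_mul_inv C₂)
    simpa using h1
  refine tendsto_of_tendsto_of_tendsto_of_le_of_le' tendsto_const_nhds hlim
    (Filter.Eventually.of_forall fun _ => zero_le) ?_
  filter_upwards [hrank, hrad, Filter.eventually_gt_atTop 0] with n hrn hradn hn
  set B₁ : NetworkGame.Param K d → Set (Ω n) := fun b =>
    {ω | u / 8 ≤ |1 / (n : ℝ) * ∑ i, NetworkGame.residual θ b (F n ω) (X n ω) (Y n ω) i|} with hB₁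
  set B₂ : Fin d ⊕ Fin K → Fin d ⊕ Fin K → Set (Ω n) := fun a b =>
    {ω | η' ≤ |1 / (n : ℝ) * ∑ i, (NetworkGame.eqRegressor θ (F n ω) (X n ω) i a *
      NetworkGame.eqRegressor θ (F n ω) (X n ω) i b
        - NetworkGame.eqMoment (μ n) θ (F n) (X n) i a b)|} with hB₂
  have hA : ∀ i : Fin n, ∀ v : Fin d ⊕ Fin K → ℝ, κ' * ∑ a, v a ^ 2
      ≤ ∑ a, ∑ b, v a * NetworkGame.eqMoment (μ n) θ (F n) (X n) i a b * v b := fun i =>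
    hquad _ (NetworkGame.posSemidef_eqMoment hlam1 (hst' θ hθ) (hF n) (hX n) hM1 (hXM n) i)
      (NetworkGame.abs_eqMoment_le hlam1 (hst' θ hθ) hM1 (hXM n) i)
      ((hrn i).trans_eq (congrArg Matrix.det
        (NetworkGame.secondMoment_eq (μ := μ n) hlam1 (hst' θ hθ) (hr n) i)))
  have hsub : {ω | ε ≤ dist (θhat n ω) θ} ≤ᵐ[μ n]
      ((⋃ b ∈ hTfin.toFinset, B₁ b) ∪ ⋃ a ∈ Finset.univ, ⋃ b ∈ Finset.univ, B₂ a b : Set (Ω n)) := by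
    filter_upwards [hXM n, hc₀ n, hmax n] with ω h1 h2 h3 hbad
    by_contra hgood
    replace hgood : ω ∉ ((⋃ b ∈ hTfin.toFinset, B₁ b) ∪
      ⋃ a ∈ Finset.univ, ⋃ b ∈ Finset.univ, B₂ a b : Set (Ω n)) := hgood
    have hg1 : ∀ b ∈ T, |NetworkGame.meanResidual θ b (F n ω) (X n ω) (Y n ω)| ≤ u / 8 :=
      fun b hb => by
        by_contra hlt
        exact hgood (Set.mem_union_left _ (Set.mem_biUnion (hTfin.mem_toFinset.2 hb)
          (not_le.1 hlt).le))
    have hg2 : ∀ a b, |1 / (n : ℝ) * ∑ i, (NetworkGame.eqRegressor θ (F n ω) (X n ω) i a *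
        NetworkGame.eqRegressor θ (F n ω) (X n ω) i b
          - NetworkGame.eqMoment (μ n) θ (F n) (X n) i a b)| ≤ η' := fun a b => by
      by_contra hlt
      exact hgood (Set.mem_union_right _ (Set.mem_biUnion (Finset.mem_univ a)
        (Set.mem_biUnion (Finset.mem_univ b) (not_le.1 hlt).le)))
    refine absurd (NetworkGame.dist_lt_of_good_event hlam1 hst' hR hθ h3.1 hM0 h1 h2 (h3.2 hθ)
      hTΘ hT hg1 hn hA hg2 hη'card hκ' hε (lt_of_le_of_lt ?_ hCu)) (not_lt.2 hbad)
    refine mul_le_mul_of_nonneg_left ?_ hC0.le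
    linarith
  calc μ n {ω | ε ≤ dist (θhat n ω) θ}
      ≤ μ n (⋃ b ∈ hTfin.toFinset, B₁ b)
        + μ n (⋃ a ∈ Finset.univ, ⋃ b ∈ Finset.univ, B₂ a b) :=
        (MeasureTheory.measure_mono_ae hsub).trans (MeasureTheory.measure_union_le _ _)
    _ ≤ _ := by
        refine add_le_add ((MeasureTheory.measure_biUnion_finset_le _ _).trans
          (Finset.sum_le_sum fun b hb => ?_))
          ((MeasureTheory.measure_biUnion_finset_le _ _).trans
            (Finset.sum_le_sum fun a _ => (MeasureTheory.measure_biUnion_finset_le _ _).trans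
              (Finset.sum_le_sum fun b _ => ?_)))
        · have hbΘ : b ∈ Θ := hTΘ (hTfin.mem_toFinset.1 hb)
          exact NetworkGame.measure_residual_ge_le hlam1 (hst' θ hθ) (hst' b hbΘ) (hR b hbΘ)
            (hF n) (hX n) (hξ n) (hshock n) (hr n) (hY n) hM0 (hXM n) hn (by positivity)
        · exact NetworkGame.measure_regressor_average_ge_le hlam1 (hst' θ hθ) (hF n) (hX n) hM1
            (hXM n) (hiid n) (hindep n) (hq n) (hc₀ n) hn hη'0 ht a b
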